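/- Let $1\le M<N$ and consider $K$ users with channel matrices $H_k=R_k^{1/2}\widetilde H_k\in\mathbb{C}^{M\times N}$, where the receive correlation matrices $R_k$ are arbitrary positive-definite matrices and all entries of $\widetilde H_1,\dots,\widetilde H_K$ are i.i.d. $\mathcal{CN}(0,1)$. Users know their own channels. A set $\mathcal S$ of users, fixed independently of the channels, is scheduled; each scheduled user feeds back, with $B=B(P)\in\mathbb{N}$ error-free bits, the index of a codeword from its own random codebook of $2^{B}$ semi-unitary $N\times d$ matrices ($U^HU=I_d$) whose column spaces are independent and isotropically distributed; the codebooks are independent across users and independent of the channels (random vector quantization). The chordal distance between a $d\times N$ matrix $G$ and a codeword $U$ is $\delta(G,U)=\sqrt{d-\mathrm{tr}(V^HUU^HV)}$, where the columns of $V$ form an orthonormal basis of the span of the columns of $G^H$ (in the general case: $\delta(G,U)=\sqrt{d-\|\Pi_G U\|_F^2}$, with $\Pi_G$ the orthogonal projection onto that span). **BD (block-diagonalization).** Here $d=M$, $M$ divides $N$, and $|\mathcal S|=N/M$. User $k$ feeds back a codeword $\bar H_k$ minimizing $\delta(H_k,\cdot)$ over its codebook. The precoders $W_k\in\mathbb{C}^{N\times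 M}$, $k\in\mathcal S$, satisfy $W_k^HW_k=I_M$ and $\bar H_\ell^HW_k=0$ for all $\ell\in\mathcal S\setminus\{k\}$, and the rate of user $k$ is $$g_k(P)=\log_2\frac{\det\big(I_M+\frac{P}{M|\mathcal S|}\sum_{\ell\in\mathcal S}H_kW_\ell W_\ell^HH_k^H\big)}{\det\big(I_M+\frac{P}{M|\mathcal S|}\sum_{\ell\in\mathcal S\setminus\{k\}}H_kW_\ell W_\ell^HH_k^H\big)} .$$ **ZFC (zero-forcing with combining).** Here $d=1$ and $|\mathcal S|=N$. User $k$ chooses a unit-norm combiner $c_k\in\mathbb{C}^M$ and a codeword $\bar h_k$ of its codebook that jointly minimize $\delta(c_k^HH_k,\bar h_k)$ (quantization-based combining). The precoders $w_k\in\mathbb{C}^N$, $k\in\mathcal S$, satisfy $\|w_k\|=1$ and $\bar h_\ell^Hw_k=0$ for all $\ell\in\mathcal S\setminus\{k\}$, and the rate of user $k$ is $$g_k(P)=\log_2\Big(1+\frac{\frac{P}{|\mathcal S|}|c_k^HH_kw_k|^2}{1+\sum_{\ell\in\mathcal S\setminus\{k\}}\frac{P}{|\mathcal S|}|c_k^HH_kw_\ell|^2}\Big).$$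 Then, with either strategy, if the total number $B_{\mathrm{total}}(P)=|\mathcal S|\,B(P)$ of feedback bits of the scheduled users satisfies $$B_{\mathrm{total}}(P)=N(N-M)\log_2P+\mathcal O(1)\qquad(P\to\infty),$$ the full multiplexing gain $N$ is achieved: the expected sum rate is finite for every $P>0$ and $$\mathbb{E}\Big\{\sum_{k\in\mathcal S}g_k(P)\Big\}=N\log_2P+\mathcal O(1)\qquad(P\to\infty),$$ so that its ratio to $\log_2 P$ tends to $N$. -/

import Mathlib

open MeasureTheory ProbabilityTheory Filter Topology
open scoped Matrix MatrixOrder ComplexOrder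

noncomputable section

namespace LimitedFeedback

/-- Matrices carry the product σ-algebra of their entries. -/
instance matrixMeasurableSpace {m n : Type*} : MeasurableSpace (Matrix m n ℂ) :=
  inferInstanceAs (MeasurableSpace (m → n → ℂ))

/-- The circularly-symmetric complex Gaussian law `CN(0,1)`: independent real and imaginary parts,
both centred Gaussian with variance `1/2`. -/
def complexGaussian : Measure ℂ :=
  ((gaussianReal 0 (1 / 2)).prod (gaussianReal 0 (1 / 2))).map (fun p : ℝ × ℝ => Complex.mk p.1 p.2)

/-- A matrix with orthonormal columns. -/
def IsSemiUnitary {m n : Type*} [Fintype m] [DecidableEq n] (U : Matrix m n ℂ) : Prop :=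
  Uᴴ * U = 1

/-- The uncorrelated fading matrices: all entries, over all users, are i.i.d. `CN(0,1)`. -/
structure IsRayleighFading {Ω : Type*} [MeasurableSpace Ω] (μ : Measure Ω) {K M N : ℕ}
    (Ht : Fin K → Ω → Matrix (Fin M) (Fin N) ℂ) : Prop where
  measurable : ∀ k, Measurable (Ht k)
  law : ∀ k i j, μ.map (fun ω => Ht k ω i j) = complexGaussian
  indep : iIndepFun (fun (p : Fin K × Fin M × Fin N) ω => Ht p.1 ω p.2.1 p.2.2) μ

/-- The channel matrix `R^{1/2} H̃` with receive correlation matrix `R`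
(`R^{1/2}` is the positive semidefinite square root). -/
def channel {M N : ℕ} (R : Matrix (Fin M) (Fin M) ℂ) (Ht : Matrix (Fin M) (Fin N) ℂ) :
    Matrix (Fin M) (Fin N) ℂ :=
  CFC.sqrt R * Ht

/-- The `j`-th column of a matrix, as a vector of the Hermitian space `ℂ^N`. -/
def column {N d : ℕ} (U : Matrix (Fin N) (Fin d) ℂ) (j : Fin d) : EuclideanSpace ℂ (Fin N) :=
  WithLp.toLp 2 (fun i => U i j)

/-- The row space of a `d × N` matrix `B`, as a subspace of the column vectors `ℂ^N`:
the span of the columns of `Bᴴ`. -/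
def rowSpace {N d : ℕ} (B : Matrix (Fin d) (Fin N) ℂ) : Submodule ℂ (EuclideanSpace ℂ (Fin N)) :=
  Submodule.span ℂ (Set.range (column Bᴴ))

/-- The chordal distance between the row space of `B` and the column space of the semi-unitary `U`,
`√(d - tr(Vᴴ U Uᴴ V))`, where the columns of `V` form an orthonormal basis of the row space of `B`.
Here `tr(Vᴴ U Uᴴ V)` is written as the sum of the squared lengths of the orthogonal projections
of the columns of `U` onto the row space. -/
def chordalDist {N d : ℕ} (B : Matrix (Fin d) (Fin N) ℂ) (U : Matrix (Fin N) (Fin d) ℂ) : ℝ :=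
  Real.sqrt ((d : ℝ) - ∑ j, ‖(rowSpace B).starProjection (column U j)‖ ^ 2)

/-- The chordal distance is given by the trace formula, for any orthonormal basis of the row space. -/
theorem chordalDist_eq {N d : ℕ} (B : Matrix (Fin d) (Fin N) ℂ) (U V : Matrix (Fin N) (Fin d) ℂ)
    (hV : IsSemiUnitary V)
    (hspan : Submodule.span ℂ (Set.range (column V)) = rowSpace B) :
    chordalDist B U = Real.sqrt ((d : ℝ) - (Vᴴ * U * Uᴴ * V).trace.re) := by
  unfold chordalDist
  have hon : Orthonormal ℂ (column V) := by
    rw [orthonormal_iff_ite]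
    intro i j
    have := congrFun (congrFun hV i) j
    simp only [Matrix.mul_apply, Matrix.conjTranspose_apply, Matrix.one_apply] at this
    rw [← this]
    simp [column, PiLp.inner_apply, mul_comm]
  have key : ∀ x, ‖(rowSpace B).starProjection x‖^2 = ∑ i, ‖inner ℂ (column V i) x‖^2 := by
    intro x
    have hmem : ∀ i, column V i ∈ rowSpace B := fun i => by
      rw [← hspan]; exact Submodule.subset_span ⟨i, rfl⟩
    let v : Fin d → rowSpace B := fun i => ⟨column V i, hmem i⟩
    have hv : Orthonormal ℂ v := by
      rw [orthonormal_iff_ite] at hon ⊢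
      exact hon
    have hsp : ⊤ ≤ Submodule.span ℂ (Set.range v) := by
      rintro ⟨y, hy⟩ -
      have : y ∈ Submodule.span ℂ (Set.range (column V)) := by rw [hspan]; exact hy
      have h2 : Set.range (column V) = (rowSpace B).subtype '' Set.range v := by
        rw [← Set.range_comp]; rfl
      rw [h2, Submodule.span_image] at this
      obtain ⟨z, hz, hzy⟩ := this
      have : z = ⟨y, hy⟩ := Subtype.ext hzy
      rwa [← this]
    let b := OrthonormalBasis.mk hv hsp
    rw [Submodule.starProjection_apply, ← Submodule.coe_norm, ← b.sum_sq_norm_inner_right]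
    refine Finset.sum_congr rfl fun i _ => ?_
    simp [b, v]
  congr 2
  simp_rw [key]
  have e : Vᴴ * U * Uᴴ * V = (Vᴴ * U) * (Vᴴ * U)ᴴ := by
    simp [Matrix.conjTranspose_mul, Matrix.mul_assoc]
  rw [e, Finset.sum_comm, Matrix.trace, Complex.re_sum]
  refine Finset.sum_congr rfl fun i _ => ?_
  rw [Matrix.diag_apply, Matrix.mul_apply, Complex.re_sum]
  refine Finset.sum_congr rfl fun j _ => ?_
  have : inner ℂ (column V i) (column U j) = (Vᴴ * U) i j := by
    simp [column, PiLp.inner_apply, Matrix.mul_apply, mul_comm]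
  rw [this, Matrix.conjTranspose_apply, ← Complex.normSq_eq_norm_sq]
  simp [Complex.normSq_apply]

/-- Random vector quantization with `n` codewords per user: every codeword is a semi-unitary
`N × d` matrix whose column space is isotropically distributed on the Grassmannian (the law of the
orthogonal projection `U Uᴴ` is invariant under unitary rotations), all codewords of all users are
independent, and the codebooks are independent of the channels. -/
structure IsRVQ {Ω : Type*} [MeasurableSpace Ω] (μ : Measure Ω) {K M N d n : ℕ}
    (Ht : Fin K → Ω → Matrix (Fin M) (Fin N) ℂ)
    (U : Fin K → Fin n → Ω → Matrix (Fin N) (Fin d) ℂ) : Prop where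
  measurable : ∀ k i, Measurable (U k i)
  semiUnitary : ∀ k i ω, IsSemiUnitary (U k i ω)
  isotropic : ∀ k i, ∀ Q ∈ Matrix.unitaryGroup (Fin N) ℂ,
    μ.map (fun ω => Q * (U k i ω * (U k i ω)ᴴ) * Qᴴ) = μ.map (fun ω => U k i ω * (U k i ω)ᴴ)
  indep : iIndepFun (fun p : Fin K × Fin n => U p.1 p.2) μ
  indep_channel : IndepFun (fun ω k => Ht k ω) (fun ω k i => U k i ω) μ

/-- A measurable rule that maps a codebook of `n` codewords and a `d × N` channel matrix to (the
index of) a codeword of minimal chordal distance; ties may be broken in any way. -/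
structure IsChordalQuantizer {N d n : ℕ}
    (q : (Fin n → Matrix (Fin N) (Fin d) ℂ) → Matrix (Fin d) (Fin N) ℂ → Fin n) : Prop where
  measurable : Measurable
    (fun p : (Fin n → Matrix (Fin N) (Fin d) ℂ) × Matrix (Fin d) (Fin N) ℂ => q p.1 p.2)
  isMin : ∀ (C : Fin n → Matrix (Fin N) (Fin d) ℂ) (H : Matrix (Fin d) (Fin N) ℂ) (i : Fin n),
    chordalDist H (C (q C H)) ≤ chordalDist H (C i)

/-- Quantization-based combining: a measurable rule that maps a codebook of `n` unit vectors and an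
`M × N` channel matrix `H` to a unit-norm receive combiner `c` and (the index of) a codeword, chosen
jointly so that the chordal distance between the effective channel `cᴴ H` and the codeword is
minimal; ties may be broken in any way. -/
structure IsQBC {M N n : ℕ}
    (q : (Fin n → Matrix (Fin N) (Fin 1) ℂ) → Matrix (Fin M) (Fin N) ℂ →
      Matrix (Fin M) (Fin 1) ℂ × Fin n) : Prop where
  measurable : Measurable
    (fun p : (Fin n → Matrix (Fin N) (Fin 1) ℂ) × Matrix (Fin M) (Fin N) ℂ => q p.1 p.2)
  unit : ∀ C H, IsSemiUnitary (q C H).1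
  isMin : ∀ (C : Fin n → Matrix (Fin N) (Fin 1) ℂ) (H : Matrix (Fin M) (Fin N) ℂ)
    (c : Matrix (Fin M) (Fin 1) ℂ) (i : Fin n), IsSemiUnitary c →
    chordalDist ((q C H).1ᴴ * H) (C (q C H).2) ≤ chordalDist (cᴴ * H) (C i)

/-- The precoders `W k` of the users scheduled in `S` are computed by zero-forcing from the fed-back
channel subspaces `Hb ℓ`, treated as if they were the true (effective) channels: `W k` is
semi-unitary and orthogonal to the fed-back subspaces of all co-users. With `d = M` this is
block-diagonalization, with `d = 1` it is zero-forcing with combining. -/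
structure IsZeroForcingPrecoder {Ω : Type*} [MeasurableSpace Ω] {K N d : ℕ} (S : Finset (Fin K))
    (Hb W : Fin K → Ω → Matrix (Fin N) (Fin d) ℂ) : Prop where
  measurable : ∀ k ∈ S, Measurable (W k)
  semiUnitary : ∀ k ∈ S, ∀ ω, IsSemiUnitary (W k ω)
  orthogonal : ∀ k ∈ S, ∀ l ∈ S, l ≠ k → ∀ ω, (Hb l ω)ᴴ * W k ω = 0

/-- The information rate of user `k` under block-diagonalization with the precoders `W`, equal power
allocation `P / (M |S|)` per stream, and the remaining inter-user interference treated as noise. -/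
def rateBD {K M N : ℕ} (S : Finset (Fin K)) (P : ℝ) (H : Matrix (Fin M) (Fin N) ℂ)
    (W : Fin K → Matrix (Fin N) (Fin M) ℂ) (k : Fin K) : ℝ :=
  Real.logb 2
    ((1 + ∑ l ∈ S, ((P / (M * S.card) : ℝ) : ℂ) • (H * W l * (W l)ᴴ * Hᴴ)).det.re /
      (1 + ∑ l ∈ S.erase k, ((P / (M * S.card) : ℝ) : ℂ) • (H * W l * (W l)ᴴ * Hᴴ)).det.re)

/-- The information rate of user `k` under zero-forcing with the receive combiner `c`, the precoders
`w`, equal power allocation `P / |S|`, and the remaining interference treated as noise. -/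
def rateZFC {K M N : ℕ} (S : Finset (Fin K)) (P : ℝ) (H : Matrix (Fin M) (Fin N) ℂ)
    (c : Matrix (Fin M) (Fin 1) ℂ) (w : Fin K → Matrix (Fin N) (Fin 1) ℂ) (k : Fin K) : ℝ :=
  Real.logb 2 (1 + (P / S.card) * ‖(cᴴ * H * w k) 0 0‖ ^ 2 /
    (1 + ∑ l ∈ S.erase k, (P / S.card) * ‖(cᴴ * H * w l) 0 0‖ ^ 2))

/-- The total number of feedback bits `Btot P` scales as `a log₂ P + O(1)` when `P → ∞`. -/
def ScalesAs (Btot : ℝ → ℝ) (a : ℝ) : Prop :=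
  (fun P => Btot P - a * Real.logb 2 P) =O[atTop] (fun _ => (1 : ℝ))

/-- The random sum rate `f P` (with transmit power `P`) has a well-defined expectation, which achieves
the multiplexing gain `m`: it is `m log₂ P + O(1)` as `P → ∞`; in particular its ratio to
`log₂ P` tends to `m`. -/
structure AchievesMultiplexingGain {Ω : Type*} [MeasurableSpace Ω] (μ : Measure Ω)
    (f : ℝ → Ω → ℝ) (m : ℝ) : Prop where
  integrable : ∀ P, 0 < P → Integrable (f P) μ
  bounded_offset : (fun P => (∫ ω, f P ω ∂μ) - m * Real.logb 2 P) =O[atTop] (fun _ => (1 : ℝ))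
  slope : Tendsto (fun P => (∫ ω, f P ω ∂μ) / Real.logb 2 P) atTop (𝓝 m)

end LimitedFeedback

end

open MeasureTheory ProbabilityTheory Filter Topology
open scoped Matrix MatrixOrder ComplexOrder

noncomputable section

namespace LimitedFeedback

/-! From above, each rate is at most `d log₂ P` plus an integrable variable independent of the
power. From below it is at least `d log₂ P`, plus the logarithm of the gain of the user's own
precoder, minus `P` times the leakage of the co-users' precoders, up to constants. Hence it suffices
that the expected leakage is `O(1/P)` and that the expected logarithmic gain is bounded below
uniformly in `P`.

Leakage. A co-user's precoder is orthogonal to the fed-back codeword, so the leakage is at most the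
channel energy times the squared quantization error (`frobSq_mul_le_chordalDist`). With `V` an
orthonormal basis of the `M`-dimensional row space, this error is at most the minimum of `d - ‖Vᴴ U
i‖²` over the codebook, in both strategies: combining can point the effective channel at the
projection of any codeword. The Grassmannian is covered by about `ε ^ (-d (N - M))` neighbourhoods
of `M`-dimensional subspaces (`exists_covering_grid`), which are equally likely by isotropy. So a
codeword is `ε`-close to a given row space with probability at least `c ε ^ (d (N - M))`, and the
best of `2 ^ B` codewords has mean error `O(2 ^ (-B / (d (N - M))))` (`exists_distortion_bound`).
Since `d |S| = N`, the bit budget means `B = d (N - M) log₂ P + O(1)` per user, and the error is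
`O(1/P)`.

Gain. The complex Gaussian density is bounded and `1/|z|` is locally integrable in the plane, so the
mean of `1/|det (G W)|` is bounded uniformly in the semi-unitary `W` (`lintegral_det_mul_le`); then
`log x ≥ -1/x` bounds the mean logarithm. The precoder is random, but its range projection is almost
surely determined by the co-users' codewords, hence independent of the user's own channel and
codebook (`IsZeroForcingPrecoder.exists_indep_projection`). This settles block-diagonalization.

With combining, the effective channel depends on the user's own codebook. The optimal combiner
aligns it with the projection `ξ` of the selected codeword onto the row space (`IsQBC.aligned`). The
gain is therefore the product of the squared length of the effective channel, the squared length of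
the projection `β` of the precoder, and the squared cosine between `β` and `ξ`. The lengths are
controlled by Gaussian determinants. The mean inverse cosine is bounded uniformly in the codebook
size by averaging over a Gaussian direction (`lintegral_alignSum_le`); this uses that the maximizing
codeword is almost surely unique, because the projected lengths have no atoms
(`measure_frobSq_eq_zero`). -/

open scoped ENNReal

set_option linter.unusedSectionVars false

/-! ### Frobenius norm -/

section MatrixAlgebra

variable {m n p ι κ : Type*} [Fintype m] [Fintype n] [Fintype p] [Fintype ι] [Fintype κ]

/-- The squared Frobenius norm. -/
def frobSq (A : Matrix m n ℂ) : ℝ := ∑ i, ∑ j, ‖A i j‖ ^ 2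

lemma frobSq_nonneg (A : Matrix m n ℂ) : 0 ≤ frobSq A := by
  unfold frobSq; positivity

lemma frobSq_conjTranspose (A : Matrix m n ℂ) : frobSq Aᴴ = frobSq A := by
  unfold frobSq; rw [Finset.sum_comm]; simp

lemma trace_mul_conjTranspose_self (A : Matrix m n ℂ) : (A * Aᴴ).trace = (frobSq A : ℂ) := by
  simp only [Matrix.trace, Matrix.diag_apply, Matrix.mul_apply, Matrix.conjTranspose_apply, frobSq]
  push_cast
  refine Finset.sum_congr rfl fun i _ => Finset.sum_congr rfl fun j _ => ?_
  exact RCLike.mul_conj (A i j)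

lemma trace_conjTranspose_mul_self (A : Matrix m n ℂ) : (Aᴴ * A).trace = (frobSq A : ℂ) := by
  rw [Matrix.trace_mul_comm, trace_mul_conjTranspose_self]

lemma frobSq_eq_zero {A : Matrix m n ℂ} (h : frobSq A = 0) : A = 0 := by
  rw [← Matrix.trace_conjTranspose_mul_self_eq_zero_iff, trace_conjTranspose_mul_self, h]; simp

lemma frobSq_mul_le (A : Matrix m n ℂ) (B : Matrix n p ℂ) :
    frobSq (A * B) ≤ frobSq A * frobSq B := by
  have h : ∀ i k, ‖(A * B) i k‖ ^ 2 ≤ (∑ j, ‖A i j‖ ^ 2) * ∑ j, ‖B j k‖ ^ 2 := by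
    intro i k
    rw [Matrix.mul_apply]
    calc ‖∑ j, A i j * B j k‖ ^ 2 ≤ (∑ j, ‖A i j‖ * ‖B j k‖) ^ 2 := by
          gcongr
          refine (norm_sum_le _ _).trans (le_of_eq ?_)
          simp
      _ ≤ _ := Finset.sum_mul_sq_le_sq_mul_sq _ _ _
  calc frobSq (A * B) ≤ ∑ i, ∑ k, (∑ j, ‖A i j‖ ^ 2) * ∑ j, ‖B j k‖ ^ 2 :=
        Finset.sum_le_sum fun i _ => Finset.sum_le_sum fun k _ => h i k
    _ = _ := by
        unfold frobSq
        rw [Finset.sum_comm (f := fun j k => ‖B j k‖ ^ 2), Finset.sum_mul_sum]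

lemma frobSq_semiUnitary_mul [DecidableEq n] {U : Matrix m n ℂ} (hU : IsSemiUnitary U)
    (A : Matrix n p ℂ) : frobSq (U * A) = frobSq A := by
  have : ((frobSq (U * A) : ℝ) : ℂ) = (frobSq A : ℝ) := by
    rw [← trace_conjTranspose_mul_self, ← trace_conjTranspose_mul_self,
      Matrix.conjTranspose_mul, Matrix.mul_assoc, ← Matrix.mul_assoc Uᴴ, show Uᴴ * U = 1 from hU,
      Matrix.one_mul]
  exact_mod_cast this

lemma frobSq_of_semiUnitary [DecidableEq n] {U : Matrix m n ℂ} (hU : IsSemiUnitary U) :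
    frobSq U = Fintype.card n := by
  have : ((frobSq U : ℝ) : ℂ) = (Fintype.card n : ℂ) := by
    rw [← trace_conjTranspose_mul_self, show Uᴴ * U = 1 from hU, Matrix.trace_one]
  exact_mod_cast this

end MatrixAlgebra

/-! ### Semi-unitary matrices as orthonormal bases -/

section SemiUnitary

variable {N a : ℕ} {ι κ : Type*} [Fintype ι] [Fintype κ]

lemma inner_column {d e : ℕ} (U : Matrix (Fin N) (Fin d) ℂ) (V : Matrix (Fin N) (Fin e) ℂ)
    (i : Fin d) (j : Fin e) : inner ℂ (column U i) (column V j) = (Uᴴ * V) i j := by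
  simp [column, PiLp.inner_apply, Matrix.mul_apply, mul_comm]

lemma isSemiUnitary_iff_orthonormal {U : Matrix (Fin N) (Fin a) ℂ} :
    IsSemiUnitary U ↔ Orthonormal ℂ (column U) := by
  rw [orthonormal_iff_ite]
  simp only [inner_column]
  constructor
  · intro h i j
    rw [show Uᴴ * U = 1 from h, Matrix.one_apply]
  · intro h
    show Uᴴ * U = 1
    ext i j
    rw [h, Matrix.one_apply]

/-- The matrix with prescribed columns. -/
def ofColumns (v : Fin a → EuclideanSpace ℂ (Fin N)) : Matrix (Fin N) (Fin a) ℂ :=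
  Matrix.of fun i j => v j i

lemma column_ofColumns (v : Fin a → EuclideanSpace ℂ (Fin N)) : column (ofColumns v) = v := by
  funext j; ext i; rfl

lemma exists_semiUnitary_mem (E : Submodule ℂ (EuclideanSpace ℂ (Fin N)))
    (ha : a ≤ Module.finrank ℂ E) :
    ∃ V : Matrix (Fin N) (Fin a) ℂ, IsSemiUnitary V ∧ ∀ j, column V j ∈ E := by
  let b := stdOrthonormalBasis ℂ E
  refine ⟨ofColumns fun j => (b (Fin.castLE ha j) : EuclideanSpace ℂ (Fin N)), ?_, ?_⟩
  · rw [isSemiUnitary_iff_orthonormal, column_ofColumns]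
    have h1 := b.orthonormal.comp (Fin.castLE ha) (Fin.castLE_injective ha)
    exact h1.comp_linearIsometry E.subtypeₗᵢ
  · intro j
    rw [column_ofColumns]
    exact (b _).2

lemma IsSemiUnitary.card_le {U : Matrix (Fin N) (Fin a) ℂ} (h : IsSemiUnitary U) : a ≤ N := by
  have := (isSemiUnitary_iff_orthonormal.1 h).linearIndependent.fintype_card_le_finrank
  simpa using this

lemma exists_unitary_extension {V : Matrix (Fin N) (Fin a) ℂ} (hV : IsSemiUnitary V) :
    ∃ Q ∈ Matrix.unitaryGroup (Fin N) ℂ, ∀ i j, Q i (Fin.castLE hV.card_le j) = V i j := by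
  have ho := isSemiUnitary_iff_orthonormal.1 hV
  let e := Fin.castLE hV.card_le
  have he : Function.Injective e := Fin.castLE_injective _
  -- The value `0` off the range of `e` is a dummy: the basis extension below only keeps the vectors
  -- indexed by that range.
  let v : Fin N → EuclideanSpace ℂ (Fin N) :=
    fun i => if h : ∃ j, e j = i then column V h.choose else 0
  have hv : ∀ j, v (e j) = column V j := by
    intro j
    have h : ∃ j', e j' = e j := ⟨j, rfl⟩
    have : h.choose = j := he h.choose_spec
    simp only [v, dif_pos h, this]
  have hr : Orthonormal ℂ ((Set.range e).domRestrict v) := by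
    have : (Set.range e).domRestrict v = column V ∘ (Equiv.ofInjective e he).symm := by
      funext x
      obtain ⟨x, j, rfl⟩ := x
      have h2 : (Equiv.ofInjective e he).symm ⟨e j, j, rfl⟩ = j :=
        Equiv.ofInjective_symm_apply he j
      simp only [Function.comp_apply, h2]
      exact hv j
    rw [this]
    exact ho.comp _ (Equiv.injective _)
  obtain ⟨b, hb⟩ := hr.exists_orthonormalBasis_extension_of_card_eq (by simp)
  refine ⟨ofColumns b, ?_, ?_⟩
  · rw [Matrix.mem_unitaryGroup_iff']
    have : IsSemiUnitary (ofColumns b) := by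
      rw [isSemiUnitary_iff_orthonormal, column_ofColumns]; exact b.orthonormal
    exact this
  · intro i j
    show b (e j) i = V i j
    rw [hb _ ⟨j, rfl⟩, hv]
    rfl

lemma IsSemiUnitary.mul {m n p : Type*} [Fintype m] [Fintype n] [DecidableEq n] [DecidableEq p]
    {U : Matrix m n ℂ} {V : Matrix n p ℂ}
    (hU : IsSemiUnitary U) (hV : IsSemiUnitary V) : IsSemiUnitary (U * V) := by
  show (U * V)ᴴ * (U * V) = 1
  rw [Matrix.conjTranspose_mul, Matrix.mul_assoc, ← Matrix.mul_assoc Uᴴ, show Uᴴ * U = 1 from hU,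
    Matrix.one_mul]
  exact hV

/-- The unitary group acts transitively on semi-unitary matrices. -/
lemma exists_unitary_mul_eq {V V' : Matrix (Fin N) (Fin a) ℂ} (hV : IsSemiUnitary V)
    (hV' : IsSemiUnitary V') : ∃ Q ∈ Matrix.unitaryGroup (Fin N) ℂ, Q * V = V' := by
  obtain ⟨Q, hQ, h⟩ := exists_unitary_extension hV
  obtain ⟨Q', hQ', h'⟩ := exists_unitary_extension hV'
  have h1 : V = Q.submatrix id (Fin.castLE hV.card_le) := by ext i j; simp [h]
  have h1' : V' = Q'.submatrix id (Fin.castLE hV.card_le) := by ext i j; simp [h']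
  -- `V` and `V'` are the leading columns of `Q` and `Q'`, so `Q' Q*` carries one to the other.
  refine ⟨Q' * star Q, mul_mem hQ' (Unitary.star_mem hQ), ?_⟩
  have hs : star Q * Q = 1 := Matrix.mem_unitaryGroup_iff'.1 hQ
  have key : ∀ A : Matrix (Fin N) (Fin N) ℂ, A * V = (A * Q).submatrix id (Fin.castLE hV.card_le) := by
    intro A; exact (congrArg (A * ·) h1).trans rfl
  rw [key, Matrix.mul_assoc, hs, Matrix.mul_one, h1']

/-- The span of the columns of a matrix. -/
def columnSpan (A : Matrix (Fin N) ι ℂ) : Submodule ℂ (EuclideanSpace ℂ (Fin N)) :=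
  Submodule.span ℂ (Set.range fun j => WithLp.toLp 2 fun i => A i j)

lemma finrank_columnSpan_le (A : Matrix (Fin N) ι ℂ) :
    Module.finrank ℂ (columnSpan A) ≤ Fintype.card ι :=
  finrank_range_le_card _

/-- There is a semi-unitary matrix orthogonal to few given columns. -/
lemma exists_semiUnitary_orthogonal (A : Matrix (Fin N) ι ℂ) (h : Fintype.card ι + a ≤ N) :
    ∃ W : Matrix (Fin N) (Fin a) ℂ, IsSemiUnitary W ∧ Aᴴ * W = 0 := by
  have h1 := (columnSpan A).finrank_add_finrank_orthogonal
  have h2 := finrank_columnSpan_le A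
  rw [finrank_euclideanSpace_fin] at h1
  obtain ⟨W, hW, hm⟩ := exists_semiUnitary_mem (columnSpan A)ᗮ (a := a) (by omega)
  refine ⟨W, hW, ?_⟩
  ext i j
  have := (Submodule.mem_orthogonal _ _).1 (hm j) _ (Submodule.subset_span ⟨i, rfl⟩)
  simpa [column, PiLp.inner_apply, Matrix.mul_apply, mul_comm] using this

/-- The columns of `V` are an orthonormal basis of `E`, so `V Vᴴ` fixes the vectors of `E`. -/
lemma mul_conjTranspose_mulVec_of_mem {E : Submodule ℂ (EuclideanSpace ℂ (Fin N))}
    {V : Matrix (Fin N) (Fin a) ℂ} (hV : IsSemiUnitary V) (hm : ∀ j, column V j ∈ E)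
    (hr : Module.finrank ℂ E = a) {x : Fin N → ℂ} (hx : WithLp.toLp 2 x ∈ E) :
    (V * Vᴴ) *ᵥ x = x := by
  have ho := isSemiUnitary_iff_orthonormal.1 hV
  have hspan : Submodule.span ℂ (Set.range (column V)) = E := by
    apply Submodule.eq_of_le_of_finrank_eq
    · rw [Submodule.span_le]; rintro _ ⟨j, rfl⟩; exact hm j
    · rw [hr, finrank_span_eq_card ho.linearIndependent, Fintype.card_fin]
  rw [← hspan] at hx
  obtain ⟨c, hc⟩ := (Submodule.mem_span_range_iff_exists_fun ℂ).1 hx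
  have hcol : x = V *ᵥ c := by
    funext i
    have := congrArg (fun v : EuclideanSpace ℂ (Fin N) => v i) hc
    simpa [column, mul_comm, Matrix.mulVec, dotProduct] using this.symm
  rw [hcol, Matrix.mulVec_mulVec, Matrix.mul_assoc, show Vᴴ * V = 1 from hV, Matrix.mul_one]

/-- An injective matrix factors through a semi-unitary matrix with the same column span. -/
lemma exists_semiUnitary_factor (A : Matrix (Fin N) ι ℂ) (hA : ∀ x, A *ᵥ x = 0 → x = 0)
    (ha : Fintype.card ι = a) :
    ∃ V : Matrix (Fin N) (Fin a) ℂ, IsSemiUnitary V ∧ V * Vᴴ * A = A ∧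
      ∀ j, column V j ∈ columnSpan A := by
  have hli : LinearIndependent ℂ
      (fun j => (WithLp.toLp 2 fun i => A i j : EuclideanSpace ℂ (Fin N))) := by
    rw [Fintype.linearIndependent_iff]
    intro g hg
    have : A *ᵥ g = 0 := by
      ext i
      have := congrArg (fun v : EuclideanSpace ℂ (Fin N) => v i) hg
      simpa [Matrix.mulVec, dotProduct, mul_comm] using this
    intro i
    rw [hA g this]; rfl
  have hr : Module.finrank ℂ (columnSpan A) = a := by
    rw [← ha]; exact finrank_span_eq_card hli
  obtain ⟨V, hV, hm⟩ := exists_semiUnitary_mem (columnSpan A) hr.ge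
  refine ⟨V, hV, ?_, hm⟩
  ext i j
  exact congrFun (mul_conjTranspose_mulVec_of_mem hV hm hr (x := fun i => A i j)
    (Submodule.subset_span ⟨j, rfl⟩)) i

end SemiUnitary

/-! ### Determinant inequalities for positive semidefinite matrices -/

section Determinants

variable {n m : Type*} [Fintype n] [DecidableEq n] [Fintype m]

/-- Evaluate the characteristic polynomial at `-1`; the signs on both sides cancel. The next three
bounds are comparisons of factors in this product. -/
lemma det_one_add_eq_prod {Y : Matrix n n ℂ} (hY : Y.IsHermitian) :
    (1 + Y).det = ((∏ i, (1 + hY.eigenvalues i) : ℝ) : ℂ) := by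
  have h1 := congrArg (Polynomial.eval (-1)) hY.charpoly_eq
  rw [Matrix.eval_charpoly, Polynomial.eval_prod] at h1
  have h2 : (Matrix.scalar n (-1 : ℂ) - Y) = -(1 + Y) := by
    rw [map_neg, map_one]; abel
  rw [h2, Matrix.det_neg] at h1
  have h3 : ∀ i, Polynomial.eval (-1 : ℂ)
      (Polynomial.X - Polynomial.C (hY.eigenvalues i : ℂ)) = (-1) * (1 + hY.eigenvalues i) := by
    intro i; simp; ring
  have h4 : (-1 : ℂ) ^ Fintype.card n * (1 + Y).det =
      (-1) ^ Fintype.card n * ∏ i, (1 + (hY.eigenvalues i : ℂ)) := by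
    rw [h1]
    refine (Finset.prod_congr rfl fun i _ => h3 i).trans ?_
    rw [Finset.prod_mul_distrib, Finset.prod_const, Finset.card_univ]
  have h5 := mul_left_cancel₀ (pow_ne_zero _ (by norm_num)) h4
  rw [h5]; push_cast; rfl

lemma one_le_det_one_add {Y : Matrix n n ℂ} (hY : Y.PosSemidef) : 1 ≤ (1 + Y).det.re := by
  rw [det_one_add_eq_prod hY.1, Complex.ofReal_re]
  calc (1 : ℝ) = ∏ _i : n, 1 := by simp
    _ ≤ _ := Finset.prod_le_prod (fun _ _ => zero_le_one)
      fun i _ => by linarith [hY.eigenvalues_nonneg i]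

lemma det_one_add_le_exp {Y : Matrix n n ℂ} (hY : Y.PosSemidef) :
    (1 + Y).det.re ≤ Real.exp Y.trace.re := by
  rw [det_one_add_eq_prod hY.1, Complex.ofReal_re, hY.1.trace_eq_sum_eigenvalues, Complex.re_sum]
  simp only [Complex.coe_algebraMap, Complex.ofReal_re]
  rw [Real.exp_sum]
  exact Finset.prod_le_prod (fun i _ => by linarith [hY.eigenvalues_nonneg i])
      fun i _ => by rw [add_comm]; exact Real.add_one_le_exp _

lemma det_le_det_one_add {Y : Matrix n n ℂ} (hY : Y.PosSemidef) :
    Y.det.re ≤ (1 + Y).det.re := by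
  have : Y.det = ((∏ i, hY.1.eigenvalues i : ℝ) : ℂ) := by
    rw [hY.1.det_eq_prod_eigenvalues]; push_cast; rfl
  rw [det_one_add_eq_prod hY.1, this, Complex.ofReal_re, Complex.ofReal_re]
  exact Finset.prod_le_prod (fun i _ => hY.eigenvalues_nonneg i) fun i _ => by linarith

lemma re_det_mul_conjTranspose (A : Matrix n n ℂ) : (A * Aᴴ).det.re = ‖A.det‖ ^ 2 := by
  rw [Matrix.det_mul, Matrix.det_conjTranspose, ← Complex.normSq_eq_norm_sq]
  have := RCLike.mul_conj A.det
  rw [show star A.det = (starRingEnd ℂ) A.det from rfl, Complex.mul_conj]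
  simp

/-- The determinant is monotone for the Loewner order. -/
lemma det_add_le_of_posSemidef {X : Matrix n n ℂ} (hX : X.PosSemidef) (A : Matrix n m ℂ) :
    (1 + X).det.re ≤ (1 + X + A * Aᴴ).det.re := by
  classical
  have hp : (1 + X).PosDef := Matrix.PosDef.one.add_posSemidef hX
  have hdet := hp.det_pos
  have hu : IsUnit (1 + X).det := hdet.ne'.isUnit
  -- Sylvester's identity turns the determinant of the second factor into that of `1 + Aᴴ (1 + X)⁻¹
  -- A`, which is at least one.
  have h1 : 1 + X + A * Aᴴ = (1 + X) * (1 + ((1 + X)⁻¹ * A) * Aᴴ) := by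
    rw [Matrix.mul_add, Matrix.mul_one, ← Matrix.mul_assoc, ← Matrix.mul_assoc,
      Matrix.mul_nonsing_inv _ hu, Matrix.one_mul]
  have h2 : (Aᴴ * ((1 + X)⁻¹ * A)).PosSemidef := by
    rw [← Matrix.mul_assoc]
    exact hp.inv.posSemidef.conjTranspose_mul_mul_same A
  rw [h1, Matrix.det_mul, Matrix.det_one_add_mul_comm]
  have h3 : (1 + X).det = ((1 + X).det.re : ℂ) := by
    rw [det_one_add_eq_prod hX.1, Complex.ofReal_re]
  rw [h3, Complex.re_ofReal_mul, Complex.ofReal_re]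
  have h4 := one_le_det_one_add h2
  have h5 := one_le_det_one_add hX
  nlinarith

/-- `P (1 + Y)` exceeds `1 + P Y` by `(P - 1)` times the identity, and the determinant is monotone.
This gives the sharp coefficient of `log P` in the upper bound of the block-diagonalization rate. -/
lemma det_one_add_smul_le {Y : Matrix n n ℂ} (hY : Y.PosSemidef) {P : ℝ} (hP : 1 ≤ P) :
    (1 + (P : ℂ) • Y).det.re ≤ P ^ Fintype.card n * (1 + Y).det.re := by
  have hP0 : (0 : ℝ) < P := by linarith
  have hPY : ((P : ℂ) • Y).PosSemidef := hY.smul (by exact_mod_cast hP0.le)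
  have h2 := det_add_le_of_posSemidef hPY (((√(P - 1) : ℝ) : ℂ) • (1 : Matrix n n ℂ))
  have h3 : 1 + (P : ℂ) • Y + (((√(P - 1) : ℝ) : ℂ) • (1 : Matrix n n ℂ)) *
      (((√(P - 1) : ℝ) : ℂ) • (1 : Matrix n n ℂ))ᴴ = (P : ℂ) • (1 + Y) := by
    have hs : ((√(P - 1) : ℝ) : ℂ) * ((√(P - 1) : ℝ) : ℂ) = P - 1 := by
      rw [← Complex.ofReal_mul, Real.mul_self_sqrt (by linarith)]
      push_cast; ring
    simp only [Matrix.conjTranspose_smul, Matrix.conjTranspose_one, Matrix.smul_mul,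
      Matrix.one_mul, smul_smul]
    rw [show star ((√(P - 1) : ℝ) : ℂ) = ((√(P - 1) : ℝ) : ℂ) from Complex.conj_ofReal _, hs,
      sub_smul, one_smul, smul_add]
    abel
  rw [h3, Matrix.det_smul, ← Complex.ofReal_pow, Complex.re_ofReal_mul] at h2
  exact h2

end Determinants

/-! ### Orthogonal projections, chordal distance and leakage -/

section Projections

variable {N d e r : ℕ}

/-- The orthogonal projection onto the complement of the column span of `A`. -/
def complProj {ι : Type*} [Fintype ι] [DecidableEq ι] (A : Matrix (Fin N) ι ℂ) :
    Matrix (Fin N) (Fin N) ℂ :=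
  1 - A * (Aᴴ * A)⁻¹ * Aᴴ

/-- By the dimension count, the difference `Z` of the two sides is a projection of trace zero, hence
zero. Thus `W Wᴴ` is a function of `A`, although `W` is only determined up to a unitary factor on
the right. -/
lemma complProj_eq {ι : Type*} [Fintype ι] [DecidableEq ι] {A : Matrix (Fin N) ι ℂ}
    (hA : (Aᴴ * A).det ≠ 0) (hc : Fintype.card ι + d = N) {W : Matrix (Fin N) (Fin d) ℂ}
    (hW : IsSemiUnitary W) (hAW : Aᴴ * W = 0) : complProj A = W * Wᴴ := by
  have hu : IsUnit (Aᴴ * A).det := hA.isUnit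
  have hWW : Wᴴ * W = 1 := hW
  have hWA : Wᴴ * A = 0 := by
    have := congrArg Matrix.conjTranspose hAW
    simpa [Matrix.conjTranspose_mul] using this
  set G := (Aᴴ * A)⁻¹ with hG
  have hGG : G * (Aᴴ * A) = 1 := Matrix.nonsing_inv_mul _ hu
  have hGh : Gᴴ = G := by
    rw [hG, Matrix.conjTranspose_nonsing_inv, Matrix.conjTranspose_mul,
      Matrix.conjTranspose_conjTranspose]
  set Z := complProj A - W * Wᴴ with hZ
  have hZdef : Z = 1 - A * G * Aᴴ - W * Wᴴ := rfl
  have hZh : Zᴴ = Z := by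
    simp [hZdef, Matrix.conjTranspose_mul, hGh, Matrix.mul_assoc]
  have e1 : A * G * Aᴴ * (A * G * Aᴴ) = A * G * Aᴴ := by
    calc _ = A * (G * (Aᴴ * A)) * G * Aᴴ := by simp only [Matrix.mul_assoc]
      _ = _ := by rw [hGG, Matrix.mul_one]
  have e2 : W * Wᴴ * (W * Wᴴ) = W * Wᴴ := by
    calc _ = W * (Wᴴ * W) * Wᴴ := by simp only [Matrix.mul_assoc]
      _ = _ := by rw [hWW, Matrix.mul_one]
  have e3 : A * G * Aᴴ * (W * Wᴴ) = 0 := by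
    calc _ = A * G * (Aᴴ * W) * Wᴴ := by simp only [Matrix.mul_assoc]
      _ = _ := by rw [hAW]; simp
  have e4 : W * Wᴴ * (A * G * Aᴴ) = 0 := by
    calc _ = W * (Wᴴ * A) * G * Aᴴ := by simp only [Matrix.mul_assoc]
      _ = _ := by rw [hWA]; simp
  have hZZ : Z * Z = Z := by
    rw [hZdef]
    simp only [Matrix.sub_mul, Matrix.mul_sub, Matrix.one_mul, Matrix.mul_one, e1, e2, e3, e4]
    abel
  have htr : Z.trace = 0 := by
    rw [hZdef, Matrix.trace_sub, Matrix.trace_sub, Matrix.trace_one, Matrix.mul_assoc,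
      Matrix.trace_mul_comm A, Matrix.mul_assoc, hGG, Matrix.trace_mul_comm W, hWW,
      Matrix.trace_one, Matrix.trace_one, ← hc]
    simp
  have : Z = 0 := by
    rw [← Matrix.trace_conjTranspose_mul_self_eq_zero_iff, hZh, hZZ, htr]
  exact sub_eq_zero.1 this

/-- The ranges of `U` and `W` are orthogonal, so `Z` below is the projection onto the rest of the
space and `‖Z V‖²` is exactly the slack. -/
lemma frobSq_add_frobSq_le {U : Matrix (Fin N) (Fin d) ℂ} {W : Matrix (Fin N) (Fin e) ℂ}
    {V : Matrix (Fin N) (Fin r) ℂ} (hU : IsSemiUnitary U) (hW : IsSemiUnitary W)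
    (hV : IsSemiUnitary V) (hUW : Uᴴ * W = 0) :
    frobSq (Vᴴ * U) + frobSq (Vᴴ * W) ≤ r := by
  have hUU : Uᴴ * U = 1 := hU
  have hWW : Wᴴ * W = 1 := hW
  have hWU : Wᴴ * U = 0 := by
    have := congrArg Matrix.conjTranspose hUW
    simpa [Matrix.conjTranspose_mul] using this
  set Z := 1 - U * Uᴴ - W * Wᴴ with hZ
  have hZh : Zᴴ = Z := by simp [hZ, Matrix.conjTranspose_mul]
  have hZZ : Z * Z = Z := by
    have e1 : U * Uᴴ * (U * Uᴴ) = U * Uᴴ := by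
      rw [Matrix.mul_assoc, ← Matrix.mul_assoc Uᴴ, hUU, Matrix.one_mul]
    have e2 : W * Wᴴ * (W * Wᴴ) = W * Wᴴ := by
      rw [Matrix.mul_assoc, ← Matrix.mul_assoc Wᴴ, hWW, Matrix.one_mul]
    have e3 : U * Uᴴ * (W * Wᴴ) = 0 := by
      rw [Matrix.mul_assoc, ← Matrix.mul_assoc Uᴴ, hUW]; simp
    have e4 : W * Wᴴ * (U * Uᴴ) = 0 := by
      rw [Matrix.mul_assoc, ← Matrix.mul_assoc Wᴴ, hWU]; simp
    rw [hZ]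
    simp only [Matrix.sub_mul, Matrix.mul_sub, Matrix.one_mul, Matrix.mul_one, e1, e2, e3, e4]
    abel
  have key : ((frobSq (Vᴴ * U) + frobSq (Vᴴ * W) + frobSq (Z * V) : ℝ) : ℂ) = (r : ℂ) := by
    push_cast
    rw [← trace_mul_conjTranspose_self, ← trace_mul_conjTranspose_self,
      ← trace_conjTranspose_mul_self]
    simp only [Matrix.conjTranspose_mul, Matrix.conjTranspose_conjTranspose, hZh]
    have e5 : Vᴴ * Z * (Z * V) = Vᴴ * V - Vᴴ * U * (Uᴴ * V) - Vᴴ * W * (Wᴴ * V) := by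
      rw [Matrix.mul_assoc, ← Matrix.mul_assoc Z, hZZ, hZ]
      simp only [Matrix.sub_mul, Matrix.mul_sub, Matrix.one_mul, Matrix.mul_assoc]
    rw [e5, Matrix.trace_sub, Matrix.trace_sub, show Vᴴ * V = 1 from hV, Matrix.trace_one]
    simp
  have key' : frobSq (Vᴴ * U) + frobSq (Vᴴ * W) + frobSq (Z * V) = r := by exact_mod_cast key
  linarith [frobSq_nonneg (Z * V)]

lemma frobSq_conjTranspose_mul_le {V : Matrix (Fin N) (Fin r) ℂ} (hV : IsSemiUnitary V)
    {p : Type*} [Fintype p] (A : Matrix (Fin N) p ℂ) : frobSq (Vᴴ * A) ≤ frobSq A := by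
  have hVV : Vᴴ * V = 1 := hV
  have key : ((frobSq (Vᴴ * A) + frobSq ((1 - V * Vᴴ) * A) : ℝ) : ℂ) = (frobSq A : ℝ) := by
    push_cast
    rw [← trace_conjTranspose_mul_self, ← trace_conjTranspose_mul_self,
      ← trace_conjTranspose_mul_self, ← Matrix.trace_add]
    congr 1
    have e : (1 - V * Vᴴ) * (1 - V * Vᴴ) = 1 - V * Vᴴ := by
      have : V * Vᴴ * (V * Vᴴ) = V * Vᴴ := by
        rw [Matrix.mul_assoc, ← Matrix.mul_assoc Vᴴ, hVV, Matrix.one_mul]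
      simp only [Matrix.sub_mul, Matrix.mul_sub, Matrix.one_mul, Matrix.mul_one, this]
      abel
    have e' : (1 - V * Vᴴ)ᴴ = 1 - V * Vᴴ := by simp [Matrix.conjTranspose_mul]
    rw [Matrix.conjTranspose_mul (1 - V * Vᴴ), e', Matrix.mul_assoc Aᴴ,
      ← Matrix.mul_assoc (1 - V * Vᴴ), e]
    simp [Matrix.conjTranspose_mul, Matrix.sub_mul, Matrix.mul_sub, Matrix.mul_assoc]
  have key' : frobSq (Vᴴ * A) + frobSq ((1 - V * Vᴴ) * A) = frobSq A := by exact_mod_cast key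
  linarith [frobSq_nonneg ((1 - V * Vᴴ) * A)]

lemma norm_sq_toLp (x : Fin N → ℂ) :
    ‖(WithLp.toLp 2 x : EuclideanSpace ℂ (Fin N))‖ ^ 2 = ∑ i, ‖x i‖ ^ 2 :=
  EuclideanSpace.norm_sq_eq _

lemma mem_rowSpace_of_mul_eq {G : Matrix (Fin d) (Fin N) ℂ} {V : Matrix (Fin N) (Fin r) ℂ}
    {L : Matrix (Fin d) (Fin r) ℂ} (h : V = Gᴴ * L) (j : Fin r) : column V j ∈ rowSpace G := by
  have : column V j = ∑ k, L k j • column Gᴴ k := by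
    ext i
    simp [column, h, Matrix.mul_apply, mul_comm]
  rw [this]
  exact Submodule.sum_mem _ fun k _ => Submodule.smul_mem _ _ (Submodule.subset_span ⟨k, rfl⟩)

lemma starProjection_rowSpace {G : Matrix (Fin d) (Fin N) ℂ} {V : Matrix (Fin N) (Fin r) ℂ}
    (hm : ∀ j, column V j ∈ rowSpace G) (hG : G * (V * Vᴴ) = G)
    (x : Fin N → ℂ) :
    (rowSpace G).starProjection (WithLp.toLp 2 x) = WithLp.toLp 2 ((V * Vᴴ) *ᵥ x) := by
  apply Submodule.eq_starProjection_of_mem_orthogonal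
  · have : (WithLp.toLp 2 ((V * Vᴴ) *ᵥ x) : EuclideanSpace ℂ (Fin N)) =
        ∑ j, (Vᴴ *ᵥ x) j • column V j := by
      ext i
      rw [← Matrix.mulVec_mulVec]
      simp [column, Matrix.mulVec, dotProduct, mul_comm]
    rw [this]
    exact Submodule.sum_mem _ fun k _ => Submodule.smul_mem _ _ (hm k)
  · rw [Submodule.mem_orthogonal, rowSpace]
    intro u hu
    refine Submodule.span_induction ?_ ?_ ?_ ?_ hu
    · rintro _ ⟨k, rfl⟩
      have h0 : G *ᵥ (x - (V * Vᴴ) *ᵥ x) = 0 := by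
        rw [Matrix.mulVec_sub, Matrix.mulVec_mulVec, hG, sub_self]
      have := congrFun h0 k
      simpa [column, PiLp.inner_apply, Matrix.mulVec, dotProduct, mul_comm] using this
    · simp
    · intro a b _ _ ha hb; rw [inner_add_left, ha, hb, add_zero]
    · intro a b _ hb; rw [inner_smul_left, hb, mul_zero]

lemma sum_starProjection_eq_frobSq {G : Matrix (Fin d) (Fin N) ℂ} {V : Matrix (Fin N) (Fin r) ℂ}
    (hV : IsSemiUnitary V) (hm : ∀ j, column V j ∈ rowSpace G) (hG : G * (V * Vᴴ) = G)
    (U : Matrix (Fin N) (Fin e) ℂ) :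
    ∑ j, ‖(rowSpace G).starProjection (column U j)‖ ^ 2 = frobSq (Vᴴ * U) := by
  rw [← frobSq_semiUnitary_mul hV, frobSq, Finset.sum_comm]
  refine Finset.sum_congr rfl fun j _ => ?_
  rw [column, starProjection_rowSpace hm hG, norm_sq_toLp, ← Matrix.mul_assoc]
  rfl

lemma exists_rowSpace_basis (G : Matrix (Fin d) (Fin N) ℂ) :
    ∃ r ≤ d, ∃ V : Matrix (Fin N) (Fin r) ℂ, IsSemiUnitary V ∧ (∀ j, column V j ∈ rowSpace G) ∧
      G * (V * Vᴴ) = G := by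
  obtain ⟨V, hV, hm⟩ := exists_semiUnitary_mem (rowSpace G) le_rfl
  refine ⟨_, ?_, V, hV, hm, ?_⟩
  · exact (finrank_columnSpan_le Gᴴ).trans_eq (Fintype.card_fin d)
  · have h : (V * Vᴴ) * Gᴴ = Gᴴ := by
      ext i j
      exact congrFun (mul_conjTranspose_mulVec_of_mem hV hm rfl (x := fun i => Gᴴ i j)
        (Submodule.subset_span ⟨j, rfl⟩)) i
    have := congrArg Matrix.conjTranspose h
    simpa [Matrix.conjTranspose_mul, Matrix.mul_assoc] using this

lemma chordalDist_sq (G : Matrix (Fin d) (Fin N) ℂ) {U : Matrix (Fin N) (Fin d) ℂ}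
    (hU : IsSemiUnitary U) {V : Matrix (Fin N) (Fin r) ℂ}
    (hV : IsSemiUnitary V) (hm : ∀ j, column V j ∈ rowSpace G) (hG : G * (V * Vᴴ) = G) :
    chordalDist G U ^ 2 = d - frobSq (Vᴴ * U) := by
  rw [chordalDist, Real.sq_sqrt, sum_starProjection_eq_frobSq hV hm hG]
  rw [sum_starProjection_eq_frobSq hV hm hG]
  have := frobSq_conjTranspose_mul_le hV U
  rw [frobSq_of_semiUnitary hU, Fintype.card_fin] at this
  linarith

/-- The interference leakage through a precoder orthogonal to the quantized channel is governed by
the quantization error. -/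
lemma frobSq_mul_le_chordalDist (G : Matrix (Fin d) (Fin N) ℂ) {U : Matrix (Fin N) (Fin d) ℂ}
    (hU : IsSemiUnitary U) {W : Matrix (Fin N) (Fin e) ℂ} (hW : IsSemiUnitary W)
    (hUW : Uᴴ * W = 0) : frobSq (G * W) ≤ frobSq G * chordalDist G U ^ 2 := by
  obtain ⟨r, hr, V, hV, hm, hG⟩ := exists_rowSpace_basis G
  rw [chordalDist_sq G hU hV hm hG]
  have h1 := frobSq_add_frobSq_le hU hW hV hUW
  -- The rank `r` may be smaller than `d`; the estimate `‖Vᴴ W‖² ≤ r - ‖Vᴴ U‖²` only improves then.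
  have h2 : (r : ℝ) ≤ d := by exact_mod_cast hr
  have h3 : G * W = G * (V * (Vᴴ * W)) := by
    rw [← Matrix.mul_assoc V, ← Matrix.mul_assoc G, hG]
  rw [h3]
  refine (frobSq_mul_le _ _).trans ?_
  rw [frobSq_semiUnitary_mul hV]
  exact mul_le_mul_of_nonneg_left (by linarith) (frobSq_nonneg _)

end Projections

/-! ### Borel structure on matrices -/

section Measurability

instance matrixBorelSpace {m n : Type*} [Countable m] [Countable n] : BorelSpace (Matrix m n ℂ) :=
  inferInstanceAs (BorelSpace (m → n → ℂ))

instance matrixSecondCountable {m n : Type*} [Countable m] [Countable n] :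
    SecondCountableTopology (Matrix m n ℂ) :=
  inferInstanceAs (SecondCountableTopology (m → n → ℂ))

end Measurability

/-! ### Negative moments of Gaussian determinants -/

section Gaussian

lemma measurable_complexMk : Measurable (fun p : ℝ × ℝ => Complex.mk p.1 p.2) :=
  Complex.measurableEquivRealProd.symm.measurable

instance : IsProbabilityMeasure complexGaussian :=
  Measure.isProbabilityMeasure_map measurable_complexMk.aemeasurable

lemma lintegral_gaussianReal_le (v : NNReal) (hv : v ≠ 0) :
    ∃ K : ℝ≥0∞, K ≠ ⊤ ∧ ∀ f : ℝ → ℝ≥0∞, ∫⁻ x, f x ∂(gaussianReal 0 v) ≤ K * ∫⁻ x, f x := by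
  refine ⟨ENNReal.ofReal (√(2 * Real.pi * v))⁻¹, ENNReal.ofReal_ne_top, fun f => ?_⟩
  rw [gaussianReal_of_var_ne_zero _ hv]
  have h : gaussianPDF 0 v ≤ fun _ => ENNReal.ofReal (√(2 * Real.pi * v))⁻¹ := by
    intro x
    rw [gaussianPDF, gaussianPDFReal]
    apply ENNReal.ofReal_le_ofReal
    have h1 : Real.exp (-(x - 0) ^ 2 / (2 * v)) ≤ 1 := by
      rw [Real.exp_le_one_iff]
      apply div_nonpos_of_nonpos_of_nonneg
      · nlinarith [sq_nonneg (x - 0)]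
      · positivity
    exact mul_le_of_le_one_right (by positivity) h1
  calc ∫⁻ x, f x ∂(volume.withDensity (gaussianPDF 0 v))
      ≤ ∫⁻ x, f x ∂(volume.withDensity fun _ => ENNReal.ofReal (√(2 * Real.pi * v))⁻¹) :=
        lintegral_mono' (withDensity_mono (Eventually.of_forall h)) le_rfl
    _ = _ := by rw [withDensity_const, lintegral_smul_measure, smul_eq_mul]

/-- The density is bounded, so singularities that are integrable for the area measure stay
integrable for the Gaussian law. -/
lemma lintegral_complexGaussian_le :
    ∃ K : ℝ≥0∞, K ≠ ⊤ ∧ ∀ f : ℂ → ℝ≥0∞, Measurable f →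
      ∫⁻ z, f z ∂complexGaussian ≤ K * ∫⁻ z, f z := by
  obtain ⟨K, hK, h⟩ := lintegral_gaussianReal_le (1 / 2) (by norm_num)
  refine ⟨K * K, ENNReal.mul_ne_top hK hK, fun f hf => ?_⟩
  have hm : Measurable fun p : ℝ × ℝ => f (Complex.mk p.1 p.2) := hf.comp measurable_complexMk
  rw [complexGaussian, lintegral_map hf measurable_complexMk, lintegral_prod _ hm.aemeasurable]
  have hvol : ∫⁻ z, f z = ∫⁻ x : ℝ, ∫⁻ y : ℝ, f (Complex.mk x y) := by
    rw [← lintegral_prod (fun p : ℝ × ℝ => f (Complex.mk p.1 p.2)) hm.aemeasurable]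
    exact ((Complex.volume_preserving_equiv_real_prod.symm).lintegral_comp hf).symm
  rw [hvol]
  calc ∫⁻ x, (∫⁻ y, f (Complex.mk x y) ∂(gaussianReal 0 (1 / 2))) ∂(gaussianReal 0 (1 / 2))
      ≤ ∫⁻ x, (K * ∫⁻ y, f (Complex.mk x y)) ∂(gaussianReal 0 (1 / 2)) :=
        lintegral_mono fun x => h _
    _ ≤ K * ∫⁻ x, (K * ∫⁻ y, f (Complex.mk x y)) := h _
    _ = _ := by rw [lintegral_const_mul' _ _ hK, mul_assoc]

/-- The plane has two real dimensions, so a pole of order one is integrable. On the ball it is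
dominated by `e |z|⁻¹ exp (-|z|)`, whose integral over the plane is a Gamma value. -/
lemma lintegral_enorm_inv_ball : ∫⁻ z in Metric.ball (0 : ℂ) 1, ‖z‖ₑ⁻¹ ≠ ⊤ := by
  have h1 := Complex.integral_rpow_mul_exp_neg_rpow (p := 1) (q := -1) le_rfl (by norm_num)
  have h2 : Integrable (fun x : ℂ => ‖x‖ ^ (-1 : ℝ) * Real.exp (-‖x‖ ^ (1 : ℝ))) := by
    -- The integral of a non-integrable function is `0` by convention, whereas the formula gives a
    -- positive value.
    by_contra h
    rw [integral_undef h] at h1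
    have : Real.Gamma ((-1 + 2) / 1) = 1 := by norm_num
    rw [this] at h1
    have := Real.pi_pos
    linarith
  have h3 := h2.2
  rw [hasFiniteIntegral_iff_enorm] at h3
  have h4 : ∫⁻ z in Metric.ball (0 : ℂ) 1, ‖z‖ₑ⁻¹ ≤
      ∫⁻ z : ℂ, ENNReal.ofReal (Real.exp 1) * ‖‖z‖ ^ (-1 : ℝ) * Real.exp (-‖z‖ ^ (1 : ℝ))‖ₑ := by
    rw [← lintegral_indicator measurableSet_ball]
    refine lintegral_mono_ae ?_
    have h0 : ∀ᵐ z : ℂ, z ≠ 0 := by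
      rw [ae_iff]; simp
    filter_upwards [h0] with z hz
    by_cases hb : z ∈ Metric.ball (0 : ℂ) 1
    · rw [Set.indicator_of_mem hb, Real.enorm_of_nonneg (by positivity),
        ← ENNReal.ofReal_mul (by positivity), ← ofReal_norm,
        ← ENNReal.ofReal_inv_of_pos (norm_pos_iff.2 hz)]
      apply ENNReal.ofReal_le_ofReal
      rw [Real.rpow_neg_one, Real.rpow_one]
      have hn : ‖z‖ < 1 := by simpa using hb
      have : 1 ≤ Real.exp 1 * Real.exp (-‖z‖) := by
        rw [← Real.exp_add]; exact Real.one_le_exp (by linarith)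
      calc ‖z‖⁻¹ = ‖z‖⁻¹ * 1 := by ring
        _ ≤ ‖z‖⁻¹ * (Real.exp 1 * Real.exp (-‖z‖)) := by gcongr
        _ = _ := by ring
    · rw [Set.indicator_of_notMem hb]; exact zero_le
  refine ne_top_of_le_ne_top ?_ h4
  rw [lintegral_const_mul' _ _ ENNReal.ofReal_ne_top]
  exact ENNReal.mul_ne_top ENNReal.ofReal_ne_top h3.ne

/-- Affine images of a complex Gaussian variable have uniformly bounded negative first moments. -/
lemma exists_negMoment_bound :
    ∃ C : ℝ≥0∞, C ≠ ⊤ ∧ ∀ a c : ℂ, ∫⁻ z, ‖c * z + a‖ₑ⁻¹ ∂complexGaussian ≤ C * ‖c‖ₑ⁻¹ := by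
  obtain ⟨K, hK, h⟩ := lintegral_complexGaussian_le
  set I := ∫⁻ z in Metric.ball (0 : ℂ) 1, ‖z‖ₑ⁻¹ with hI
  have hC0 : 1 + K * I ≠ 0 := by simp
  refine ⟨1 + K * I, ?_, fun a c => ?_⟩
  · exact ENNReal.add_ne_top.2 ⟨ENNReal.one_ne_top, ENNReal.mul_ne_top hK lintegral_enorm_inv_ball⟩
  have hshift : ∀ a : ℂ, ∫⁻ z, ‖z + a‖ₑ⁻¹ ∂complexGaussian ≤ 1 + K * I := by
    intro a
    -- Outside the unit ball the inverse is at most one; the part inside is compared with Lebesgue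
    -- measure, which does not see the shift by `a`.
    set g : ℂ → ℝ≥0∞ := (Metric.ball (0 : ℂ) 1).indicator fun z => ‖z‖ₑ⁻¹ with hg
    have hgm : Measurable g := (measurable_enorm.inv).indicator measurableSet_ball
    have hle : ∀ z : ℂ, ‖z‖ₑ⁻¹ ≤ 1 + g z := by
      intro z
      by_cases hb : z ∈ Metric.ball (0 : ℂ) 1
      · rw [hg, Set.indicator_of_mem hb]; exact le_add_self
      · have : (1 : ℝ≥0∞) ≤ ‖z‖ₑ := by
          have : 1 ≤ ‖z‖ := by simpa using hb
          rw [← ofReal_norm]; exact ENNReal.one_le_ofReal.2 this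
        exact (ENNReal.inv_le_one.2 this).trans le_self_add
    calc ∫⁻ z, ‖z + a‖ₑ⁻¹ ∂complexGaussian ≤ ∫⁻ z, (1 + g (z + a)) ∂complexGaussian :=
          lintegral_mono fun z => hle _
      _ = 1 + ∫⁻ z, g (z + a) ∂complexGaussian := by
          rw [lintegral_add_left measurable_const]; simp
      _ ≤ 1 + K * ∫⁻ z, g (z + a) := by
          gcongr; exact h _ (hgm.comp (measurable_add_const a))
      _ = _ := by
          rw [lintegral_add_right_eq_self (μ := volume) g a, hg,
            lintegral_indicator measurableSet_ball]
  -- For `c = 0` the right-hand side is `⊤`, because the constant is nonzero.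
  by_cases hc : c = 0
  · rw [hc]; simp only [enorm_zero, ENNReal.inv_zero, ENNReal.mul_top hC0]; exact le_top
  · have h1 : ∀ z, ‖c * z + a‖ₑ⁻¹ = ‖c‖ₑ⁻¹ * ‖z + a / c‖ₑ⁻¹ := by
      intro z
      rw [← ENNReal.mul_inv (Or.inr (by simp)) (Or.inl (by simp)), ← enorm_mul]
      congr 2
      field_simp
    simp_rw [h1]
    rw [lintegral_const_mul' _ _ (by simpa using hc), mul_comm]
    gcongr
    exact hshift _

lemma integrable_norm_sq_complexGaussian :
    Integrable (fun z : ℂ => ‖z‖ ^ 2) complexGaussian := by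
  have h0 : Integrable (fun x : ℝ => x ^ 2) (gaussianReal 0 (1 / 2)) :=
    (memLp_id_gaussianReal (μ := 0) (v := 1 / 2) 2).integrable_sq
  rw [complexGaussian, integrable_map_measure (by fun_prop) measurable_complexMk.aemeasurable]
  have h1 := (h0.comp_fst (gaussianReal 0 (1 / 2))).add (h0.comp_snd (gaussianReal 0 (1 / 2)))
  refine h1.congr (Eventually.of_forall fun p => ?_)
  simp only [Pi.add_apply, Function.comp_apply]
  rw [← Complex.normSq_eq_norm_sq, Complex.normSq_apply]
  ring

/-- The uniform bound on negative first moments of affine images of a complex Gaussian. -/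
def negMomentBound : ℝ≥0∞ := exists_negMoment_bound.choose

lemma negMomentBound_ne_top : negMomentBound ≠ ⊤ := exists_negMoment_bound.choose_spec.1

lemma lintegral_affine_le (a c : ℂ) :
    ∫⁻ z, ‖c * z + a‖ₑ⁻¹ ∂complexGaussian ≤ negMomentBound * ‖c‖ₑ⁻¹ :=
  exists_negMoment_bound.choose_spec.2 a c

/-- A vector with i.i.d. complex Gaussian entries. -/
def gaussianVector (N : ℕ) : Measure (Fin N → ℂ) := Measure.pi fun _ => complexGaussian

/-- A matrix with i.i.d. complex Gaussian entries. -/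
def gaussianMatrix (m N : ℕ) : Measure (Matrix (Fin m) (Fin N) ℂ) :=
  Measure.pi fun _ : Fin m => gaussianVector N

instance (N : ℕ) : IsProbabilityMeasure (gaussianVector N) := by
  unfold gaussianVector; infer_instance

instance (m N : ℕ) : IsProbabilityMeasure (gaussianMatrix m N) := by
  unfold gaussianMatrix
  exact inferInstanceAs (IsProbabilityMeasure (Measure.pi fun _ : Fin m => gaussianVector N))

lemma lintegral_pi_succAbove {α : Type*} [MeasurableSpace α] (ν : Measure α) [SigmaFinite ν]
    {n : ℕ} (i : Fin (n + 1)) {F : α × (Fin n → α) → ℝ≥0∞} (hF : Measurable F) :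
    ∫⁻ g, F (g i, fun j => g (i.succAbove j)) ∂(Measure.pi fun _ : Fin (n + 1) => ν) =
      ∫⁻ y, ∫⁻ x, F (x, y) ∂ν ∂(Measure.pi fun _ : Fin n => ν) := by
  have hmp := measurePreserving_piFinSuccAbove (fun _ : Fin (n + 1) => ν) i
  rw [← lintegral_prod_symm' _ hF]
  exact hmp.lintegral_comp hF

/-- With all coordinates but the `i`-th frozen, the product is an affine function of one Gaussian
variable with slope `b i`. -/
lemma lintegral_dotProduct_le_coord {N : ℕ} (b : Fin N → ℂ) (i : Fin N) :
    ∫⁻ g, ‖b ⬝ᵥ g‖ₑ⁻¹ ∂(gaussianVector N) ≤ negMomentBound * ‖b i‖ₑ⁻¹ := by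
  cases N with
  | zero => exact i.elim0
  | succ n =>
  have hF : Measurable fun p : ℂ × (Fin n → ℂ) =>
      ‖b i * p.1 + ∑ j, b (i.succAbove j) * p.2 j‖ₑ⁻¹ := by fun_prop
  have h2 : ∀ g : Fin (n + 1) → ℂ, b ⬝ᵥ g =
      b i * g i + ∑ j, b (i.succAbove j) * g (i.succAbove j) := by
    intro g
    rw [dotProduct, Fin.sum_univ_succAbove _ i]
  calc ∫⁻ g, ‖b ⬝ᵥ g‖ₑ⁻¹ ∂(gaussianVector (n + 1))
      = ∫⁻ g, ‖b i * g i + ∑ j, b (i.succAbove j) * g (i.succAbove j)‖ₑ⁻¹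
          ∂(Measure.pi fun _ : Fin (n + 1) => complexGaussian) := by
        simp_rw [h2]; rfl
    _ = ∫⁻ y, ∫⁻ x, ‖b i * x + ∑ j, b (i.succAbove j) * y j‖ₑ⁻¹ ∂complexGaussian
          ∂(Measure.pi fun _ : Fin n => complexGaussian) :=
        lintegral_pi_succAbove complexGaussian i hF
    _ ≤ ∫⁻ _y : Fin n → ℂ, negMomentBound * ‖b i‖ₑ⁻¹ ∂(Measure.pi fun _ => complexGaussian) :=
        lintegral_mono fun y => lintegral_affine_le _ _
    _ = negMomentBound * ‖b i‖ₑ⁻¹ := by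
        rw [lintegral_const, measure_univ, mul_one]

/-- Some coordinate of `b` has modulus at least `s / N`. The power of `N` lost here is harmless:
only uniformity in `b` matters. -/
lemma lintegral_dotProduct_le {N : ℕ} (b : Fin N → ℂ) {s : ℝ} (hs : s ^ 2 ≤ ∑ i, ‖b i‖ ^ 2)
    (hs0 : 0 ≤ s) (hN : 0 < N) :
    ∫⁻ g, ‖b ⬝ᵥ g‖ₑ⁻¹ ∂(gaussianVector N) ≤
      negMomentBound * N * (ENNReal.ofReal s)⁻¹ := by
  obtain ⟨i, hi⟩ : ∃ i, s ≤ N * ‖b i‖ := by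
    by_contra! hcon
    have hne : (Finset.univ : Finset (Fin N)).Nonempty := ⟨⟨0, hN⟩, Finset.mem_univ _⟩
    have hNr : (1 : ℝ) ≤ N := by exact_mod_cast hN
    have h1 : ∑ i, ‖b i‖ ^ 2 < ∑ _i : Fin N, (s / N) ^ 2 := by
      apply Finset.sum_lt_sum_of_nonempty hne
      intro i _
      have : ‖b i‖ < s / N := by rw [lt_div_iff₀ (by linarith)]; linarith [hcon i]
      exact pow_lt_pow_left₀ this (norm_nonneg _) (by norm_num)
    simp only [Finset.sum_const, Finset.card_univ, Fintype.card_fin, nsmul_eq_mul] at h1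
    have h2 : (N : ℝ) * (s / N) ^ 2 ≤ s ^ 2 := by
      have h3 : (N : ℝ) * (s / N) ^ 2 = s ^ 2 / N := by field_simp
      rw [h3]
      exact div_le_self (sq_nonneg s) hNr
    linarith
  refine (lintegral_dotProduct_le_coord b i).trans ?_
  rw [mul_assoc]
  gcongr
  by_cases hb : b i = 0
  · have : s = 0 := le_antisymm (by simpa [hb] using hi) hs0
    rw [this]; simp [hb, ENNReal.mul_top, hN.ne']
  rw [← ofReal_norm, ENNReal.inv_le_iff_inv_le, ENNReal.mul_inv (Or.inl (by simp [hN.ne']))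
    (Or.inl (by simp)), inv_inv]
  have : (N : ℝ≥0∞)⁻¹ * ENNReal.ofReal s = ENNReal.ofReal (s / N) := by
    rw [ENNReal.ofReal_div_of_pos (by exact_mod_cast hN), ENNReal.ofReal_natCast,
      ENNReal.div_eq_inv_mul]
  rw [this]
  apply ENNReal.ofReal_le_ofReal
  rw [div_le_iff₀ (by exact_mod_cast hN)]; linarith

lemma sum_norm_sq_semiUnitary_mulVec {m n : Type*} [Fintype m] [Fintype n] [DecidableEq n]
    {U : Matrix m n ℂ} (hU : IsSemiUnitary U) (x : n → ℂ) :
    ∑ i, ‖(U *ᵥ x) i‖ ^ 2 = ∑ j, ‖x j‖ ^ 2 := by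
  have h1 : frobSq (U * Matrix.of fun j (_ : Fin 1) => x j) =
    frobSq (Matrix.of fun j (_ : Fin 1) => x j) := frobSq_semiUnitary_mul hU _
  have h2 : ∀ i, (U * Matrix.of fun j (_ : Fin 1) => x j) i 0 = (U *ᵥ x) i := fun i => rfl
  simpa [frobSq, h2] using h1

/-- Square Gaussian matrices, observed through a semi-unitary matrix, have determinants with
uniformly bounded negative first moments. -/
lemma lintegral_det_mul_le {N : ℕ} (hN : 0 < N) :
    ∀ (m : ℕ) (W : Matrix (Fin N) (Fin m) ℂ), IsSemiUnitary W →
    ∫⁻ G, ‖(G * W).det‖ₑ⁻¹ ∂(gaussianMatrix m N) ≤ (negMomentBound * N) ^ m := by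
  intro m
  induction m with
  | zero => intro W _; simp
  | succ m ih =>
    intro W hW
    set W' : Matrix (Fin N) (Fin m) ℂ := W.submatrix id Fin.succ with hW'
    have hWs : IsSemiUnitary W' := by
      show W'ᴴ * W' = 1
      have : W'ᴴ * W' = (Wᴴ * W).submatrix Fin.succ Fin.succ := rfl
      rw [this, show Wᴴ * W = 1 from hW]
      ext i j; simp [Matrix.one_apply]
    -- The signed cofactors along row zero of `G W`. They depend on the other rows only, so the
    -- determinant is linear in the Gaussian row `G 0`, with coefficient vector `W D`.
    let D : (Fin m → Fin N → ℂ) → Fin (m + 1) → ℂ := fun G j =>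
      (-1) ^ (j : ℕ) * ((Matrix.of G) * W.submatrix id j.succAbove).det
    have hD : Continuous D := by
      refine continuous_pi fun j => continuous_const.mul (Continuous.matrix_det ?_)
      refine Continuous.matrix_mul ?_ continuous_const
      exact continuous_id
    let F : (Fin N → ℂ) × (Fin m → Fin N → ℂ) → ℝ≥0∞ := fun p => ‖(W *ᵥ D p.2) ⬝ᵥ p.1‖ₑ⁻¹
    have hF : Measurable F := by
      apply Measurable.inv
      apply Measurable.enorm
      have : Continuous fun p : (Fin N → ℂ) × (Fin m → Fin N → ℂ) => (W *ᵥ D p.2) ⬝ᵥ p.1 :=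
        Continuous.dotProduct (Continuous.matrix_mulVec continuous_const
          (hD.comp continuous_snd)) continuous_fst
      exact this.measurable
    have hdet : ∀ G : Fin (m + 1) → Fin N → ℂ, (Matrix.of G * W).det =
        (W *ᵥ D fun j => G j.succ) ⬝ᵥ G 0 := by
      intro G
      rw [Matrix.det_succ_row_zero]
      have h1 : ∀ j : Fin (m + 1), (Matrix.of G * W).submatrix Fin.succ j.succAbove =
        (Matrix.of fun i => G i.succ) * W.submatrix id j.succAbove := fun j => rfl
      simp_rw [h1]
      simp only [dotProduct, Matrix.mulVec, D, Matrix.mul_apply, Finset.sum_mul, Finset.mul_sum,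
        Matrix.of_apply]
      rw [Finset.sum_comm]
      refine Finset.sum_congr rfl fun i _ => Finset.sum_congr rfl fun j _ => ?_
      ring
    have hstep : ∫⁻ G, ‖(G * W).det‖ₑ⁻¹ ∂(gaussianMatrix (m + 1) N) =
        ∫⁻ G : Fin m → Fin N → ℂ, ∫⁻ g, F (g, G) ∂(gaussianVector N)
          ∂(Measure.pi fun _ => gaussianVector N) := by
      rw [← lintegral_pi_succAbove (gaussianVector N) 0 hF]
      refine lintegral_congr fun G => ?_
      exact congrArg (fun z : ℂ => ‖z‖ₑ⁻¹) (hdet G)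
    rw [hstep]
    -- `‖W D‖ = ‖D‖ ≥ |D 0|`, and `D 0` is the determinant with one row of `G` and one column of `W`
    -- removed, to which the induction hypothesis applies.
    have hinner : ∀ G : Fin m → Fin N → ℂ, ∫⁻ g, F (g, G) ∂(gaussianVector N) ≤
        negMomentBound * N * ‖((Matrix.of G) * W').det‖ₑ⁻¹ := by
      intro G
      rw [← ofReal_norm]
      refine lintegral_dotProduct_le (W *ᵥ D G) ?_ (norm_nonneg _) hN
      rw [sum_norm_sq_semiUnitary_mulVec hW]
      have h3 : ‖D G 0‖ ^ 2 ≤ ∑ j, ‖D G j‖ ^ 2 :=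
        Finset.single_le_sum (f := fun j => ‖D G j‖ ^ 2) (fun _ _ => by positivity)
          (Finset.mem_univ 0)
      refine le_trans (le_of_eq ?_) h3
      simp only [D, hW', norm_mul, norm_pow, norm_neg, norm_one, one_pow, one_mul]
      rfl
    have hfin : negMomentBound * (N : ℝ≥0∞) ≠ ⊤ :=
      ENNReal.mul_ne_top negMomentBound_ne_top (ENNReal.natCast_ne_top N)
    have hlast : ∫⁻ G : Fin m → Fin N → ℂ, ‖((Matrix.of G) * W').det‖ₑ⁻¹
        ∂(Measure.pi fun _ => gaussianVector N) ≤ (negMomentBound * N) ^ m := ih W' hWs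
    refine (lintegral_mono hinner).trans ?_
    rw [lintegral_const_mul' _ _ hfin, pow_succ, mul_comm]
    exact mul_le_mul_left hlast _

lemma measurable_frobSq {m n : Type*} [Fintype m] [Fintype n] :
    Measurable (frobSq : Matrix m n ℂ → ℝ) := by
  have : Continuous (frobSq : Matrix m n ℂ → ℝ) := by
    unfold frobSq
    exact continuous_finsetSum _ fun i _ => continuous_finsetSum _ fun j _ =>
      ((continuous_id.matrix_elem i j).norm).pow 2
  exact this.measurable

lemma integrable_frobSq_gaussianMatrix (m N : ℕ) :
    Integrable (frobSq : Matrix (Fin m) (Fin N) ℂ → ℝ) (gaussianMatrix m N) := by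
  unfold frobSq
  refine integrable_finsetSum _ fun i _ => integrable_finsetSum _ fun j _ => ?_
  have h1 : MeasurePreserving (fun g : Fin N → ℂ => g j) (gaussianVector N) complexGaussian :=
    measurePreserving_eval (fun _ : Fin N => complexGaussian) j
  have h2 : MeasurePreserving (fun G : Fin m → Fin N → ℂ => G i)
      (Measure.pi fun _ => gaussianVector N) (gaussianVector N) :=
    measurePreserving_eval (fun _ : Fin m => gaussianVector N) i
  exact (h1.comp h2).integrable_comp_of_integrable integrable_norm_sq_complexGaussian

/-- The law of a Rayleigh fading matrix. -/
lemma IsRayleighFading.map_eq {Ω : Type*} [MeasurableSpace Ω] {μ : Measure Ω}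
    [IsProbabilityMeasure μ] {K M N : ℕ}
    {Ht : Fin K → Ω → Matrix (Fin M) (Fin N) ℂ} (h : IsRayleighFading μ Ht) (k : Fin K) :
    μ.map (Ht k) = gaussianMatrix M N := by
  have hme : ∀ i j, Measurable fun ω => Ht k ω i j := fun i j =>
    (measurable_pi_apply j).comp ((measurable_pi_apply i).comp (h.measurable k))
  have h0 : iIndepFun (fun (p : Fin M × Fin N) ω => Ht k ω p.1 p.2) μ :=
    h.indep.precomp (g := fun p : Fin M × Fin N => (k, p)) (fun p q hpq => (Prod.mk.inj hpq).2)
  have h1 := (iIndepFun_iff_map_fun_eq_pi_map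
    (f := fun (p : Fin M × Fin N) ω => Ht k ω p.1 p.2)
    (fun p => (hme p.1 p.2).aemeasurable)).1 h0
  simp only [h.law] at h1
  have h2 := Measure.infinitePi_map_curry (fun (_ : Fin M) (_ : Fin N) => complexGaussian)
  simp only [Measure.infinitePi_eq_pi] at h2
  have h3 : μ.map (Ht k) = (μ.map fun ω (p : Fin M × Fin N) => Ht k ω p.1 p.2).map
      (MeasurableEquiv.curry (Fin M) (Fin N) ℂ) := by
    rw [Measure.map_map (MeasurableEquiv.curry (Fin M) (Fin N) ℂ).measurable
      (measurable_pi_lambda _ fun p => hme p.1 p.2)]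
    rfl
  rw [h3, h1]
  exact h2

end Gaussian

/-! ### Isotropic random projections and nondegeneracy -/

section Isotropy

variable {Ω : Type*} [MeasurableSpace Ω] {μ : Measure Ω} {N a : ℕ}

/-- The law of the random matrix `Z` is invariant under unitary conjugation. -/
def IsIsotropic (μ : Measure Ω) (Z : Ω → Matrix (Fin N) (Fin N) ℂ) : Prop :=
  ∀ Q ∈ Matrix.unitaryGroup (Fin N) ℂ, μ.map (fun ω => Q * Z ω * Qᴴ) = μ.map Z

lemma measurable_conj_mul {m n : Type*} [Fintype m] [Fintype n] (A : Matrix m n ℂ) (B : Matrix n m ℂ) :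
    Measurable fun Z : Matrix n n ℂ => A * Z * B := by
  have : Continuous fun Z : Matrix n n ℂ => A * Z * B :=
    (continuous_const.matrix_mul continuous_id).matrix_mul continuous_const
  exact this.measurable

/-- Pick a unitary `Q` with `Q V' = V`; then `Vᴴ Z V = V'ᴴ (Qᴴ Z Q) V'`, and `Qᴴ Z Q` has the law of
`Z`. -/
lemma IsIsotropic.measure_preimage_eq {Z : Ω → Matrix (Fin N) (Fin N) ℂ} (hZ : IsIsotropic μ Z)
    (hm : Measurable Z) {V V' : Matrix (Fin N) (Fin a) ℂ} (hV : IsSemiUnitary V)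
    (hV' : IsSemiUnitary V') {s : Set (Matrix (Fin a) (Fin a) ℂ)} (hs : MeasurableSet s) :
    μ {ω | Vᴴ * Z ω * V ∈ s} = μ {ω | V'ᴴ * Z ω * V' ∈ s} := by
  obtain ⟨Q, hQ, hQV⟩ := exists_unitary_mul_eq hV' hV
  have h1 := hZ Qᴴ (Unitary.star_mem hQ)
  have hT : MeasurableSet {Y : Matrix (Fin N) (Fin N) ℂ | V'ᴴ * Y * V' ∈ s} :=
    measurable_conj_mul _ _ hs
  have h2 := congrArg (fun ρ => ρ {Y : Matrix (Fin N) (Fin N) ℂ | V'ᴴ * Y * V' ∈ s}) h1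
  have hmc : Measurable fun ω => Qᴴ * Z ω * Qᴴᴴ := (measurable_conj_mul _ _).comp hm
  rw [Measure.map_apply hmc hT, Measure.map_apply hm hT] at h2
  refine Eq.trans ?_ h2
  congr 1
  ext ω
  simp only [Set.mem_ofPred_eq, Set.mem_preimage, ← hQV, Matrix.conjTranspose_mul,
    Matrix.conjTranspose_conjTranspose, Matrix.mul_assoc]

lemma IsIsotropic.one_sub {Z : Ω → Matrix (Fin N) (Fin N) ℂ} (hZ : IsIsotropic μ Z)
    (hm : Measurable Z) : IsIsotropic μ (fun ω => 1 - Z ω) := by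
  intro Q hQ
  have hQ' : Q * Qᴴ = 1 := Matrix.mem_unitaryGroup_iff.1 hQ
  have hs : Measurable fun Y : Matrix (Fin N) (Fin N) ℂ => 1 - Y :=
    (continuous_const.sub continuous_id).measurable
  have h := congrArg (fun ρ => ρ.map fun Y : Matrix (Fin N) (Fin N) ℂ => 1 - Y) (hZ Q hQ)
  have hmc : Measurable fun ω => Q * Z ω * Qᴴ := (measurable_conj_mul _ _).comp hm
  rw [Measure.map_map hs hm, Measure.map_map hs hmc] at h
  refine Eq.trans ?_ h
  congr 1
  funext ω
  simp [Matrix.mul_sub, Matrix.sub_mul, hQ']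

lemma measurable_det {n : Type*} [Fintype n] [DecidableEq n] :
    Measurable (fun A : Matrix n n ℂ => A.det) :=
  (continuous_id.matrix_det).measurable

/-- A variable with a finite negative moment vanishes with probability zero. -/
lemma ae_det_mul_ne_zero {W : Matrix (Fin N) (Fin a) ℂ} (hW : IsSemiUnitary W) :
    ∀ᵐ G ∂(gaussianMatrix a N), (G * W).det ≠ 0 := by
  obtain rfl | hN := Nat.eq_zero_or_pos N
  · have : a = 0 := by simpa using hW.card_le
    subst this
    simp
  have h := lintegral_det_mul_le hN a W hW
  have hfin : (negMomentBound * (N : ℝ≥0∞)) ^ a ≠ ⊤ :=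
    ENNReal.pow_ne_top (ENNReal.mul_ne_top negMomentBound_ne_top (ENNReal.natCast_ne_top N))
  have hmeas : Measurable fun G : Matrix (Fin a) (Fin N) ℂ => ‖(G * W).det‖ₑ⁻¹ := by
    have : Continuous fun G : Matrix (Fin a) (Fin N) ℂ => (G * W).det :=
      (continuous_id.matrix_mul continuous_const).matrix_det
    exact this.measurable.enorm.inv
  have h2 := ae_lt_top hmeas (ne_top_of_le_ne_top hfin h)
  filter_upwards [h2] with G hG h0
  simp [h0] at hG

lemma exists_ne_zero_of_det_eq_zero {n : Type*} [Fintype n] [DecidableEq n] {A : Matrix n n ℂ}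
    (h : A.det = 0) : ∃ x, x ≠ 0 ∧ A *ᵥ x = 0 :=
  Matrix.exists_mulVec_eq_zero_iff.2 h

lemma det_eq_zero_of_mulVec {n : Type*} [Fintype n] [DecidableEq n] {A : Matrix n n ℂ}
    {x : n → ℂ} (hx : x ≠ 0) (h : A *ᵥ x = 0) : A.det = 0 :=
  Matrix.exists_mulVec_eq_zero_iff.1 ⟨x, hx, h⟩

/-- If a projection annihilates a quadratic form on `x`, it annihilates `x`. -/
lemma mulVec_eq_zero_of_projection {n p : Type*} [Fintype n] [Fintype p]
    {Z : Matrix n n ℂ} (hZh : Zᴴ = Z) (hZZ : Z * Z = Z) (A : Matrix n p ℂ) {x : p → ℂ}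
    (h : (Aᴴ * Z * A) *ᵥ x = 0) : (Z * A) *ᵥ x = 0 := by
  have h1 : (Z * A)ᴴ * (Z * A) = Aᴴ * Z * A := by
    rw [Matrix.conjTranspose_mul, hZh, Matrix.mul_assoc, ← Matrix.mul_assoc Z, hZZ,
      Matrix.mul_assoc]
  rw [← h1] at h
  rwa [Matrix.conjTranspose_mul_self_mulVec_eq_zero] at h

/-- An isotropic random projection of rank at least `a` is nondegenerate on a fixed
`a`-dimensional subspace. -/
lemma IsIsotropic.ae_det_ne_zero [IsProbabilityMeasure μ]
    {Z : Ω → Matrix (Fin N) (Fin N) ℂ} (hZ : IsIsotropic μ Z)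
    (hm : Measurable Z) (hZh : ∀ ω, (Z ω)ᴴ = Z ω) (hZZ : ∀ ω, Z ω * Z ω = Z ω)
    (hW : ∀ ω, ∃ W : Matrix (Fin N) (Fin a) ℂ, IsSemiUnitary W ∧ Z ω * W = W)
    {V : Matrix (Fin N) (Fin a) ℂ} (hV : IsSemiUnitary V) :
    ∀ᵐ ω ∂μ, (Vᴴ * Z ω * V).det ≠ 0 := by
  have hS : MeasurableSet {p : Matrix (Fin a) (Fin N) ℂ × Ω | (p.1 * Z p.2 * p.1ᴴ).det = 0} := by
    have : Continuous fun p : Matrix (Fin a) (Fin N) ℂ × Matrix (Fin N) (Fin N) ℂ =>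
        (p.1 * p.2 * p.1ᴴ).det :=
      ((continuous_fst.matrix_mul continuous_snd).matrix_mul
        continuous_fst.matrix_conjTranspose).matrix_det
    have h2 := this.measurable.comp (measurable_fst.prodMk (hm.comp measurable_snd) :
      Measurable fun p : Matrix (Fin a) (Fin N) ℂ × Ω => (p.1, Z p.2))
    exact h2 (measurableSet_singleton 0)
  -- An auxiliary Gaussian `G` replaces the fixed subspace. For every `ω` the determinant is nonzero
  -- for almost all `G`, since it could vanish only together with `det (G W)`; Fubini then exchanges
  -- the quantifiers.
  have hzero : (gaussianMatrix a N).prod μ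
      {p : Matrix (Fin a) (Fin N) ℂ × Ω | (p.1 * Z p.2 * p.1ᴴ).det = 0} = 0 := by
    rw [Measure.prod_apply_symm hS, lintegral_eq_zero_iff (measurable_measure_prodMk_right hS)]
    refine Eventually.of_forall fun ω => ?_
    obtain ⟨W, hWs, hZW⟩ := hW ω
    have h := ae_det_mul_ne_zero hWs
    rw [ae_iff] at h
    refine measure_mono_null ?_ h
    intro G hG
    simp only [Set.mem_preimage, Set.mem_ofPred_eq] at hG
    obtain ⟨x, hx, h0⟩ := exists_ne_zero_of_det_eq_zero hG
    have h1 : (Z ω * Gᴴ) *ᵥ x = 0 := by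
      apply mulVec_eq_zero_of_projection (hZh ω) (hZZ ω)
      rwa [Matrix.conjTranspose_conjTranspose]
    have h2 : (G * W)ᴴ *ᵥ x = 0 := by
      have e : (G * W)ᴴ = Wᴴ * (Z ω * Gᴴ) := by
        conv_lhs => rw [← hZW]
        simp [Matrix.conjTranspose_mul, hZh, Matrix.mul_assoc]
      rw [e, ← Matrix.mulVec_mulVec, h1, Matrix.mulVec_zero]
    have h3 := det_eq_zero_of_mulVec hx h2
    rw [Matrix.det_conjTranspose, star_eq_zero] at h3
    simpa using h3
  rw [Measure.prod_apply hS, lintegral_eq_zero_iff (measurable_measure_prodMk_left hS)] at hzero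
  -- Fix one `G` that is good for almost all `ω`. Invertibility of `G V` only serves to make the
  -- rows of `G` independent; isotropy then transports the statement from the row space of `G` to
  -- the range of `V`.
  obtain ⟨G, hG0, hGV⟩ := (hzero.and (ae_det_mul_ne_zero hV)).exists
  have hinj : ∀ x, Gᴴ *ᵥ x = 0 → x = 0 := by
    intro x hx
    by_contra hne
    have h2 : (G * V)ᴴ *ᵥ x = 0 := by
      rw [Matrix.conjTranspose_mul, ← Matrix.mulVec_mulVec, hx, Matrix.mulVec_zero]
    have h3 := det_eq_zero_of_mulVec hne h2
    rw [Matrix.det_conjTranspose, star_eq_zero] at h3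
    exact hGV h3
  obtain ⟨V', hV', hfac, -⟩ := exists_semiUnitary_factor Gᴴ hinj (Fintype.card_fin a)
  rw [ae_iff]
  simp only [ne_eq, not_not]
  have hsing : MeasurableSet {Y : Matrix (Fin a) (Fin a) ℂ | Y.det = 0} :=
    measurable_det (measurableSet_singleton 0)
  have key := hZ.measure_preimage_eq hm hV hV' hsing
  simp only [Set.mem_ofPred_eq] at key
  rw [key]
  refine measure_mono_null ?_ hG0
  intro ω hω
  simp only [Set.mem_ofPred_eq, Set.mem_preimage] at hω ⊢
  have e : G * Z ω * Gᴴ = (V'ᴴ * Gᴴ)ᴴ * (V'ᴴ * Z ω * V') * (V'ᴴ * Gᴴ) := by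
    have h' : G = G * (V' * V'ᴴ) := by
      have := congrArg Matrix.conjTranspose hfac
      simp only [Matrix.conjTranspose_mul, Matrix.conjTranspose_conjTranspose] at this
      exact this.symm
    calc G * Z ω * Gᴴ = G * (V' * V'ᴴ) * Z ω * (V' * V'ᴴ * Gᴴ) := by rw [hfac, ← h']
      _ = _ := by simp [Matrix.conjTranspose_mul, Matrix.mul_assoc]
  rw [e, Matrix.det_mul, Matrix.det_mul, hω]
  simp

end Isotropy

/-! ### Projected lengths have no atoms -/

section NoAtoms

variable {Ω : Type*} [MeasurableSpace Ω] {μ : Measure Ω} [IsProbabilityMeasure μ] {N : ℕ}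

lemma isHermitian_mul_conjTranspose {d : ℕ} (U : Matrix (Fin N) (Fin d) ℂ) :
    (U * Uᴴ)ᴴ = U * Uᴴ := by simp [Matrix.conjTranspose_mul]

lemma IsSemiUnitary.mul_conjTranspose_idem {d : ℕ} {U : Matrix (Fin N) (Fin d) ℂ}
    (hU : IsSemiUnitary U) : U * Uᴴ * (U * Uᴴ) = U * Uᴴ := by
  rw [Matrix.mul_assoc, ← Matrix.mul_assoc Uᴴ, show Uᴴ * U = 1 from hU, Matrix.one_mul]

lemma measurable_mul_conjTranspose {m n : Type*} [Fintype m] [Fintype n] :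
    Measurable fun U : Matrix m n ℂ => U * Uᴴ := by
  have : Continuous fun U : Matrix m n ℂ => U * Uᴴ :=
    continuous_id.matrix_mul continuous_id.matrix_conjTranspose
  exact this.measurable

/-- The inclusion of `ℂ^(m+1)` into `ℂ^(m+2)` that rotates the first basis vector towards the last
one. -/
def tilt (m : ℕ) (u : ℂ) : Matrix (Fin (m + 2)) (Fin (m + 1)) ℂ :=
  Matrix.of fun i j => Fin.lastCases (motive := fun _ => ℂ) (if j = 0 then u * ((√2 : ℝ) : ℂ)⁻¹ else 0)
    (fun i => if i = j then (if j = 0 then ((√2 : ℝ) : ℂ)⁻¹ else 1) else 0) i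

lemma isSemiUnitary_tilt (m : ℕ) {u : ℂ} (hu : ‖u‖ = 1) : IsSemiUnitary (tilt m u) := by
  have hs : ((√2 : ℝ) : ℂ) * ((√2 : ℝ) : ℂ) = 2 := by
    rw [← Complex.ofReal_mul, Real.mul_self_sqrt (by norm_num)]; norm_num
  have hs0 : ((√2 : ℝ) : ℂ) ≠ 0 := by
    intro h; rw [h] at hs; norm_num at hs
  have huu : (starRingEnd ℂ) u * u = 1 := by
    rw [RCLike.conj_mul, hu]; norm_num
  show (tilt m u)ᴴ * tilt m u = 1
  ext j l
  rw [Matrix.mul_apply, Fin.sum_univ_castSucc]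
  simp only [Matrix.conjTranspose_apply, tilt, Matrix.of_apply, Fin.lastCases_castSucc,
    Fin.lastCases_last, Matrix.one_apply]
  rw [Finset.sum_eq_single j]
  · by_cases hj : j = 0 <;> by_cases hl : l = 0
    · subst hj; subst hl
      simp only [if_true, star_mul', RCLike.star_def, map_inv₀, Complex.conj_ofReal]
      have e : (((√2 : ℝ) : ℂ))⁻¹ * ((√2 : ℝ) : ℂ)⁻¹ = 1 / 2 := by
        rw [← mul_inv, hs]; norm_num
      linear_combination e + (((√2 : ℝ) : ℂ))⁻¹ * ((√2 : ℝ) : ℂ)⁻¹ * huu + e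
    · subst hj
      simp [hl, Ne.symm hl]
    · subst hl
      simp [hj]
    · by_cases hjl : j = l <;> simp [hj, hl, hjl]
  · intro b _ hb
    simp [hb]
  · simp

/-- The point is that the phase `u` enters only through the real part of `u` times a fixed complex
number. -/
lemma frobSq_tilt (m : ℕ) {u : ℂ} (hu : ‖u‖ = 1) (ξ : Matrix (Fin (m + 2)) (Fin 1) ℂ) :
    frobSq ((tilt m u)ᴴ * ξ) = (∑ j : Fin m, ‖ξ j.succ.castSucc 0‖ ^ 2 +
      (‖ξ 0 0‖ ^ 2 + ‖ξ (Fin.last _) 0‖ ^ 2) / 2) +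
      (u * (ξ 0 0 * (starRingEnd ℂ) (ξ (Fin.last _) 0))).re := by
  have h : ∀ j, ((tilt m u)ᴴ * ξ) j 0 = if j = 0 then
      ((√2 : ℝ) : ℂ)⁻¹ * (ξ 0 0 + (starRingEnd ℂ) u * ξ (Fin.last _) 0) else ξ j.castSucc 0 := by
    intro j
    rw [Matrix.mul_apply, Fin.sum_univ_castSucc]
    simp only [Matrix.conjTranspose_apply, tilt, Matrix.of_apply, Fin.lastCases_castSucc,
      Fin.lastCases_last]
    rw [Finset.sum_eq_single j]
    · by_cases hj : j = 0
      · subst hj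
        simp only [if_true, star_mul', RCLike.star_def, map_inv₀, Complex.conj_ofReal,
          Fin.castSucc_zero]
        ring
      · simp [hj]
    · intro b _ hb
      simp [hb]
    · simp
  have hsq : (√2)⁻¹ ^ 2 = (1 : ℝ) / 2 := by
    rw [inv_pow, Real.sq_sqrt (by norm_num)]; norm_num
  have hn : ‖((√2 : ℝ) : ℂ)⁻¹‖ = (√2)⁻¹ := by
    rw [norm_inv, Complex.norm_real, Real.norm_of_nonneg (by positivity)]
  have hu2 : u.re * u.re + u.im * u.im = 1 := by
    rw [← Complex.normSq_apply, Complex.normSq_eq_norm_sq, hu]; norm_num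
  simp only [frobSq, Finset.univ_unique, Fin.default_eq_zero, Finset.sum_singleton, h]
  rw [Fin.sum_univ_succ]
  simp only [if_true, Fin.succ_ne_zero, if_false]
  rw [norm_mul, mul_pow, hn, hsq]
  have e : ‖ξ 0 0 + (starRingEnd ℂ) u * ξ (Fin.last _) 0‖ ^ 2 = ‖ξ 0 0‖ ^ 2 +
      ‖ξ (Fin.last _) 0‖ ^ 2 + 2 * (u * (ξ 0 0 * (starRingEnd ℂ) (ξ (Fin.last _) 0))).re := by
    simp only [← Complex.normSq_eq_norm_sq, Complex.normSq_apply, Complex.add_re, Complex.add_im,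
      Complex.mul_re, Complex.mul_im, Complex.conj_re, Complex.conj_im]
    linear_combination ((ξ (Fin.last (m + 1)) 0).re ^ 2 + (ξ (Fin.last (m + 1)) 0).im ^ 2) * hu2
  rw [e]
  ring

/-- On the unit circle the conjugate of `u` is `1/u`, so the condition becomes a quadratic equation
for `u` with leading coefficient `w`. -/
lemma card_filter_re_le {w : ℂ} (hw : w ≠ 0) (s : ℝ) (T : Finset ℂ) (hT : ∀ u ∈ T, ‖u‖ = 1) :
    (T.filter fun u => (u * w).re = s).card ≤ 2 := by
  classical
  let p : Polynomial ℂ := Polynomial.C w * Polynomial.X ^ 2 + Polynomial.C (-2 * (s : ℂ)) *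
    Polynomial.X + Polynomial.C ((starRingEnd ℂ) w)
  have hdeg : p.natDegree = 2 := Polynomial.natDegree_quadratic hw
  have hp0 : p ≠ 0 := by
    intro h; rw [h] at hdeg; simp at hdeg
  have hsub : T.filter (fun u => (u * w).re = s) ⊆ p.roots.toFinset := by
    intro u hu
    rw [Finset.mem_filter] at hu
    rw [Multiset.mem_toFinset, Polynomial.mem_roots hp0, Polynomial.IsRoot]
    have h1 : u * w + (starRingEnd ℂ) (u * w) = 2 * (s : ℂ) := by
      rw [RCLike.add_conj, show RCLike.re (u * w) = s from hu.2]
      rfl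
    have huu : (starRingEnd ℂ) u * u = 1 := by
      rw [RCLike.conj_mul, hT u hu.1]; norm_num
    rw [map_mul] at h1
    simp only [p, Polynomial.eval_add, Polynomial.eval_mul, Polynomial.eval_C, Polynomial.eval_pow,
      Polynomial.eval_X]
    linear_combination u * h1 - (starRingEnd ℂ) w * huu
  calc _ ≤ p.roots.toFinset.card := Finset.card_le_card hsub
    _ ≤ Multiset.card p.roots := Multiset.toFinset_card_le _
    _ ≤ p.natDegree := Polynomial.card_roots' p
    _ = 2 := hdeg

lemma infinite_unit_complex : {u : ℂ | ‖u‖ = 1}.Infinite := by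
  have h : IsPreconnected (Metric.sphere (0 : ℂ) 1) :=
    isPreconnected_sphere (by rw [Complex.rank_real_complex]; norm_num) _ _
  have h2 : (Metric.sphere (0 : ℂ) 1).Nontrivial :=
    ⟨1, by simp, -1, by simp, by norm_num⟩
  have h3 := h.infinite_of_nontrivial h2
  have e : {u : ℂ | ‖u‖ = 1} = Metric.sphere (0 : ℂ) 1 := by ext; simp
  rwa [e]

lemma frobSq_conjTranspose_mul_eq {d r : ℕ} (V : Matrix (Fin N) (Fin r) ℂ)
    (U : Matrix (Fin N) (Fin d) ℂ) : frobSq (Vᴴ * U) = (Vᴴ * (U * Uᴴ) * V).trace.re := by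
  have : Vᴴ * (U * Uᴴ) * V = (Vᴴ * U) * (Vᴴ * U)ᴴ := by
    simp [Matrix.conjTranspose_mul, Matrix.mul_assoc]
  rw [this, trace_mul_conjTranspose_self, Complex.ofReal_re]

lemma measurable_trace_re {n : Type*} [Fintype n] :
    Measurable fun A : Matrix n n ℂ => A.trace.re :=
  (Complex.continuous_re.comp continuous_id.matrix_trace).measurable

/-- The squared length of the projection of an isotropic unit vector to a fixed proper subspace has
no atoms. -/
lemma measure_frobSq_eq_zero {m : ℕ} {U : Ω → Matrix (Fin N) (Fin 1) ℂ} (hm : Measurable U)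
    (hU : ∀ ω, IsSemiUnitary (U ω)) (hiso : IsIsotropic μ fun ω => U ω * (U ω)ᴴ)
    (hmN : m + 1 < N) {V : Matrix (Fin N) (Fin (m + 1)) ℂ} (hV : IsSemiUnitary V) (t : ℝ) :
    μ {ω | frobSq (Vᴴ * U ω) = t} = 0 := by
  have hX : Measurable fun ω => U ω * (U ω)ᴴ := measurable_mul_conjTranspose.comp hm
  obtain ⟨F, hF, -⟩ := exists_semiUnitary_orthogonal (N := N) (a := m + 2)
    (0 : Matrix (Fin N) (Fin 0) ℂ) (by simp; omega)
  have hpu : ∀ u : ℂ, ‖u‖ = 1 →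
      μ {ω | frobSq ((F * tilt m u)ᴴ * U ω) = t} = μ {ω | frobSq (Vᴴ * U ω) = t} := by
    intro u hu
    have hs : MeasurableSet {Y : Matrix (Fin (m + 1)) (Fin (m + 1)) ℂ | Y.trace.re = t} :=
      measurable_trace_re (measurableSet_singleton t)
    have := hiso.measure_preimage_eq hX (hF.mul (isSemiUnitary_tilt m hu)) hV hs
    simpa only [Set.mem_ofPred_eq, frobSq_conjTranspose_mul_eq] using this
  -- The coefficient of the phase is built from two coordinates of the projected vector; each is
  -- almost surely nonzero, by nondegeneracy on a one-dimensional subspace.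
  have hnz : ∀ i : Fin (m + 2), ∀ᵐ ω ∂μ, (Fᴴ * U ω) i 0 ≠ 0 := by
    intro i
    let f : Matrix (Fin N) (Fin 1) ℂ := F.submatrix id fun _ => i
    have hf : IsSemiUnitary f := by
      show fᴴ * f = 1
      have : fᴴ * f = (Fᴴ * F).submatrix (fun _ => i) (fun _ => i) := rfl
      rw [this, show Fᴴ * F = 1 from hF]
      ext a b
      rw [Subsingleton.elim a b]
      simp
    have h := hiso.ae_det_ne_zero hX (fun ω => isHermitian_mul_conjTranspose _)
      (fun ω => (hU ω).mul_conjTranspose_idem)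
      (fun ω => ⟨U ω, hU ω, by rw [Matrix.mul_assoc, show (U ω)ᴴ * U ω = 1 from hU ω,
        Matrix.mul_one]⟩) hf
    filter_upwards [h] with ω hω h0
    apply hω
    have e : fᴴ * (U ω * (U ω)ᴴ) * f = (fᴴ * U ω) * ((U ω)ᴴ * f) := by
      simp only [Matrix.mul_assoc]
    have e0 : (fᴴ * U ω).det = (Fᴴ * U ω) i 0 := by
      rw [Matrix.det_unique]; rfl
    rw [e, Matrix.det_mul, e0, h0, zero_mul]
  have hsets : ∀ u, MeasurableSet {ω | frobSq ((F * tilt m u)ᴴ * U ω) = t} := by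
    intro u
    have : Measurable fun ω => frobSq ((F * tilt m u)ᴴ * U ω) := by
      have hc : Continuous fun A : Matrix (Fin N) (Fin 1) ℂ => (F * tilt m u)ᴴ * A :=
        continuous_const.matrix_mul continuous_id
      exact measurable_frobSq.comp (hc.measurable.comp hm)
    exact this (measurableSet_singleton t)
  -- Any `n` phases give `n` events of equal probability, while almost every `ω` lies in at most two
  -- of them.
  have hcount : ∀ n : ℕ, (n : ℝ≥0∞) * μ {ω | frobSq (Vᴴ * U ω) = t} ≤ 2 := by
    intro n
    classical
    obtain ⟨T, hTs, hTc⟩ := infinite_unit_complex.exists_subset_card_eq n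
    have hT : ∀ u ∈ T, ‖u‖ = 1 := fun u hu => hTs hu
    calc (n : ℝ≥0∞) * μ {ω | frobSq (Vᴴ * U ω) = t}
        = ∑ u ∈ T, μ {ω | frobSq ((F * tilt m u)ᴴ * U ω) = t} := by
          rw [Finset.sum_congr rfl fun u hu => hpu u (hT u hu), Finset.sum_const, hTc, nsmul_eq_mul]
      _ = ∑ u ∈ T, ∫⁻ ω, {ω | frobSq ((F * tilt m u)ᴴ * U ω) = t}.indicator 1 ω ∂μ := by
          refine Finset.sum_congr rfl fun u _ => ?_
          rw [lintegral_indicator_one (hsets u)]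
      _ = ∫⁻ ω, ∑ u ∈ T, {ω | frobSq ((F * tilt m u)ᴴ * U ω) = t}.indicator 1 ω ∂μ := by
          rw [lintegral_finsetSum _ fun u _ => measurable_one.indicator (hsets u)]
      _ ≤ ∫⁻ _ω, 2 ∂μ := by
          refine lintegral_mono_ae ?_
          filter_upwards [hnz 0, hnz (Fin.last _)] with ω h0 hl
          have hw : (Fᴴ * U ω) 0 0 * (starRingEnd ℂ) ((Fᴴ * U ω) (Fin.last _) 0) ≠ 0 :=
            mul_ne_zero h0 ((map_ne_zero _).2 hl)
          have hc := card_filter_re_le hw (t - (∑ j : Fin m, ‖(Fᴴ * U ω) j.succ.castSucc 0‖ ^ 2 +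
            (‖(Fᴴ * U ω) 0 0‖ ^ 2 + ‖(Fᴴ * U ω) (Fin.last _) 0‖ ^ 2) / 2)) T hT
          have e : ∑ u ∈ T, {ω | frobSq ((F * tilt m u)ᴴ * U ω) = t}.indicator (1 : Ω → ℝ≥0∞) ω ≤
              ((T.filter fun u => (u * ((Fᴴ * U ω) 0 0 *
                (starRingEnd ℂ) ((Fᴴ * U ω) (Fin.last _) 0))).re =
              t - (∑ j : Fin m, ‖(Fᴴ * U ω) j.succ.castSucc 0‖ ^ 2 +
            (‖(Fᴴ * U ω) 0 0‖ ^ 2 + ‖(Fᴴ * U ω) (Fin.last _) 0‖ ^ 2) / 2)).card : ℝ≥0∞) := by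
            rw [Finset.card_filter]
            push_cast
            refine Finset.sum_le_sum fun u hu => ?_
            rw [Set.indicator_apply]
            split_ifs with h1 h2
            · simp
            · exfalso
              apply h2
              simp only [Set.mem_ofPred_eq] at h1
              rw [Matrix.conjTranspose_mul, Matrix.mul_assoc, frobSq_tilt m (hT u hu)] at h1
              linarith
            · simp
            · simp
          exact e.trans (by exact_mod_cast hc)
      _ = 2 := by simp
  by_contra hne
  have hpos : 0 < (μ {ω | frobSq (Vᴴ * U ω) = t}).toReal :=
    ENNReal.toReal_pos hne (measure_ne_top _ _)
  obtain ⟨n, hn⟩ := exists_nat_gt (2 / (μ {ω | frobSq (Vᴴ * U ω) = t}).toReal)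
  have h1 := ENNReal.toReal_mono (by norm_num) (hcount n)
  rw [ENNReal.toReal_mul, ENNReal.toReal_natCast] at h1
  rw [div_lt_iff₀ hpos] at hn
  simp only [ENNReal.toReal_ofNat] at h1
  linarith

lemma measure_eq_zero_of_indep {A B : Ω → ℝ} (hA : Measurable A) (hB : Measurable B)
    (h : IndepFun A B μ) (h0 : ∀ t, μ {ω | A ω = t} = 0) : μ {ω | A ω = B ω} = 0 := by
  have h1 := (indepFun_iff_map_prod_eq_prod_map_map hA.aemeasurable hB.aemeasurable).1 h
  have hs : MeasurableSet {p : ℝ × ℝ | p.1 = p.2} := measurableSet_eq_fun measurable_fst measurable_snd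
  have h2 : μ {ω | A ω = B ω} = μ.map (fun ω => (A ω, B ω)) {p : ℝ × ℝ | p.1 = p.2} := by
    rw [Measure.map_apply (hA.prodMk hB) hs]; rfl
  have : IsProbabilityMeasure (μ.map A) := Measure.isProbabilityMeasure_map hA.aemeasurable
  have : IsProbabilityMeasure (μ.map B) := Measure.isProbabilityMeasure_map hB.aemeasurable
  rw [h2, h1, Measure.prod_apply_symm hs, lintegral_eq_zero_iff (measurable_measure_prodMk_right hs)]
  refine Eventually.of_forall fun t => ?_
  have : (fun x : ℝ => (x, t)) ⁻¹' {p : ℝ × ℝ | p.1 = p.2} = {t} := by ext; simp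
  simp only [this]
  rw [Measure.map_apply hA (measurableSet_singleton t)]
  exact h0 t

end NoAtoms

/-! ### Covering the Grassmannian -/

section Covering

variable {N d r L : ℕ}

/-- A semi-unitary matrix is determined by some of its rows, with coefficients of modulus at most
one for the others. -/
lemma exists_rows_coeff_le_one {U : Matrix (Fin N) (Fin d) ℂ} (hU : IsSemiUnitary U) :
    ∃ f : Fin d → Fin N, Function.Injective f ∧ ∃ Y : Matrix (Fin N) (Fin d) ℂ,
      U = Y * U.submatrix f id ∧ ∀ i j, ‖Y i j‖ ≤ 1 := by
  have hrank : Module.finrank ℂ (Submodule.span ℂ (Set.range U.row)) = d := by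
    rw [← Matrix.rank_eq_finrank_span_row]
    apply le_antisymm
    · simpa using U.rank_le_width
    · have h1 : (Uᴴ * U).rank ≤ U.rank := Matrix.rank_mul_le_right _ _
      rw [show Uᴴ * U = 1 from hU, Matrix.rank_one, Fintype.card_fin] at h1
      exact h1
  have key : ∃ g : Fin d → (Fin d → ℂ), (∀ i, g i ∈ Set.range U.row) ∧ LinearIndependent ℂ g := by
    obtain h := Submodule.exists_fun_fin_finrank_span_eq ℂ (Set.range U.row)
    rw [hrank] at h
    obtain ⟨g, h1, -, h2⟩ := h
    exact ⟨g, h1, h2⟩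
  obtain ⟨g, hg, hli⟩ := key
  choose f0 hf0 using hg
  have hf0det : (U.submatrix f0 id).det ≠ 0 := by
    have h1 : U.submatrix f0 id = Matrix.of g := by
      ext i j; exact congrFun (hf0 i) j
    have h2 := Matrix.linearIndependent_rows_iff_isUnit.1
      (show LinearIndependent ℂ (Matrix.of g).row from hli)
    rw [h1]
    exact ((Matrix.isUnit_iff_isUnit_det _).1 h2).ne_zero
  have : Nonempty (Fin d → Fin N) := ⟨f0⟩
  -- Take `d` rows with the largest minor: by Cramer's rule every coefficient of another row is a
  -- ratio of a minor to this one.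
  obtain ⟨f, hf⟩ := Finite.exists_max fun f : Fin d → Fin N => ‖(U.submatrix f id).det‖
  have hdet : (U.submatrix f id).det ≠ 0 := by
    have := hf f0
    intro h0
    rw [h0, norm_zero] at this
    exact hf0det (norm_le_zero_iff.1 this)
  refine ⟨f, ?_, U * (U.submatrix f id)⁻¹, ?_, ?_⟩
  · intro a b hab
    by_contra hne
    apply hdet
    apply Matrix.det_zero_of_row_eq hne
    funext j
    simp [hab]
  · rw [Matrix.mul_assoc, Matrix.nonsing_inv_mul _ hdet.isUnit, Matrix.mul_one]
  · intro i l
    set Y := U * (U.submatrix f id)⁻¹ with hY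
    have hUY : U = Y * U.submatrix f id := by
      rw [hY, Matrix.mul_assoc, Matrix.nonsing_inv_mul _ hdet.isUnit, Matrix.mul_one]
    have hrow : U i = ∑ k, Y i k • (U.submatrix f id) k := by
      funext j
      have := congrFun (congrFun hUY i) j
      rw [this, Matrix.mul_apply]
      simp
    have h1 := Matrix.det_updateRow_sum (U.submatrix f id) l (fun k => Y i k)
    rw [← hrow, smul_eq_mul] at h1
    have h2 : (U.submatrix f id).updateRow l (U i) = U.submatrix (Function.update f l i) id := by
      ext a b
      by_cases h : a = l
      · subst h; simp
      · simp [Matrix.updateRow_ne h, Function.update_of_ne h]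
    have h3 := hf (Function.update f l i)
    rw [← h2, h1, norm_mul] at h3
    exact le_of_mul_le_mul_right (h3.trans_eq (one_mul _).symm) (norm_pos_iff.2 hdet)

/-- The points of a square grid in the complex unit square. -/
def gridPoint (n : ℕ) (p : Fin (2 * n + 1) × Fin (2 * n + 1)) : ℂ :=
  ⟨((p.1 : ℕ) - n : ℝ) / n, ((p.2 : ℕ) - n : ℝ) / n⟩

lemma exists_grid_coord {n : ℕ} (hn : 0 < n) {x : ℝ} (hx : |x| ≤ 1) :
    ∃ a : Fin (2 * n + 1), |x - ((a : ℕ) - n : ℝ) / n| ≤ 1 / n := by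
  have hnr : (0 : ℝ) < n := by exact_mod_cast hn
  obtain ⟨h1, h2⟩ := abs_le.1 hx
  have h3 : 0 ≤ (x + 1) * n := by nlinarith
  have h4 : ⌊(x + 1) * n⌋₊ < 2 * n + 1 := by
    rw [Nat.floor_lt h3]
    push_cast
    nlinarith
  refine ⟨⟨_, h4⟩, ?_⟩
  have h5 := Nat.floor_le h3
  have h6 := Nat.lt_floor_add_one ((x + 1) * n)
  have : x - ((⌊(x + 1) * n⌋₊ : ℕ) - n : ℝ) / n = ((x + 1) * n - ⌊(x + 1) * n⌋₊) / n := by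
    field_simp; ring
  simp only
  rw [this, abs_of_nonneg (by apply div_nonneg <;> linarith)]
  gcongr
  linarith

lemma exists_gridPoint {n : ℕ} (hn : 0 < n) {z : ℂ} (hz : ‖z‖ ≤ 1) :
    ∃ p, ‖z - gridPoint n p‖ ≤ 2 / n := by
  obtain ⟨a, ha⟩ := exists_grid_coord hn ((Complex.abs_re_le_norm z).trans hz)
  obtain ⟨b, hb⟩ := exists_grid_coord hn ((Complex.abs_im_le_norm z).trans hz)
  refine ⟨(a, b), ?_⟩
  refine (Complex.norm_le_abs_re_add_abs_im _).trans ?_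
  have : (2 : ℝ) / n = 1 / n + 1 / n := by ring
  rw [this]
  exact add_le_add ha hb

/-- The subspaces of `ℂ^N` that are graphs over the first `d + r` coordinates, depending only on the
first `d` of them. -/
def graphMatrix (σ : (Fin d ⊕ Fin r) ⊕ Fin L ≃ Fin N) (Y : Matrix (Fin L) (Fin d) ℂ) :
    Matrix (Fin N) (Fin d ⊕ Fin r) ℂ :=
  (Matrix.fromRows 1 (Matrix.fromCols Y 0)).submatrix σ.symm id

lemma graphMatrix_injective (σ : (Fin d ⊕ Fin r) ⊕ Fin L ≃ Fin N) (Y : Matrix (Fin L) (Fin d) ℂ)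
    {x : Fin d ⊕ Fin r → ℂ} (h : graphMatrix σ Y *ᵥ x = 0) : x = 0 := by
  funext j
  have h1 := congrFun h (σ (Sum.inl j))
  have h2 : (graphMatrix σ Y *ᵥ x) (σ (Sum.inl j)) =
    (Matrix.fromRows (1 : Matrix (Fin d ⊕ Fin r) (Fin d ⊕ Fin r) ℂ)
      (Matrix.fromCols Y 0) *ᵥ x) (Sum.inl j) := by
    simp [graphMatrix, Matrix.mulVec, dotProduct]
  rw [h2, Matrix.fromRows_mulVec] at h1
  simpa using h1

/-- The left side is `‖(1 - V Vᴴ) U‖²`, the squared distance from `U` to the matrices with columns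
in the range of `V`, and `U'` is one of these. -/
lemma sub_frobSq_le {M : ℕ} {U : Matrix (Fin N) (Fin d) ℂ} (hU : IsSemiUnitary U)
    {V : Matrix (Fin N) (Fin M) ℂ} (hV : IsSemiUnitary V) {U' : Matrix (Fin N) (Fin d) ℂ}
    (hU' : V * Vᴴ * U' = U') : d - frobSq (Vᴴ * U) ≤ frobSq (U - U') := by
  have hVV : Vᴴ * V = 1 := hV
  have e : (1 - V * Vᴴ) * (1 - V * Vᴴ) = 1 - V * Vᴴ := by
    simp only [Matrix.sub_mul, Matrix.mul_sub, Matrix.one_mul, Matrix.mul_one,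
      hV.mul_conjTranspose_idem]
    abel
  have e' : (1 - V * Vᴴ)ᴴ = 1 - V * Vᴴ := by simp [Matrix.conjTranspose_mul]
  have key : ∀ A : Matrix (Fin N) (Fin d) ℂ,
      frobSq (Vᴴ * A) + frobSq ((1 - V * Vᴴ) * A) = frobSq A := by
    intro A
    have : ((frobSq (Vᴴ * A) + frobSq ((1 - V * Vᴴ) * A) : ℝ) : ℂ) = (frobSq A : ℝ) := by
      push_cast
      rw [← trace_conjTranspose_mul_self, ← trace_conjTranspose_mul_self,
        ← trace_conjTranspose_mul_self, ← Matrix.trace_add]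
      congr 1
      rw [Matrix.conjTranspose_mul (1 - V * Vᴴ), e', Matrix.mul_assoc Aᴴ,
        ← Matrix.mul_assoc (1 - V * Vᴴ), e]
      simp [Matrix.conjTranspose_mul, Matrix.sub_mul, Matrix.mul_sub, Matrix.mul_assoc]
    exact_mod_cast this
  have h1 := key U
  have h2 := key (U - U')
  have h3 : (1 - V * Vᴴ) * (U - U') = (1 - V * Vᴴ) * U := by
    rw [Matrix.mul_sub, Matrix.sub_mul _ _ U', hU']; simp
  rw [frobSq_of_semiUnitary hU, Fintype.card_fin] at h1
  rw [h3] at h2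
  linarith [frobSq_nonneg (Vᴴ * (U - U'))]

lemma exists_equiv_extending (hN : d + r + L = N) {f : Fin d → Fin N}
    (hf : Function.Injective f) :
    ∃ σ : (Fin d ⊕ Fin r) ⊕ Fin L ≃ Fin N, ∀ i, σ (Sum.inl (Sum.inl i)) = f i := by
  classical
  let τ : (Fin d ⊕ Fin r) ⊕ Fin L ≃ Fin N := Fintype.equivOfCardEq (by simp [hN])
  let g : Fin d → Fin N := fun i => τ (Sum.inl (Sum.inl i))
  have hg : Function.Injective g := fun a b hab => by
    have := τ.injective hab
    simpa using this
  let e : {x // x ∈ Set.range g} ≃ {x // x ∈ Set.range f} :=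
    (Equiv.ofInjective g hg).symm.trans (Equiv.ofInjective f hf)
  refine ⟨τ.trans e.extendSubtype, fun i => ?_⟩
  have h1 := e.extendSubtype_apply_of_mem (g i) ⟨i, rfl⟩
  have h2 : (Equiv.ofInjective g hg).symm ⟨g i, i, rfl⟩ = i := Equiv.ofInjective_symm_apply hg i
  show e.extendSubtype (g i) = f i
  rw [h1]
  simp only [e, Equiv.trans_apply, h2]
  rfl

/-- A covering of the Grassmannian of `d`-dimensional subspaces by neighbourhoods of
`(d+r)`-dimensional subspaces, with explicit size. -/
lemma exists_covering_grid (hN : d + r + L = N) {n : ℕ} (hn : 0 < n) :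
    ∃ V : ((Fin d ⊕ Fin r) ⊕ Fin L ≃ Fin N) × (Fin L → Fin d → Fin (2 * n + 1) × Fin (2 * n + 1)) →
      Matrix (Fin N) (Fin (d + r)) ℂ, (∀ i, IsSemiUnitary (V i)) ∧
      ∀ U : Matrix (Fin N) (Fin d) ℂ, IsSemiUnitary U →
        ∃ i, d - frobSq ((V i)ᴴ * U) ≤ L * d * (2 / n) ^ 2 * d := by
  have hex : ∀ i : ((Fin d ⊕ Fin r) ⊕ Fin L ≃ Fin N) ×
      (Fin L → Fin d → Fin (2 * n + 1) × Fin (2 * n + 1)),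
      ∃ V : Matrix (Fin N) (Fin (d + r)) ℂ, IsSemiUnitary V ∧
      V * Vᴴ * graphMatrix i.1 (Matrix.of fun k l => gridPoint n (i.2 k l)) =
      graphMatrix i.1 (Matrix.of fun k l => gridPoint n (i.2 k l)) := by
    intro i
    obtain ⟨V, hV, h, -⟩ := exists_semiUnitary_factor
      (graphMatrix i.1 (Matrix.of fun k l => gridPoint n (i.2 k l)))
      (fun x => graphMatrix_injective _ _) (a := d + r) (by simp)
    exact ⟨V, hV, h⟩
  choose V hV hVA using hex
  refine ⟨V, hV, fun U hU => ?_⟩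
  obtain ⟨f, hf, Y, hUY, hY⟩ := exists_rows_coeff_le_one hU
  obtain ⟨σ, hσ⟩ := exists_equiv_extending (d := d) (r := r) (L := L) hN hf
  have hgr : ∀ (k : Fin L) (l : Fin d), ∃ p, ‖Y (σ (Sum.inr k)) l - gridPoint n p‖ ≤ 2 / n :=
    fun k l => exists_gridPoint hn (hY _ _)
  choose g hg using hgr
  refine ⟨(σ, g), ?_⟩
  set G : Matrix (Fin L) (Fin d) ℂ := Matrix.of fun k l => gridPoint n (g k l) with hG
  set A := graphMatrix (r := r) σ G with hA
  -- The approximant `A * UJ` agrees with `U` on `d + r` rows; only in the last `L` rows are the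
  -- coefficients rounded. The `r` extra directions absorb their rows exactly, so `L d` complex
  -- parameters are discretized instead of `(L + r) d`. This is why the exponent is `d (N - M)`.
  set UJ : Matrix (Fin d ⊕ Fin r) (Fin d) ℂ := U.submatrix (fun j => σ (Sum.inl j)) id with hUJ
  have hfix : V (σ, g) * (V (σ, g))ᴴ * (A * UJ) = A * UJ := by
    rw [← Matrix.mul_assoc, hVA]
  refine (sub_frobSq_le hU (hV _) hfix).trans ?_
  have hrows : ∀ j, (A * UJ) (σ (Sum.inl j)) = U (σ (Sum.inl j)) := by
    intro j
    have h1 : (A * UJ) (σ (Sum.inl j)) =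
        (Matrix.fromRows (1 : Matrix (Fin d ⊕ Fin r) (Fin d ⊕ Fin r) ℂ)
          (Matrix.fromCols G 0) * UJ) (Sum.inl j) := by
      funext c
      simp [hA, graphMatrix, Matrix.mul_apply]
    rw [h1, Matrix.fromRows_mul]
    funext c
    simp [hUJ]
  have hrows2 : ∀ k c, (U - A * UJ) (σ (Sum.inr k)) c =
      ((Matrix.of fun k l => Y (σ (Sum.inr k)) l - G k l) * U.submatrix f id) k c := by
    intro k c
    have h1 : (A * UJ) (σ (Sum.inr k)) =
        (Matrix.fromRows (1 : Matrix (Fin d ⊕ Fin r) (Fin d ⊕ Fin r) ℂ)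
          (Matrix.fromCols G 0) * UJ) (Sum.inr k) := by
      funext c
      simp [hA, graphMatrix, Matrix.mul_apply]
    have h2 : (A * UJ) (σ (Sum.inr k)) c = (G * U.submatrix f id) k c := by
      rw [h1, Matrix.fromRows_mul, Matrix.fromRows_apply_inr]
      simp [Matrix.mul_apply, hUJ, hσ]
    have h3 : U (σ (Sum.inr k)) c = (Y * U.submatrix f id) (σ (Sum.inr k)) c :=
      congrFun (congrFun hUY _) _
    rw [Matrix.sub_apply, h2, h3]
    simp [Matrix.mul_apply, sub_mul, Finset.sum_sub_distrib]
  have hfr : frobSq (U - A * UJ) =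
      frobSq ((Matrix.of fun k l => Y (σ (Sum.inr k)) l - G k l) * U.submatrix f id) := by
    unfold frobSq
    rw [← σ.sum_comp, Fintype.sum_sum_type]
    have hz : ∀ j c, (U - A * UJ) (σ (Sum.inl j)) c = 0 := by
      intro j c
      rw [Matrix.sub_apply, hrows, sub_self]
    simp only [hz, hrows2]
    simp
  rw [hfr]
  refine (frobSq_mul_le _ _).trans ?_
  have b1 : frobSq (Matrix.of fun k l => Y (σ (Sum.inr k)) l - G k l) ≤ L * d * (2 / n) ^ 2 := by
    unfold frobSq
    calc _ ≤ ∑ _k : Fin L, ∑ _l : Fin d, ((2 : ℝ) / n) ^ 2 := by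
          refine Finset.sum_le_sum fun k _ => Finset.sum_le_sum fun l _ => ?_
          have := hg k l
          exact pow_le_pow_left₀ (norm_nonneg _) this 2
      _ = _ := by simp; ring
  have b2 : frobSq (U.submatrix f id) ≤ d := by
    have h1 : frobSq U = d := by rw [frobSq_of_semiUnitary hU, Fintype.card_fin]
    rw [← h1]
    unfold frobSq
    calc ∑ i, ∑ j, ‖U.submatrix f id i j‖ ^ 2
        = ∑ i ∈ Finset.univ.map ⟨f, hf⟩, ∑ j, ‖U i j‖ ^ 2 := by
          rw [Finset.sum_map]; rfl
      _ ≤ _ := Finset.sum_le_sum_of_subset_of_nonneg (Finset.subset_univ _)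
          fun _ _ _ => by positivity
  exact mul_le_mul b1 b2 (frobSq_nonneg _) (by positivity)

end Covering

/-! ### Small-ball probabilities of isotropic subspaces -/

section SmallBall

variable {Ω : Type*} [MeasurableSpace Ω] {μ : Measure Ω} [IsProbabilityMeasure μ] {N M d : ℕ}

/-- Lower bound on the probability that an isotropic subspace is close to a fixed subspace. -/
lemma exists_smallBall_bound (hd : d ≤ M) (hM : M ≤ N) :
    ∃ c : ℝ, 0 < c ∧ c ≤ 1 ∧ ∀ (U : Ω → Matrix (Fin N) (Fin d) ℂ), Measurable U →
      (∀ ω, IsSemiUnitary (U ω)) → IsIsotropic μ (fun ω => U ω * (U ω)ᴴ) →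
      ∀ V : Matrix (Fin N) (Fin M) ℂ, IsSemiUnitary V → ∀ ε : ℝ, 0 < ε → ε ≤ 1 →
      c * ε ^ (d * (N - M)) ≤ μ.real {ω | d - frobSq (Vᴴ * U ω) ≤ ε} := by
  obtain ⟨r, rfl⟩ := Nat.exists_eq_add_of_le hd
  obtain ⟨L, rfl⟩ := Nat.exists_eq_add_of_le hM
  rw [Nat.add_sub_cancel_left]
  set S : ℕ := Fintype.card ((Fin d ⊕ Fin r) ⊕ Fin L ≃ Fin (d + r + L)) with hS
  have hSpos : (0 : ℝ) < S := by
    have : Nonempty ((Fin d ⊕ Fin r) ⊕ Fin L ≃ Fin (d + r + L)) :=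
      ⟨Fintype.equivOfCardEq (by simp)⟩
    exact_mod_cast Fintype.card_pos
  -- The grid size `n ≥ √(κ / ε)` makes the covering radius at most `ε`. The summand one ensures `κ
  -- / ε ≥ 1`, whence `2 n + 1 ≤ 5 √(κ / ε)`; this is the origin of the factor 25.
  set κ : ℝ := 4 * L * d * d + 1 with hκ
  have hκ1 : 1 ≤ κ := by rw [hκ]; linarith [show (0 : ℝ) ≤ 4 * L * d * d by positivity]
  have hS1 : (1 : ℝ) ≤ S := by exact_mod_cast Nat.one_le_iff_ne_zero.2 (by
    intro h; rw [h] at hSpos; simp at hSpos)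
  refine ⟨(S * (25 * κ) ^ (d * L))⁻¹, by positivity, ?_, ?_⟩
  · apply inv_le_one_of_one_le₀
    have : (1 : ℝ) ≤ (25 * κ) ^ (d * L) := one_le_pow₀ (by linarith)
    nlinarith
  intro U hUm hU hiso V hV ε hε hε1
  set n : ℕ := ⌈√(κ / ε)⌉₊ with hn
  have hq : 1 ≤ κ / ε := by rw [le_div_iff₀ hε]; linarith
  have hsq1 : 1 ≤ √(κ / ε) := Real.one_le_sqrt.2 hq
  have hnle : √(κ / ε) ≤ n := Nat.le_ceil _
  have hn0 : 0 < n := by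
    have : (0 : ℝ) < n := by linarith
    exact_mod_cast this
  have hnlt : (n : ℝ) < √(κ / ε) + 1 := Nat.ceil_lt_add_one (by positivity)
  obtain ⟨Vc, hVc, hcov⟩ := exists_covering_grid (d := d) (r := r) (L := L) rfl hn0
  have hX : Measurable fun ω => U ω * (U ω)ᴴ := measurable_mul_conjTranspose.comp hUm
  have hs : MeasurableSet {Y : Matrix (Fin (d + r)) (Fin (d + r)) ℂ | (d : ℝ) - Y.trace.re ≤ ε} :=
    measurableSet_le (measurable_const.sub measurable_trace_re) measurable_const
  have heq : ∀ i, μ {ω | d - frobSq ((Vc i)ᴴ * U ω) ≤ ε} = μ {ω | d - frobSq (Vᴴ * U ω) ≤ ε} := by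
    intro i
    have := hiso.measure_preimage_eq hX (hVc i) hV hs
    simpa only [Set.mem_ofPred_eq, frobSq_conjTranspose_mul_eq] using this
  have hε' : (L : ℝ) * d * (2 / n) ^ 2 * d ≤ ε := by
    have h1 : κ / ε ≤ (n : ℝ) ^ 2 := by
      rw [← Real.sq_sqrt (by positivity : 0 ≤ κ / ε)]
      exact pow_le_pow_left₀ (by positivity) hnle 2
    have hn0r : (0 : ℝ) < n := by exact_mod_cast hn0
    rw [div_le_iff₀ hε] at h1
    have : (L : ℝ) * d * (2 / n) ^ 2 * d = (4 * L * d * d) / (n : ℝ) ^ 2 := by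
      field_simp; ring
    rw [this, div_le_iff₀ (by positivity)]
    linarith
  -- The events cover `Ω` and are equally likely, so each has at least the inverse of their number
  -- as its probability.
  have hunion : (Set.univ : Set Ω) ⊆ ⋃ i, {ω | d - frobSq ((Vc i)ᴴ * U ω) ≤ ε} := by
    intro ω _
    obtain ⟨i, hi⟩ := hcov (U ω) (hU ω)
    exact Set.mem_iUnion.2 ⟨i, hi.trans hε'⟩
  have h1 : (1 : ℝ) ≤ S * ((2 * n + 1) * (2 * n + 1)) ^ (d * L) *
      μ.real {ω | d - frobSq (Vᴴ * U ω) ≤ ε} := by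
    calc (1 : ℝ) = μ.real Set.univ := by simp
      _ ≤ μ.real (⋃ i, {ω | d - frobSq ((Vc i)ᴴ * U ω) ≤ ε}) :=
          measureReal_mono hunion
      _ ≤ ∑ i, μ.real {ω | d - frobSq ((Vc i)ᴴ * U ω) ≤ ε} := measureReal_iUnion_fintype_le _
      _ = ∑ _i, μ.real {ω | d - frobSq (Vᴴ * U ω) ≤ ε} := by
          refine Finset.sum_congr rfl fun i _ => ?_
          rw [measureReal_def, heq i, measureReal_def]
      _ = _ := by
          rw [Finset.sum_const, Finset.card_univ, Fintype.card_prod, nsmul_eq_mul]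
          congr 1
          simp only [Fintype.card_fun, Fintype.card_prod, Fintype.card_fin, ← hS]
          push_cast
          rw [← pow_mul]
  have h3 : ((2 * (n : ℝ) + 1) * (2 * n + 1)) ≤ 25 * κ / ε := by
    have h4 : 2 * (n : ℝ) + 1 ≤ 5 * √(κ / ε) := by linarith
    calc ((2 * (n : ℝ) + 1) * (2 * n + 1)) ≤ (5 * √(κ / ε)) * (5 * √(κ / ε)) :=
          mul_le_mul h4 h4 (by positivity) (by positivity)
      _ = 25 * (√(κ / ε) * √(κ / ε)) := by ring
      _ = 25 * κ / ε := by rw [Real.mul_self_sqrt (by positivity)]; ring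
  have h5 : (1 : ℝ) ≤ S * (25 * κ / ε) ^ (d * L) *
      μ.real {ω | d - frobSq (Vᴴ * U ω) ≤ ε} := by
    refine h1.trans ?_
    gcongr
  rw [inv_mul_le_iff₀ (by positivity)]
  rw [div_pow] at h5
  have hep : 0 < ε ^ (d * L) := by positivity
  calc ε ^ (d * L) = ε ^ (d * L) * 1 := by ring
    _ ≤ ε ^ (d * L) * (S * ((25 * κ) ^ (d * L) / ε ^ (d * L)) *
      μ.real {ω | d - frobSq (Vᴴ * U ω) ≤ ε}) := by gcongr
    _ = _ := by field_simp

end SmallBall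

/-! ### Mean quantization error of random codebooks -/

section Distortion

variable {Ω : Type*} [MeasurableSpace Ω] {μ : Measure Ω} [IsProbabilityMeasure μ] {N M d : ℕ}

lemma measurable_frobSq_mul (V : Matrix (Fin N) (Fin M) ℂ) :
    Measurable fun U : Matrix (Fin N) (Fin d) ℂ => frobSq (Vᴴ * U) := by
  have hc : Continuous fun A : Matrix (Fin N) (Fin d) ℂ => Vᴴ * A :=
    continuous_const.matrix_mul continuous_id
  exact measurable_frobSq.comp hc.measurable

lemma sub_frobSq_nonneg {U : Matrix (Fin N) (Fin d) ℂ} (hU : IsSemiUnitary U)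
    {V : Matrix (Fin N) (Fin M) ℂ} (hV : IsSemiUnitary V) : 0 ≤ d - frobSq (Vᴴ * U) := by
  have := frobSq_conjTranspose_mul_le hV U
  rw [frobSq_of_semiUnitary hU, Fintype.card_fin] at this
  linarith

lemma lintegral_exp_neg_mul_rpow {p b : ℝ} (hp : 0 < p) (hb : 0 < b) :
    ∫⁻ t in Set.Ioi (0 : ℝ), ENNReal.ofReal (Real.exp (-b * t ^ p)) =
      ENNReal.ofReal (b ^ (-1 / p) * Real.Gamma (1 / p + 1)) := by
  have h := integral_exp_neg_mul_rpow hp hb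
  have hpos : 0 < b ^ (-1 / p) * Real.Gamma (1 / p + 1) :=
    mul_pos (Real.rpow_pos_of_pos hb _) (Real.Gamma_pos_of_pos (by positivity))
  have hint : Integrable (fun t => Real.exp (-b * t ^ p)) (volume.restrict (Set.Ioi 0)) := by
    by_contra hcon
    rw [integral_undef hcon] at h
    linarith
  rw [← h, ofReal_integral_eq_lintegral_ofReal hint (Eventually.of_forall fun t => by positivity)]

/-- The expected quantization error of random vector quantization with `n` codewords is
`O(n^(-1/(d(N-M))))`. -/
lemma exists_distortion_bound (hd1 : 1 ≤ d) (hd : d ≤ M) (hM : M < N) :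
    ∃ C : ℝ, 0 < C ∧ ∀ (n : ℕ), 0 < n → ∀ (U : Fin n → Ω → Matrix (Fin N) (Fin d) ℂ),
      (∀ i, Measurable (U i)) → (∀ i ω, IsSemiUnitary (U i ω)) →
      (∀ i, IsIsotropic μ (fun ω => U i ω * (U i ω)ᴴ)) → iIndepFun U μ →
      ∀ V : Matrix (Fin N) (Fin M) ℂ, IsSemiUnitary V →
      ∫⁻ ω, ENNReal.ofReal (⨅ i, (d - frobSq (Vᴴ * U i ω))) ∂μ ≤
        ENNReal.ofReal (C * (n : ℝ) ^ (-1 / ((d * (N - M) : ℕ) : ℝ))) := by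
  obtain ⟨c, hc, hc1, hball⟩ := exists_smallBall_bound (μ := μ) hd hM.le
  set T : ℕ := d * (N - M) with hT
  have hT0 : 0 < T := Nat.mul_pos (by omega) (by omega)
  have hTr : (0 : ℝ) < T := by exact_mod_cast hT0
  have hdr : (1 : ℝ) ≤ d := by exact_mod_cast hd1
  -- The small-ball bound holds for radii up to one, but the error ranges up to `d`; it is applied
  -- at `t / d`.
  set c' : ℝ := c / (d : ℝ) ^ T with hc'
  have hc'0 : 0 < c' := by positivity
  refine ⟨c' ^ (-1 / (T : ℝ)) * Real.Gamma (1 / (T : ℝ) + 1), mul_pos (Real.rpow_pos_of_pos hc'0 _)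
    (Real.Gamma_pos_of_pos (by positivity)), ?_⟩
  intro n hn U hUm hU hiso hind V hV
  have hne : Nonempty (Fin n) := ⟨⟨0, hn⟩⟩
  have hD : ∀ i, Measurable fun ω => (d : ℝ) - frobSq (Vᴴ * U i ω) := fun i =>
    measurable_const.sub ((measurable_frobSq_mul V).comp (hUm i))
  have hnr : (0 : ℝ) < n := by exact_mod_cast hn
  rw [lintegral_eq_lintegral_meas_lt μ
    (Eventually.of_forall fun ω => Real.iInf_nonneg fun i => sub_frobSq_nonneg (hU i ω) hV)
    (Measurable.iInf hD).aemeasurable]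
  -- By independence the tail is at most `(1 - c' t ^ T) ^ n ≤ exp (-n c' t ^ T)` for `t ≤ d`, and
  -- zero beyond. Integrating it gives the power `n ^ (-1 / T)` and a Gamma factor.
  have htail : ∀ t : ℝ, 0 < t → μ {ω | t < ⨅ i, ((d : ℝ) - frobSq (Vᴴ * U i ω))} ≤
      ENNReal.ofReal (Real.exp (-(n * c') * t ^ (T : ℝ))) := by
    intro t ht
    have hsub : {ω | t < ⨅ i, ((d : ℝ) - frobSq (Vᴴ * U i ω))} ⊆
        ⋂ i ∈ (Finset.univ : Finset (Fin n)),
          U i ⁻¹' {A | t < (d : ℝ) - frobSq (Vᴴ * A)} := by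
      intro ω hω
      simp only [Set.mem_iInter, Set.mem_preimage, Set.mem_ofPred_eq]
      intro i _
      exact lt_of_lt_of_le hω (ciInf_le (Set.finite_range _).bddBelow i)
    have hmeas : MeasurableSet {A : Matrix (Fin N) (Fin d) ℂ | t < (d : ℝ) - frobSq (Vᴴ * A)} :=
      measurableSet_lt measurable_const (measurable_const.sub (measurable_frobSq_mul V))
    have hone : ∀ i, μ.real (U i ⁻¹' {A | t < (d : ℝ) - frobSq (Vᴴ * A)}) ≤
        Real.exp (-c' * t ^ T) := by
      intro i
      have hcompl : U i ⁻¹' {A | t < (d : ℝ) - frobSq (Vᴴ * A)} =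
          {ω | (d : ℝ) - frobSq (Vᴴ * U i ω) ≤ t}ᶜ := by
        ext ω; simp only [Set.mem_preimage, Set.mem_ofPred_eq, Set.mem_compl_iff, not_le]
      have hms : MeasurableSet {ω | (d : ℝ) - frobSq (Vᴴ * U i ω) ≤ t} :=
        measurableSet_le (hD i) measurable_const
      rw [hcompl, probReal_compl_eq_one_sub hms]
      by_cases htd : t ≤ d
      · have h1 := hball (U i) (hUm i) (hU i) (hiso i) V hV (t / d) (by positivity)
          ((div_le_one (by linarith)).2 htd)
        have h2 : μ.real {ω | (d : ℝ) - frobSq (Vᴴ * U i ω) ≤ t / d} ≤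
            μ.real {ω | (d : ℝ) - frobSq (Vᴴ * U i ω) ≤ t} := by
          refine measureReal_mono ?_ (measure_ne_top _ _)
          intro ω hω
          exact le_trans hω (div_le_self ht.le hdr)
        have h3 : c * (t / d) ^ T = c' * t ^ T := by rw [hc', div_pow]; ring
        have h4 := Real.add_one_le_exp (-c' * t ^ T)
        linarith
      · have h1 : μ.real {ω | (d : ℝ) - frobSq (Vᴴ * U i ω) ≤ t} = 1 := by
          have : {ω | (d : ℝ) - frobSq (Vᴴ * U i ω) ≤ t} = Set.univ := by
            ext ω
            simp only [Set.mem_ofPred_eq, Set.mem_univ, iff_true]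
            linarith [frobSq_nonneg (Vᴴ * U i ω)]
          rw [this]; simp
        rw [h1, sub_self]
        positivity
    rw [← ENNReal.ofReal_toReal (measure_ne_top μ _)]
    apply ENNReal.ofReal_le_ofReal
    calc μ.real {ω | t < ⨅ i, ((d : ℝ) - frobSq (Vᴴ * U i ω))}
        ≤ μ.real (⋂ i ∈ (Finset.univ : Finset (Fin n)),
          U i ⁻¹' {A | t < (d : ℝ) - frobSq (Vᴴ * A)}) := measureReal_mono hsub
      _ = ∏ i, μ.real (U i ⁻¹' {A | t < (d : ℝ) - frobSq (Vᴴ * A)}) := by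
          rw [measureReal_def, hind.measure_inter_preimage_eq_mul Finset.univ fun _ _ => hmeas,
            ENNReal.toReal_prod]
          rfl
      _ ≤ ∏ _i : Fin n, Real.exp (-c' * t ^ T) :=
          Finset.prod_le_prod (fun _ _ => measureReal_nonneg) fun i _ => hone i
      _ = Real.exp (-(n * c') * t ^ (T : ℝ)) := by
          rw [Finset.prod_const, Finset.card_univ, Fintype.card_fin, ← Real.exp_nat_mul,
            Real.rpow_natCast]
          congr 1
          ring
  calc _ ≤ ∫⁻ t in Set.Ioi (0 : ℝ), ENNReal.ofReal (Real.exp (-(n * c') * t ^ (T : ℝ))) :=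
        setLIntegral_mono' measurableSet_Ioi fun t ht => htail t ht
    _ = _ := by
        rw [lintegral_exp_neg_mul_rpow hTr (by positivity)]
        congr 1
        rw [Real.mul_rpow hnr.le hc'0.le]
        ring

end Distortion

/-! ### Row-space projections and lines -/

section RowSpace

variable {N M d : ℕ}

/-- The orthogonal projection onto the row space of a matrix with independent rows. -/
def rowProj (H : Matrix (Fin M) (Fin N) ℂ) : Matrix (Fin N) (Fin N) ℂ :=
  Hᴴ * (H * Hᴴ)⁻¹ * H

/-- Links the explicit formula `rowProj`, which is measurable in `H`, to a non-canonical orthonormal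
basis `V` in which the geometry is done. The matrix `W₀` merely certifies full row rank. -/
lemma exists_rowProj_factor {H : Matrix (Fin M) (Fin N) ℂ} {W₀ : Matrix (Fin N) (Fin M) ℂ}
    (h : (H * W₀).det ≠ 0) :
    ∃ V : Matrix (Fin N) (Fin M) ℂ, IsSemiUnitary V ∧ (∀ j, column V j ∈ rowSpace H) ∧
      H * (V * Vᴴ) = H ∧ (H * V).det ≠ 0 ∧ rowProj H = V * Vᴴ := by
  have hinj : ∀ x, Hᴴ *ᵥ x = 0 → x = 0 := by
    intro x hx
    by_contra hne
    have h2 : (H * W₀)ᴴ *ᵥ x = 0 := by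
      rw [Matrix.conjTranspose_mul, ← Matrix.mulVec_mulVec, hx, Matrix.mulVec_zero]
    have h3 := det_eq_zero_of_mulVec hne h2
    rw [Matrix.det_conjTranspose, star_eq_zero] at h3
    exact h h3
  obtain ⟨V, hV, hfac, hcol⟩ := exists_semiUnitary_factor Hᴴ hinj (Fintype.card_fin M)
  have hH : H * (V * Vᴴ) = H := by
    have := congrArg Matrix.conjTranspose hfac
    simpa [Matrix.conjTranspose_mul, Matrix.mul_assoc] using this
  have hdet : (H * V).det ≠ 0 := by
    intro h0
    apply h
    rw [← hH, Matrix.mul_assoc, Matrix.mul_assoc, ← Matrix.mul_assoc, Matrix.det_mul, h0, zero_mul]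
  refine ⟨V, hV, hcol, hH, hdet, ?_⟩
  set T := H * V with hT
  have hHT : H = T * Vᴴ := by rw [hT, Matrix.mul_assoc, hH]
  have hHH : Hᴴ = V * Tᴴ := by
    rw [hHT, Matrix.conjTranspose_mul, Matrix.conjTranspose_conjTranspose]
  have hTT : H * Hᴴ = T * Tᴴ := by
    rw [hHH, hHT, Matrix.mul_assoc, ← Matrix.mul_assoc Vᴴ, show Vᴴ * V = 1 from hV, Matrix.one_mul]
  have hu : IsUnit T.det := hdet.isUnit
  have hu' : IsUnit Tᴴ.det := by
    rw [Matrix.det_conjTranspose]; exact (star_ne_zero.2 hdet).isUnit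
  rw [rowProj, hTT, Matrix.mul_inv_rev, hHH]
  calc V * Tᴴ * (Tᴴ⁻¹ * T⁻¹) * H = V * (Tᴴ * Tᴴ⁻¹) * (T⁻¹ * H) := by simp only [Matrix.mul_assoc]
    _ = V * (T⁻¹ * (T * Vᴴ)) := by rw [Matrix.mul_nonsing_inv _ hu', ← hHT, Matrix.mul_one]
    _ = V * Vᴴ := by rw [← Matrix.mul_assoc T⁻¹, Matrix.nonsing_inv_mul _ hu, Matrix.one_mul]

lemma measurable_matrix_inv {n : Type*} [Fintype n] [DecidableEq n] :
    Measurable fun A : Matrix n n ℂ => A⁻¹ := by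
  have : (fun A : Matrix n n ℂ => A⁻¹) = fun A => A.det⁻¹ • A.adjugate := by
    funext A
    rw [Matrix.inv_def, Ring.inverse_eq_inv']
  rw [this]
  have h2 : Measurable fun A : Matrix n n ℂ => A.adjugate :=
    (continuous_id.matrix_adjugate).measurable
  refine measurable_pi_lambda _ fun i => measurable_pi_lambda _ fun j => ?_
  exact measurable_det.inv.mul ((measurable_pi_apply j).comp ((measurable_pi_apply i).comp h2))

lemma _root_.Measurable.matrixMul {α : Type*} [MeasurableSpace α] {m n p : Type*} [Fintype m]
    [Fintype n] [Fintype p] {f : α → Matrix m n ℂ} {g : α → Matrix n p ℂ} (hf : Measurable f)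
    (hg : Measurable g) : Measurable fun x => f x * g x := by
  have : Continuous fun q : Matrix m n ℂ × Matrix n p ℂ => q.1 * q.2 :=
    continuous_fst.matrix_mul continuous_snd
  exact this.measurable.comp (hf.prodMk hg)

lemma _root_.Measurable.matrixConjTranspose {α : Type*} [MeasurableSpace α] {m n : Type*}
    [Fintype m] [Fintype n] {f : α → Matrix m n ℂ} (hf : Measurable f) :
    Measurable fun x => (f x)ᴴ := by
  have : Continuous fun q : Matrix m n ℂ => qᴴ := continuous_id.matrix_conjTranspose
  exact this.measurable.comp hf

lemma _root_.Measurable.matrixElem {α : Type*} [MeasurableSpace α] {m n : Type*}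
    {f : α → Matrix m n ℂ} (hf : Measurable f) (i : m) (j : n) :
    Measurable fun x => f x i j :=
  (measurable_pi_apply j).comp ((measurable_pi_apply i).comp hf)

lemma measurable_rowProj : Measurable (rowProj : Matrix (Fin M) (Fin N) ℂ → _) :=
  (measurable_id.matrixConjTranspose.matrixMul (measurable_matrix_inv.comp
    (measurable_id.matrixMul measurable_id.matrixConjTranspose))).matrixMul measurable_id

lemma trace_rowProj_mul {V : Matrix (Fin N) (Fin M) ℂ} (U : Matrix (Fin N) (Fin d) ℂ) :
    (V * Vᴴ * (U * Uᴴ)).trace.re = frobSq (Vᴴ * U) := by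
  rw [frobSq_conjTranspose_mul_eq, Matrix.mul_assoc V, Matrix.trace_mul_comm V]

lemma chordalDist_smul_sq {v : Matrix (Fin N) (Fin 1) ℂ} (hv : IsSemiUnitary v) {s : ℂ}
    (hs : s ≠ 0) {u : Matrix (Fin N) (Fin 1) ℂ} (hu : IsSemiUnitary u) :
    chordalDist (s • vᴴ) u ^ 2 = 1 - frobSq (vᴴ * u) := by
  rw [chordalDist_sq (s • vᴴ) hu hv, Nat.cast_one]
  · apply mem_rowSpace_of_mul_eq (L := (star s)⁻¹ • (1 : Matrix (Fin 1) (Fin 1) ℂ))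
    rw [Matrix.conjTranspose_smul, Matrix.conjTranspose_conjTranspose, Matrix.smul_mul,
      Matrix.mul_smul, Matrix.mul_one, smul_smul, mul_inv_cancel₀ (star_ne_zero.2 hs), one_smul]
  · rw [Matrix.smul_mul, ← Matrix.mul_assoc, show vᴴ * v = 1 from hv, Matrix.one_mul]

lemma conjTranspose_mul_self_fin_one {n : Type*} [Fintype n] (ξ : Matrix n (Fin 1) ℂ) :
    ξᴴ * ξ = ((frobSq ξ : ℝ) : ℂ) • (1 : Matrix (Fin 1) (Fin 1) ℂ) := by
  ext i j
  have h := trace_conjTranspose_mul_self ξ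
  rw [Matrix.trace_fin_one] at h
  rw [Subsingleton.elim i 0, Subsingleton.elim j 0, h]
  simp

lemma frobSq_smul {m n : Type*} [Fintype m] [Fintype n] (s : ℂ) (A : Matrix m n ℂ) :
    frobSq (s • A) = ‖s‖ ^ 2 * frobSq A := by
  simp only [frobSq, Matrix.smul_apply, smul_eq_mul, norm_mul, mul_pow, Finset.mul_sum]

lemma frobSq_fin_one (A : Matrix (Fin 1) (Fin 1) ℂ) : frobSq A = ‖A 0 0‖ ^ 2 := by
  simp [frobSq]

lemma isSemiUnitary_normalize {n : Type*} [Fintype n] {ξ : Matrix n (Fin 1) ℂ}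
    (hξ : frobSq ξ ≠ 0) : IsSemiUnitary ((((√(frobSq ξ))⁻¹ : ℝ) : ℂ) • ξ) := by
  have hpos : 0 < frobSq ξ := lt_of_le_of_ne (frobSq_nonneg ξ) (Ne.symm hξ)
  show ((((√(frobSq ξ))⁻¹ : ℝ) : ℂ) • ξ)ᴴ * ((((√(frobSq ξ))⁻¹ : ℝ) : ℂ) • ξ) = 1
  rw [Matrix.conjTranspose_smul, Matrix.smul_mul, Matrix.mul_smul, conjTranspose_mul_self_fin_one,
    smul_smul, smul_smul, show ∀ r : ℝ, star (r : ℂ) = (r : ℂ) from Complex.conj_ofReal,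
    ← Complex.ofReal_mul, ← Complex.ofReal_mul]
  have : (√(frobSq ξ))⁻¹ * (√(frobSq ξ))⁻¹ * frobSq ξ = 1 := by
    rw [← mul_inv, Real.mul_self_sqrt hpos.le, inv_mul_cancel₀ hξ]
  rw [this, Complex.ofReal_one, one_smul]

lemma frobSq_normalize_mul {n p : Type*} [Fintype n] [Fintype p] {ξ : Matrix n (Fin 1) ℂ}
    (A : Matrix n p ℂ) :
    frobSq (((((√(frobSq ξ))⁻¹ : ℝ) : ℂ) • ξ)ᴴ * A) = frobSq (ξᴴ * A) / frobSq ξ := by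
  rw [Matrix.conjTranspose_smul, Matrix.smul_mul, frobSq_smul, norm_star, Complex.norm_real,
    Real.norm_of_nonneg (by positivity), inv_pow, Real.sq_sqrt (frobSq_nonneg ξ)]
  ring

/-- Equality case of the Cauchy-Schwarz inequality. -/
lemma smul_eq_of_frobSq_mul_le {n : Type*} [Fintype n] {ξ τ : Matrix n (Fin 1) ℂ}
    (h : frobSq ξ * frobSq τ ≤ frobSq (ξᴴ * τ)) :
    ((frobSq ξ : ℝ) : ℂ) • τ = ξ * (ξᴴ * τ) := by
  set a := frobSq ξ with ha
  set s := ξᴴ * τ with hs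
  have hsH : τᴴ * ξ = sᴴ := by rw [hs]; simp [Matrix.conjTranspose_mul]
  have key : ((frobSq ((a : ℂ) • τ - ξ * s) : ℝ) : ℂ) =
      ((a * (a * frobSq τ - frobSq s) : ℝ) : ℂ) := by
    rw [← trace_conjTranspose_mul_self]
    have e : ((a : ℂ) • τ - ξ * s)ᴴ * ((a : ℂ) • τ - ξ * s) =
        ((a : ℂ) * a) • (τᴴ * τ) - (a : ℂ) • (sᴴ * s) := by
      rw [Matrix.conjTranspose_sub, Matrix.conjTranspose_smul, Matrix.conjTranspose_mul,
        show star (a : ℂ) = (a : ℂ) from Complex.conj_ofReal _]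
      have e1 : sᴴ * ξᴴ * (ξ * s) = (a : ℂ) • (sᴴ * s) := by
        rw [Matrix.mul_assoc, ← Matrix.mul_assoc ξᴴ, conjTranspose_mul_self_fin_one]
        simp [ha]
      have e2 : τᴴ * (ξ * s) = sᴴ * s := by rw [← Matrix.mul_assoc, hsH]
      have e3 : sᴴ * ξᴴ * τ = sᴴ * s := by rw [Matrix.mul_assoc]
      simp only [Matrix.sub_mul, Matrix.mul_sub, Matrix.smul_mul, Matrix.mul_smul, e1, e2, e3,
        smul_smul, smul_sub]
      abel
    rw [e, Matrix.trace_sub, Matrix.trace_smul, Matrix.trace_smul, trace_conjTranspose_mul_self,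
      trace_conjTranspose_mul_self]
    push_cast
    simp only [smul_eq_mul]
    ring
  have key' : frobSq ((a : ℂ) • τ - ξ * s) = a * (a * frobSq τ - frobSq s) := by exact_mod_cast key
  have h0 : frobSq ((a : ℂ) • τ - ξ * s) = 0 := by
    apply le_antisymm _ (frobSq_nonneg _)
    rw [key']
    exact mul_nonpos_of_nonneg_of_nonpos (frobSq_nonneg ξ) (by linarith)
  exact sub_eq_zero.1 (frobSq_eq_zero h0)

end RowSpace

/-! ### Geometry of quantization-based combining -/

section Combining

variable {N M n : ℕ}

/-- In the coordinates `V` of the row space a combiner acts only through the direction `τ` of `(H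
V)ᴴ c`; the scale `s` drops out. Choosing a combiner is choosing a direction, and `exists_combiner`
shows that every direction is available. -/
lemma chordalDist_combined_sq {H : Matrix (Fin M) (Fin N) ℂ} {V : Matrix (Fin N) (Fin M) ℂ}
    (hV : IsSemiUnitary V) (hH : H * (V * Vᴴ) = H)
    {c : Matrix (Fin M) (Fin 1) ℂ} {s : ℂ} (hs : s ≠ 0) {τ : Matrix (Fin M) (Fin 1) ℂ}
    (hτ : (H * V)ᴴ * c = s • τ) (hτ0 : frobSq τ ≠ 0) {u : Matrix (Fin N) (Fin 1) ℂ}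
    (hu : IsSemiUnitary u) :
    chordalDist (cᴴ * H) u ^ 2 = 1 - frobSq (τᴴ * (Vᴴ * u)) / frobSq τ := by
  have hpos : 0 < frobSq τ := lt_of_le_of_ne (frobSq_nonneg τ) (Ne.symm hτ0)
  have hv := hV.mul (isSemiUnitary_normalize hτ0)
  have hsq : (0 : ℝ) < √(frobSq τ) := Real.sqrt_pos.2 hpos
  have e : cᴴ * H = (star s * ((√(frobSq τ) : ℝ) : ℂ)) •
      (V * ((((√(frobSq τ))⁻¹ : ℝ) : ℂ) • τ))ᴴ := by
    have h1 : cᴴ * (H * V) = star s • τᴴ := by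
      have := congrArg Matrix.conjTranspose hτ
      simpa [Matrix.conjTranspose_mul, Matrix.mul_assoc] using this
    rw [← hH, ← Matrix.mul_assoc H, ← Matrix.mul_assoc, h1, Matrix.conjTranspose_mul,
      Matrix.conjTranspose_smul, Matrix.smul_mul, Matrix.smul_mul, smul_smul,
      show ∀ r : ℝ, star (r : ℂ) = (r : ℂ) from Complex.conj_ofReal, mul_assoc,
      ← Complex.ofReal_mul, mul_inv_cancel₀ hsq.ne', Complex.ofReal_one, mul_one]
  rw [e, chordalDist_smul_sq hv (mul_ne_zero (star_ne_zero.2 hs)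
    (Complex.ofReal_ne_zero.2 hsq.ne')) hu, Matrix.conjTranspose_mul, Matrix.mul_assoc,
    frobSq_normalize_mul]

lemma frobSq_effective_ne_zero {H : Matrix (Fin M) (Fin N) ℂ} {V : Matrix (Fin N) (Fin M) ℂ}
    (hdet : (H * V).det ≠ 0) {c : Matrix (Fin M) (Fin 1) ℂ} (hc : IsSemiUnitary c) :
    frobSq ((H * V)ᴴ * c) ≠ 0 := by
  intro h0
  have h1 := frobSq_eq_zero h0
  have hu' : IsUnit (H * V)ᴴ.det := by
    rw [Matrix.det_conjTranspose]; exact (star_ne_zero.2 hdet).isUnit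
  have h2 : c = 0 := by
    have := congrArg (fun A => (H * V)ᴴ⁻¹ * A) h1
    simpa only [← Matrix.mul_assoc, Matrix.nonsing_inv_mul _ hu', Matrix.one_mul,
      Matrix.mul_zero] using this
  have h3 : cᴴ * c = 1 := hc
  rw [h2] at h3
  simp at h3

lemma exists_combiner {H : Matrix (Fin M) (Fin N) ℂ} {V : Matrix (Fin N) (Fin M) ℂ}
    (hdet : (H * V).det ≠ 0) {τ : Matrix (Fin M) (Fin 1) ℂ} (hτ : frobSq τ ≠ 0) :
    ∃ c : Matrix (Fin M) (Fin 1) ℂ, IsSemiUnitary c ∧ ∃ s : ℂ, s ≠ 0 ∧ (H * V)ᴴ * c = s • τ := by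
  have hu' : IsUnit (H * V)ᴴ.det := by
    rw [Matrix.det_conjTranspose]; exact (star_ne_zero.2 hdet).isUnit
  set c₀ := (H * V)ᴴ⁻¹ * τ with hc₀
  have h1 : (H * V)ᴴ * c₀ = τ := by
    rw [hc₀, ← Matrix.mul_assoc, Matrix.mul_nonsing_inv _ hu', Matrix.one_mul]
  have h2 : frobSq c₀ ≠ 0 := by
    intro h0
    rw [frobSq_eq_zero h0, Matrix.mul_zero] at h1
    apply hτ
    rw [← h1]; simp [frobSq]
  have hpos : 0 < frobSq c₀ := lt_of_le_of_ne (frobSq_nonneg _) (Ne.symm h2)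
  refine ⟨((((√(frobSq c₀))⁻¹ : ℝ) : ℂ) • c₀ : Matrix (Fin M) (Fin 1) ℂ),
    isSemiUnitary_normalize h2, (((√(frobSq c₀))⁻¹ : ℝ) : ℂ), ?_, ?_⟩
  · exact Complex.ofReal_ne_zero.2 (inv_ne_zero (Real.sqrt_pos.2 hpos).ne')
  · rw [Matrix.mul_smul, h1]

/-- Quantization-based combining achieves the distance between the codewords and the row space. -/
lemma IsQBC.chordalDist_sq_le {q : (Fin n → Matrix (Fin N) (Fin 1) ℂ) → Matrix (Fin M) (Fin N) ℂ →
      Matrix (Fin M) (Fin 1) ℂ × Fin n} (hq : IsQBC q) {C : Fin n → Matrix (Fin N) (Fin 1) ℂ}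
    (hC : ∀ i, IsSemiUnitary (C i)) {H : Matrix (Fin M) (Fin N) ℂ} {V : Matrix (Fin N) (Fin M) ℂ}
    (hV : IsSemiUnitary V) (hH : H * (V * Vᴴ) = H) (hdet : (H * V).det ≠ 0) (j : Fin n) :
    chordalDist ((q C H).1ᴴ * H) (C (q C H).2) ^ 2 ≤ 1 - frobSq (Vᴴ * C j) := by
  -- A codeword orthogonal to the row space offers no direction to aim at, but then the claimed
  -- bound is the trivial one.
  by_cases h0 : frobSq (Vᴴ * C j) = 0
  · have h1 := frobSq_effective_ne_zero hdet (hq.unit C H)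
    rw [h0, chordalDist_combined_sq hV hH one_ne_zero (one_smul ℂ _).symm h1 (hC _)]
    have : 0 ≤ frobSq (((H * V)ᴴ * (q C H).1)ᴴ * (Vᴴ * C (q C H).2)) /
        frobSq ((H * V)ᴴ * (q C H).1) := div_nonneg (frobSq_nonneg _) (frobSq_nonneg _)
    linarith
  -- Compare with the combiner that points the effective channel along the projection of codeword
  -- `j`.
  · obtain ⟨c, hc, s, hs, hcs⟩ := exists_combiner hdet h0
    have h1 := hq.isMin C H c j hc
    have h2 : chordalDist ((q C H).1ᴴ * H) (C (q C H).2) ^ 2 ≤ chordalDist (cᴴ * H) (C j) ^ 2 :=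
      pow_le_pow_left₀ (Real.sqrt_nonneg _) h1 2
    refine h2.trans (le_of_eq ?_)
    rw [chordalDist_combined_sq hV hH hs hcs h0 (hC _), conjTranspose_mul_self_fin_one, frobSq_smul,
      frobSq_fin_one]
    simp only [Matrix.one_apply_eq, norm_one, one_pow, mul_one, Complex.norm_real, Real.norm_eq_abs,
      sq_abs]
    rw [sq, mul_div_assoc, div_self h0, mul_one]

/-- The codeword selected by quantization-based combining maximizes the projection onto the row
space, and the effective channel is aligned with this projection. -/
lemma IsQBC.aligned {q : (Fin n → Matrix (Fin N) (Fin 1) ℂ) → Matrix (Fin M) (Fin N) ℂ →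
      Matrix (Fin M) (Fin 1) ℂ × Fin n} (hq : IsQBC q) {C : Fin n → Matrix (Fin N) (Fin 1) ℂ}
    (hC : ∀ i, IsSemiUnitary (C i)) {H : Matrix (Fin M) (Fin N) ℂ} {V : Matrix (Fin N) (Fin M) ℂ}
    (hV : IsSemiUnitary V) (hH : H * (V * Vᴴ) = H) (hdet : (H * V).det ≠ 0) :
    (∀ j, frobSq (Vᴴ * C j) ≤ frobSq (Vᴴ * C (q C H).2)) ∧
    ∀ β : Matrix (Fin M) (Fin 1) ℂ, frobSq (Vᴴ * C (q C H).2) *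
      frobSq (βᴴ * ((H * V)ᴴ * (q C H).1)) =
      frobSq ((H * V)ᴴ * (q C H).1) * frobSq (βᴴ * (Vᴴ * C (q C H).2)) := by
  have hτ := frobSq_effective_ne_zero hdet (hq.unit C H)
  set τ := (H * V)ᴴ * (q C H).1 with hτdef
  set ξ := Vᴴ * C (q C H).2 with hξ
  have hτpos : 0 < frobSq τ := lt_of_le_of_ne (frobSq_nonneg _) (Ne.symm hτ)
  have hcs : frobSq (τᴴ * ξ) ≤ frobSq τ * frobSq ξ := by
    have := frobSq_mul_le τᴴ ξ
    rwa [frobSq_conjTranspose] at this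
  -- Together with `|τᴴ ξ|² ≤ ‖τ‖² ‖ξ‖²` this shows that `ξ` is longest; for the selected index it
  -- forces equality in Cauchy-Schwarz, so `τ` is parallel to `ξ` whenever `ξ` is nonzero.
  have hle : ∀ j, frobSq (Vᴴ * C j) * frobSq τ ≤ frobSq (τᴴ * ξ) := by
    intro j
    have h1 := hq.chordalDist_sq_le hC hV hH hdet j
    rw [chordalDist_combined_sq hV hH one_ne_zero (one_smul ℂ _).symm hτ (hC _)] at h1
    rw [← le_div_iff₀ hτpos]
    linarith
  refine ⟨fun j => ?_, fun β => ?_⟩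
  · have := (hle j).trans hcs
    rw [mul_comm] at this
    exact le_of_mul_le_mul_left this hτpos
  · have hsymm : frobSq (ξᴴ * τ) = frobSq (τᴴ * ξ) := by
      rw [← frobSq_conjTranspose, Matrix.conjTranspose_mul, Matrix.conjTranspose_conjTranspose]
    have h1 := hle (q C H).2
    rw [← hξ, ← hsymm] at h1
    have heq : frobSq (ξᴴ * τ) = frobSq ξ * frobSq τ := by
      apply le_antisymm _ h1
      rw [hsymm, mul_comm]; exact hcs
    have h2 := smul_eq_of_frobSq_mul_le h1
    have h3 := congrArg (fun A => frobSq (βᴴ * A)) h2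
    simp only [Matrix.mul_smul, frobSq_smul, Complex.norm_real, Real.norm_eq_abs, sq_abs] at h3
    have h4 : frobSq (βᴴ * (ξ * (ξᴴ * τ))) = frobSq (βᴴ * ξ) * frobSq (ξᴴ * τ) := by
      rw [← Matrix.mul_assoc, frobSq_fin_one, frobSq_fin_one, frobSq_fin_one, Matrix.mul_apply]
      simp [mul_pow]
    rw [h4, heq] at h3
    by_cases h0 : frobSq ξ = 0
    · have : ξ = 0 := frobSq_eq_zero h0
      rw [h0, this]
      simp [frobSq]
    · apply mul_left_cancel₀ h0
      linarith

end Combining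

/-! ### Independence tools -/

section Independence

variable {Ω : Type*} [MeasurableSpace Ω] {μ : Measure Ω} [IsProbabilityMeasure μ]

lemma lintegral_of_indepFun {α β : Type*} [MeasurableSpace α] [MeasurableSpace β] {X : Ω → α}
    {Y : Ω → β} (hX : Measurable X) (hY : Measurable Y) (h : IndepFun X Y μ) {F : α × β → ℝ≥0∞}
    (hF : Measurable F) :
    ∫⁻ ω, F (X ω, Y ω) ∂μ = ∫⁻ ω, ∫⁻ ω', F (X ω, Y ω') ∂μ ∂μ := by
  have h1 := (indepFun_iff_map_prod_eq_prod_map_map hX.aemeasurable hY.aemeasurable).1 h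
  have : IsProbabilityMeasure (μ.map X) := Measure.isProbabilityMeasure_map hX.aemeasurable
  have : IsProbabilityMeasure (μ.map Y) := Measure.isProbabilityMeasure_map hY.aemeasurable
  rw [← lintegral_map hF (hX.prodMk hY), h1, lintegral_prod _ hF.aemeasurable,
    lintegral_map hF.lintegral_prod_right' hX]
  refine lintegral_congr fun ω => ?_
  exact lintegral_map (hF.comp measurable_prodMk_left) hY

lemma ae_of_indepFun {α β : Type*} [MeasurableSpace α] [MeasurableSpace β] {X : Ω → α}
    {Y : Ω → β} (hX : Measurable X) (hY : Measurable Y) (h : IndepFun X Y μ) {s : Set (α × β)}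
    (hs : MeasurableSet s) (h0 : ∀ᵐ ω ∂μ, ∀ᵐ ω' ∂μ, (X ω, Y ω') ∈ s) :
    ∀ᵐ ω ∂μ, (X ω, Y ω) ∈ s := by
  have h1 := lintegral_of_indepFun hX hY h (F := sᶜ.indicator 1)
    (measurable_one.indicator hs.compl)
  have h2 : ∫⁻ ω, sᶜ.indicator (1 : α × β → ℝ≥0∞) (X ω, Y ω) ∂μ = 0 := by
    rw [h1]
    have : ∀ᵐ ω ∂μ, ∫⁻ ω', sᶜ.indicator (1 : α × β → ℝ≥0∞) (X ω, Y ω') ∂μ = 0 := by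
      filter_upwards [h0] with ω hω
      rw [lintegral_congr_ae (g := fun _ => 0), lintegral_zero]
      filter_upwards [hω] with ω' hω'
      simp [hω']
    rw [lintegral_congr_ae this, lintegral_zero]
  have h3 := (lintegral_eq_zero_iff
    ((measurable_one.indicator hs.compl).comp (hX.prodMk hY))).1 h2
  filter_upwards [h3] with ω hω
  by_contra hcon
  simp [hcon] at hω

lemma comap_prodMk_eq_generateFrom {α γ : Type*} [MeasurableSpace α] [MeasurableSpace γ]
    (a : Ω → α) (c : Ω → γ) :
    MeasurableSpace.comap (fun ω => (a ω, c ω)) Prod.instMeasurableSpace =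
      MeasurableSpace.generateFrom (Set.preimage (fun ω => (a ω, c ω)) ''
        Set.image2 (· ×ˢ ·) {s : Set α | MeasurableSet s} {t : Set γ | MeasurableSet t}) := by
  rw [← MeasurableSpace.comap_generateFrom, generateFrom_prod]

/-- The hypotheses make all four variables jointly independent, so they may be regrouped; it
suffices to check rectangles, which form a π-system. It is used to pass from the split
channels/codebooks to the split user/other users. -/
lemma indepFun_prodMk_prodMk {α β γ ε : Type*} [MeasurableSpace α] [MeasurableSpace β]
    [MeasurableSpace γ] [MeasurableSpace ε] {a : Ω → α} {b : Ω → β} {c : Ω → γ} {e : Ω → ε}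
    (ha : Measurable a) (hb : Measurable b) (hc : Measurable c) (he : Measurable e)
    (hab : IndepFun a b μ) (hce : IndepFun c e μ)
    (h : IndepFun (fun ω => (a ω, b ω)) (fun ω => (c ω, e ω)) μ) :
    IndepFun (fun ω => (a ω, c ω)) (fun ω => (b ω, e ω)) μ := by
  have hac : IndepFun a c μ := h.comp measurable_fst measurable_fst
  have hbe : IndepFun b e μ := h.comp measurable_snd measurable_snd
  rw [IndepFun_iff_Indep]
  refine IndepSets.indep (ha.prodMk hc).comap_le (hb.prodMk he).comap_le
    (isPiSystem_prod.comap fun ω => (a ω, c ω))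
    (isPiSystem_prod.comap fun ω => (b ω, e ω)) ?_ ?_ ?_
  · exact comap_prodMk_eq_generateFrom a c
  · exact comap_prodMk_eq_generateFrom b e
  rw [IndepSets_iff]
  rintro _ _ ⟨_, ⟨A, hA, C, hC, rfl⟩, rfl⟩ ⟨_, ⟨B, hB, E, hE, rfl⟩, rfl⟩
  have e1 : (fun ω => (a ω, c ω)) ⁻¹' A ×ˢ C ∩ (fun ω => (b ω, e ω)) ⁻¹' B ×ˢ E =
      (fun ω => (a ω, b ω)) ⁻¹' A ×ˢ B ∩ (fun ω => (c ω, e ω)) ⁻¹' C ×ˢ E := by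
    ext ω; simp only [Set.mem_inter_iff, Set.mem_preimage, Set.mem_prod]; tauto
  simp only [e1]
  rw [h.measure_inter_preimage_eq_mul _ _ (MeasurableSet.prod hA hB) (MeasurableSet.prod hC hE)]
  simp only [Set.mk_preimage_prod]
  rw [hab.measure_inter_preimage_eq_mul _ _ hA hB,
    hce.measure_inter_preimage_eq_mul _ _ hC hE, hac.measure_inter_preimage_eq_mul _ _ hA hC,
    hbe.measure_inter_preimage_eq_mul _ _ hB hE]
  ring

lemma indepFun_fiber {κ ι β : Type*} [Fintype κ] [Fintype ι] [MeasurableSpace β]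
    {f : κ × ι → Ω → β} (hf : iIndepFun f μ) (hm : ∀ p, Measurable (f p)) (k : κ) :
    IndepFun (fun ω i => f (k, i) ω) (fun ω (l : {l // l ≠ k}) i => f (l, i) ω) μ := by
  classical
  have h := hf.indepFun_finset (Finset.univ.filter fun p : κ × ι => p.1 = k)
    (Finset.univ.filter fun p : κ × ι => p.1 ≠ k)
    (Finset.disjoint_filter_filter_not _ _ _) hm
  refine h.comp (φ := fun x i => x ⟨(k, i), by simp⟩)
    (ψ := fun x (l : {l // l ≠ k}) i => x ⟨(l, i), by simpa using l.2⟩) ?_ ?_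
  · exact measurable_pi_lambda _ fun i => measurable_pi_apply _
  · exact measurable_pi_lambda _ fun l => measurable_pi_lambda _ fun i => measurable_pi_apply _

end Independence

/-! ### Independence between a user and the others -/

section Users

variable {Ω : Type*} [MeasurableSpace Ω] {μ : Measure Ω} [IsProbabilityMeasure μ] {K M N d n : ℕ}
  {Ht : Fin K → Ω → Matrix (Fin M) (Fin N) ℂ} {U : Fin K → Fin n → Ω → Matrix (Fin N) (Fin d) ℂ}

lemma IsRVQ.measurable_codebook (hU : IsRVQ μ Ht U) (k : Fin K) :
    Measurable fun ω i => U k i ω :=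
  measurable_pi_lambda _ fun i => hU.measurable k i

lemma IsRVQ.iIndepFun_codebook (hU : IsRVQ μ Ht U) (k : Fin K) : iIndepFun (U k) μ :=
  hU.indep.precomp (g := fun i => (k, i)) fun _ _ h => (Prod.mk.inj h).2

lemma IsRVQ.indepFun_codebook (hU : IsRVQ μ Ht U) (k : Fin K) :
    IndepFun (Ht k) (fun ω i => U k i ω) μ :=
  hU.indep_channel.comp (measurable_pi_apply k) (measurable_pi_apply k)

lemma IsRVQ.isIsotropic (hU : IsRVQ μ Ht U) (k : Fin K) (i : Fin n) :
    IsIsotropic μ fun ω => U k i ω * (U k i ω)ᴴ :=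
  hU.isotropic k i

lemma IsRayleighFading.indepFun_others (h : IsRayleighFading μ Ht) (k : Fin K) :
    IndepFun (Ht k) (fun ω (l : {l // l ≠ k}) => Ht l ω) μ := by
  have h1 := indepFun_fiber (ι := Fin M × Fin N) h.indep
    (fun p => ((h.measurable p.1).matrixElem _ _)) k
  have hm : Measurable fun (x : Fin M × Fin N → ℂ) => (Matrix.of fun i j => x (i, j)) :=
    measurable_pi_lambda _ fun i => measurable_pi_lambda _ fun j => measurable_pi_apply _
  exact h1.comp (φ := fun x => Matrix.of fun i j => x (i, j))
    (ψ := fun x (l : {l // l ≠ k}) => Matrix.of fun i j => x l (i, j)) hm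
    (measurable_pi_lambda _ fun l => hm.comp (measurable_pi_apply l))

/-- The channel and the codebook of a user are independent of those of the other users. -/
lemma IsRVQ.indepFun_others (hU : IsRVQ μ Ht U) (hHt : IsRayleighFading μ Ht) (k : Fin K) :
    IndepFun (fun ω => (Ht k ω, fun i => U k i ω))
      (fun ω => ((fun l : {l // l ≠ k} => Ht l ω), fun (l : {l // l ≠ k}) i => U l i ω)) μ := by
  refine indepFun_prodMk_prodMk (hHt.measurable k)
    (measurable_pi_lambda _ fun l => hHt.measurable l) (hU.measurable_codebook k)
    (measurable_pi_lambda _ fun l => hU.measurable_codebook l) (hHt.indepFun_others k)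
    (indepFun_fiber hU.indep (fun p => hU.measurable p.1 p.2) k) ?_
  refine hU.indep_channel.comp (φ := fun x => (x k, fun l : {l // l ≠ k} => x l))
    (ψ := fun x => (x k, fun l : {l // l ≠ k} => x l)) ?_ ?_
  · exact (measurable_pi_apply k).prodMk (measurable_pi_lambda _ fun l => measurable_pi_apply _)
  · exact (measurable_pi_apply k).prodMk (measurable_pi_lambda _ fun l => measurable_pi_apply _)

end Users

/-! ### Independent isotropic subspaces are in general position -/

section GeneralPosition

variable {Ω : Type*} [MeasurableSpace Ω] {μ : Measure Ω} [IsProbabilityMeasure μ] {N d : ℕ}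
  {κ : Type*}

/-- The matrix whose columns are the columns of the matrices `X l`, `l ∈ T`. -/
def blockColumns (T : Finset κ) (X : κ → Matrix (Fin N) (Fin d) ℂ) :
    Matrix (Fin N) (T × Fin d) ℂ :=
  Matrix.of fun i p => X p.1 i p.2

lemma blockColumns_mulVec (T : Finset κ) (X : κ → Matrix (Fin N) (Fin d) ℂ) (x : κ → Fin d → ℂ) :
    blockColumns T X *ᵥ (fun p => x p.1 p.2) = ∑ l ∈ T, X l *ᵥ x l := by
  funext i
  simp only [Matrix.mulVec, dotProduct, blockColumns, Matrix.of_apply, Fintype.sum_prod_type,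
    Finset.sum_apply]
  exact Finset.sum_coe_sort T fun l => ∑ j, X l i j * x l j

lemma blockColumns_conjTranspose_mul_eq_zero {e : ℕ} {T : Finset κ}
    {X : κ → Matrix (Fin N) (Fin d) ℂ} {W : Matrix (Fin N) (Fin e) ℂ}
    (h : ∀ l ∈ T, (X l)ᴴ * W = 0) : (blockColumns T X)ᴴ * W = 0 := by
  ext p j
  exact congrFun (congrFun (h p.1 p.1.2) p.2) j

lemma measurable_blockColumns (T : Finset κ) :
    Measurable (blockColumns T : (κ → Matrix (Fin N) (Fin d) ℂ) → _) := by
  refine measurable_pi_lambda _ fun i => measurable_pi_lambda _ fun p => ?_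
  exact (measurable_pi_apply p.1.1).matrixElem i p.2

lemma det_conjTranspose_mul_self_ne_zero {ι : Type*} [Fintype ι] [DecidableEq ι]
    {A : Matrix (Fin N) ι ℂ} (h : ∀ x, A *ᵥ x = 0 → x = 0) : (Aᴴ * A).det ≠ 0 := by
  intro h0
  obtain ⟨x, hx, hx0⟩ := exists_ne_zero_of_det_eq_zero h0
  exact hx (h x (Matrix.conjTranspose_mul_self_mulVec_eq_zero A x |>.1 hx0))

lemma mulVec_injective_of_det_ne_zero {ι : Type*} [Fintype ι] [DecidableEq ι]
    {A : Matrix (Fin N) ι ℂ} (h : (Aᴴ * A).det ≠ 0) (x : ι → ℂ) (hx : A *ᵥ x = 0) : x = 0 := by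
  by_contra hne
  exact h (det_eq_zero_of_mulVec hne (by rw [← Matrix.mulVec_mulVec, hx, Matrix.mulVec_zero]))

/-- Few independent isotropic subspaces are almost surely in general position. -/
lemma ae_det_blockColumns_ne_zero {X : κ → Ω → Matrix (Fin N) (Fin d) ℂ}
    (hm : ∀ l, Measurable (X l)) (hX : ∀ l ω, IsSemiUnitary (X l ω))
    (hiso : ∀ l, IsIsotropic μ fun ω => X l ω * (X l ω)ᴴ) (hind : iIndepFun X μ)
    [DecidableEq κ] (T : Finset κ) (hT : d * T.card ≤ N) :
    ∀ᵐ ω ∂μ, ((blockColumns T fun l => X l ω)ᴴ * blockColumns T fun l => X l ω).det ≠ 0 := by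
  induction T using Finset.induction_on with
  | empty => 
    refine Eventually.of_forall fun ω => ?_
    rw [Matrix.det_isEmpty]; exact one_ne_zero
  | insert a T ha ih =>
    rw [Finset.card_insert_of_notMem ha] at hT
    have hT' : d * T.card + d ≤ N := by linarith
    have hTa := ih (by omega)
    set A : Ω → Matrix (Fin N) (T × Fin d) ℂ := fun ω => blockColumns T fun l => X l ω with hA
    have hAm : Measurable A := (measurable_blockColumns T).comp (measurable_pi_lambda _ hm)
    have hAX : IndepFun A (X a) μ := by
      have h := hind.indepFun_finset T {a} (Finset.disjoint_singleton_right.2 ha) hm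
      refine h.comp (φ := fun x : T → Matrix (Fin N) (Fin d) ℂ =>
        (Matrix.of fun i (p : T × Fin d) => x p.1 i p.2))
        (ψ := fun x : ({a} : Finset κ) → Matrix (Fin N) (Fin d) ℂ =>
          x ⟨a, Finset.mem_singleton_self a⟩) ?_ (measurable_pi_apply _)
      exact measurable_pi_lambda _ fun i => measurable_pi_lambda _ fun p =>
        (measurable_pi_apply p.1).matrixElem i p.2
    have hs : MeasurableSet {q : Matrix (Fin N) (T × Fin d) ℂ × Matrix (Fin N) (Fin d) ℂ |
        (q.1ᴴ * (1 - q.2 * q.2ᴴ) * q.1).det ≠ 0} := by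
      have : Measurable fun q : Matrix (Fin N) (T × Fin d) ℂ × Matrix (Fin N) (Fin d) ℂ =>
          (q.1ᴴ * (1 - q.2 * q.2ᴴ) * q.1).det := by
        have hc : Continuous fun q : Matrix (Fin N) (T × Fin d) ℂ × Matrix (Fin N) (Fin d) ℂ =>
            (q.1ᴴ * (1 - q.2 * q.2ᴴ) * q.1).det :=
          ((continuous_fst.matrix_conjTranspose.matrix_mul (continuous_const.sub
            (continuous_snd.matrix_mul continuous_snd.matrix_conjTranspose))).matrix_mul
            continuous_fst).matrix_det
        exact hc.measurable
      exact this (measurableSet_singleton 0).compl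
    -- With the old blocks `A` frozen, the complement of the new block is isotropic of dimension `N
    -- - d ≥ d |T|`, so projecting to it keeps the columns of `A` independent.
    have hne := ae_of_indepFun hAm (hm a) hAX hs (by
      filter_upwards [hTa] with ω hω
      obtain ⟨V, hV, hVA, -⟩ := exists_semiUnitary_factor (A ω)
        (mulVec_injective_of_det_ne_zero hω) (a := d * T.card)
        (by simp [mul_comm])
      have h1 := ((hiso a).one_sub (measurable_mul_conjTranspose.comp (hm a))).ae_det_ne_zero
        (measurable_const.sub (measurable_mul_conjTranspose.comp (hm a)))
        (fun ω' => by simp [Matrix.conjTranspose_mul])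
        (fun ω' => by
          have := (hX a ω').mul_conjTranspose_idem
          rw [Matrix.sub_mul, Matrix.mul_sub, Matrix.mul_sub, this]; simp)
        (fun ω' => by
          obtain ⟨W, hW, hXW⟩ := exists_semiUnitary_orthogonal (X a ω') (a := d * T.card)
            (by simp; omega)
          exact ⟨W, hW, by rw [Matrix.sub_mul, Matrix.mul_assoc, hXW]; simp⟩) hV
      filter_upwards [h1] with ω' hω'
      intro h0
      obtain ⟨x, hx, hx0⟩ := exists_ne_zero_of_det_eq_zero h0
      have hidem : (1 - X a ω' * (X a ω')ᴴ) * (1 - X a ω' * (X a ω')ᴴ) =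
          1 - X a ω' * (X a ω')ᴴ := by
        have := (hX a ω').mul_conjTranspose_idem
        rw [Matrix.sub_mul, Matrix.mul_sub, Matrix.mul_sub, this]; simp
      have h2 := mulVec_eq_zero_of_projection (by simp [Matrix.conjTranspose_mul]) hidem (A ω) hx0
      have h3 : (Vᴴ * (1 - X a ω' * (X a ω')ᴴ) * V) *ᵥ ((Vᴴ * A ω) *ᵥ x) = 0 := by
        rw [Matrix.mulVec_mulVec]
        have : Vᴴ * (1 - X a ω' * (X a ω')ᴴ) * V * (Vᴴ * A ω) =
            Vᴴ * ((1 - X a ω' * (X a ω')ᴴ) * A ω) := by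
          conv_rhs => rw [← hVA]
          simp only [Matrix.mul_assoc]
        rw [this, ← Matrix.mulVec_mulVec, h2, Matrix.mulVec_zero]
      have h4 : (Vᴴ * A ω) *ᵥ x = 0 := by
        by_contra hne
        exact hω' (det_eq_zero_of_mulVec hne h3)
      apply hx
      apply mulVec_injective_of_det_ne_zero hω
      show A ω *ᵥ x = 0
      rw [← hVA, Matrix.mul_assoc, ← Matrix.mulVec_mulVec, h4, Matrix.mulVec_zero])
    filter_upwards [hne] with ω hω
    apply det_conjTranspose_mul_self_ne_zero
    intro y hy
    -- Extending `y` by zero lets `blockColumns_mulVec` be used for both `insert a T` and `T`.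
    set x : κ → Fin d → ℂ := fun l j => if h : l ∈ insert a T then y (⟨l, h⟩, j) else 0 with hx
    have hyx : y = fun p => x p.1 p.2 := by
      funext ⟨⟨l, hl⟩, j⟩
      simp only [hx]
      rw [dif_pos hl]
    rw [hyx, blockColumns_mulVec, Finset.sum_insert ha, ← blockColumns_mulVec] at hy
    have hXX : (X a ω)ᴴ * X a ω = 1 := hX a ω
    have h1 : (A ω) *ᵥ (fun p => x p.1 p.2) = -(X a ω *ᵥ x a) := by
      rw [eq_neg_iff_add_eq_zero, add_comm]; exact hy
    -- The projection `1 - X Xᴴ` annihilates the block `a`, leaving a relation among the old blocks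
    -- only.
    have h2 : ((A ω)ᴴ * (1 - X a ω * (X a ω)ᴴ) * A ω) *ᵥ (fun p => x p.1 p.2) = 0 := by
      rw [← Matrix.mulVec_mulVec, h1, Matrix.mulVec_neg, Matrix.mulVec_mulVec, Matrix.mul_assoc,
        Matrix.sub_mul, Matrix.mul_assoc, hXX]
      simp
    have h3 : (fun p : T × Fin d => x p.1 p.2) = 0 := by
      by_contra hne
      exact hω (det_eq_zero_of_mulVec hne h2)
    rw [h3, Matrix.mulVec_zero, zero_eq_neg] at h1
    have h4 : x a = 0 := by
      have := congrArg ((X a ω)ᴴ *ᵥ ·) h1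
      simpa [Matrix.mulVec_mulVec, hXX] using this
    rw [hyx]
    funext ⟨⟨l, hl⟩, j⟩
    rcases Finset.mem_insert.1 hl with rfl | hl'
    · exact congrFun h4 j
    · exact congrFun h3 (⟨l, hl'⟩, j)

end GeneralPosition

/-! ### Independence of the precoder from the own channel; mean interference -/

section Precoder

variable {Ω : Type*} [MeasurableSpace Ω] {μ : Measure Ω} [IsProbabilityMeasure μ] {K M N d n : ℕ}
  {Ht : Fin K → Ω → Matrix (Fin M) (Fin N) ℂ} {U : Fin K → Fin n → Ω → Matrix (Fin N) (Fin d) ℂ}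

lemma measurable_apply_index {β : Type*} [MeasurableSpace β] :
    Measurable fun q : (Fin n → β) × Fin n => q.1 q.2 :=
  measurable_from_prod_countable_left fun i => measurable_pi_apply i

lemma measurable_complProj {ι : Type*} [Fintype ι] [DecidableEq ι] :
    Measurable (complProj : Matrix (Fin N) ι ℂ → _) :=
  measurable_const.sub ((measurable_id.matrixMul (measurable_matrix_inv.comp
    (measurable_id.matrixConjTranspose.matrixMul measurable_id))).matrixMul
      measurable_id.matrixConjTranspose)

/-- The projection onto the range of a zero-forcing precoder is a function of the channels and the
codebooks of the other users. -/
lemma IsZeroForcingPrecoder.exists_indep_projection (hHt : IsRayleighFading μ Ht)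
    (hU : IsRVQ μ Ht U)
    {s : Fin K → (Fin n → Matrix (Fin N) (Fin d) ℂ) → Matrix (Fin M) (Fin N) ℂ → Fin n}
    (hs : ∀ l, Measurable
      fun p : (Fin n → Matrix (Fin N) (Fin d) ℂ) × Matrix (Fin M) (Fin N) ℂ => s l p.1 p.2)
    {S : Finset (Fin K)} (hS : d * S.card = N) {W : Fin K → Ω → Matrix (Fin N) (Fin d) ℂ}
    (hW : IsZeroForcingPrecoder S
      (fun l ω => U l (s l (fun i => U l i ω) (Ht l ω)) ω) W) {k : Fin K} (hk : k ∈ S) :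
    ∃ O : Ω → Matrix (Fin N) (Fin N) ℂ, Measurable O ∧ (∀ᵐ ω ∂μ, O ω = W k ω * (W k ω)ᴴ) ∧
      IndepFun (fun ω => (Ht k ω, fun i => U k i ω)) O μ := by
  classical
  set T : Finset {l // l ≠ k} := S.subtype (· ≠ k) with hT
  have hTc : T.card + 1 = S.card := by
    rw [hT, Finset.card_subtype, Finset.filter_ne', Finset.card_erase_add_one hk]
  have hdT : d * T.card + d = N := by rw [← hS, ← hTc]; ring
  let F : ({l // l ≠ k} → Matrix (Fin M) (Fin N) ℂ) ×
      ({l // l ≠ k} → Fin n → Matrix (Fin N) (Fin d) ℂ) → Matrix (Fin N) (Fin N) ℂ := fun x =>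
    complProj (blockColumns T fun l => x.2 l (s l (x.2 l) (x.1 l)))
  have hF : Measurable F := by
    refine measurable_complProj.comp ((measurable_blockColumns T).comp
      (measurable_pi_lambda _ fun l => ?_))
    have h1 : Measurable fun x : ({l // l ≠ k} → Matrix (Fin M) (Fin N) ℂ) ×
        ({l // l ≠ k} → Fin n → Matrix (Fin N) (Fin d) ℂ) => x.2 l :=
      (measurable_pi_apply l).comp measurable_snd
    have h2 : Measurable fun x : ({l // l ≠ k} → Matrix (Fin M) (Fin N) ℂ) ×
        ({l // l ≠ k} → Fin n → Matrix (Fin N) (Fin d) ℂ) => x.1 l :=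
      (measurable_pi_apply l).comp measurable_fst
    exact measurable_apply_index.comp (h1.prodMk ((hs l).comp (h1.prodMk h2)))
  have hX : Measurable fun ω => ((fun l : {l // l ≠ k} => Ht l ω),
      fun (l : {l // l ≠ k}) i => U l i ω) :=
    (measurable_pi_lambda _ fun l : {l // l ≠ k} => hHt.measurable l).prodMk
      (measurable_pi_lambda _ fun l : {l // l ≠ k} => hU.measurable_codebook l)
  refine ⟨fun ω => F ((fun l : {l // l ≠ k} => Ht l ω), fun (l : {l // l ≠ k}) i => U l i ω),
    hF.comp hX, ?_, (hU.indepFun_others hHt k).comp measurable_id hF⟩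
  -- The fed-back indices are random and depend on the codebooks, so general position is needed for
  -- all of the finitely many selections at once; codewords with a fixed selection of indices are
  -- independent and isotropic.
  have hgp : ∀ᵐ ω ∂μ, ∀ j : {l // l ≠ k} → Fin n,
      ((blockColumns T fun l => U l (j l) ω)ᴴ * blockColumns T fun l => U l (j l) ω).det ≠ 0 := by
    rw [ae_all_iff]
    intro j
    refine ae_det_blockColumns_ne_zero (X := fun l : {l // l ≠ k} => U l (j l))
      (fun l => hU.measurable _ _) (fun l => hU.semiUnitary _ _) (fun l => hU.isIsotropic _ _)
      ?_ T (by omega)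
    exact hU.indep.precomp (g := fun l : {l // l ≠ k} => ((l : Fin K), j l))
      fun l l' h => Subtype.ext (Prod.mk.inj h).1
  filter_upwards [hgp] with ω hω
  refine complProj_eq (hω fun l => s l (fun i => U l i ω) (Ht l ω)) ?_ (hW.semiUnitary k hk ω) ?_
  · simp only [Fintype.card_prod, Fintype.card_coe, Fintype.card_fin]
    rw [mul_comm]; exact hdT
  · refine blockColumns_conjTranspose_mul_eq_zero fun l hl => ?_
    exact hW.orthogonal k hk l (Finset.mem_subtype.1 hl) l.2 ω

/-- `W` itself may depend on `G`; but `|det (G W)|² = det (G W Wᴴ Gᴴ)` involves only the projection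
`O`, which is independent of `G`. -/
lemma lintegral_det_mul_le_of_indepFun {e : ℕ} (hN : 0 < N) {G : Ω → Matrix (Fin e) (Fin N) ℂ}
    (hGm : Measurable G) (hG : μ.map G = gaussianMatrix e N) {O : Ω → Matrix (Fin N) (Fin N) ℂ}
    (hO : Measurable O) (hGO : IndepFun G O μ) {W : Ω → Matrix (Fin N) (Fin e) ℂ}
    (hW : ∀ ω, IsSemiUnitary (W ω)) (hOW : ∀ᵐ ω ∂μ, O ω = W ω * (W ω)ᴴ) :
    ∫⁻ ω, ‖(G ω * W ω).det‖ₑ⁻¹ ∂μ ≤ (negMomentBound * N) ^ e := by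
  let F : Matrix (Fin e) (Fin N) ℂ × Matrix (Fin N) (Fin N) ℂ → ℝ≥0∞ := fun q =>
    (ENNReal.ofReal √‖(q.1 * q.2 * q.1ᴴ).det‖)⁻¹
  have hF : Measurable F := by
    have : Measurable fun q : Matrix (Fin e) (Fin N) ℂ × Matrix (Fin N) (Fin N) ℂ =>
        (q.1 * q.2 * q.1ᴴ).det :=
      measurable_det.comp ((measurable_fst.matrixMul measurable_snd).matrixMul
        measurable_fst.matrixConjTranspose)
    exact (ENNReal.measurable_ofReal.comp this.norm.sqrt).inv
  have hFW : ∀ (g : Matrix (Fin e) (Fin N) ℂ) (w : Matrix (Fin N) (Fin e) ℂ),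
      F (g, w * wᴴ) = ‖(g * w).det‖ₑ⁻¹ := by
    intro g w
    have h1 : g * (w * wᴴ) * gᴴ = (g * w) * (g * w)ᴴ := by
      simp only [Matrix.conjTranspose_mul, Matrix.mul_assoc]
    simp only [F]
    rw [h1, Matrix.det_mul, Matrix.det_conjTranspose, norm_mul, norm_star,
      Real.sqrt_mul_self (norm_nonneg _), ofReal_norm]
  have h1 : ∫⁻ ω, ‖(G ω * W ω).det‖ₑ⁻¹ ∂μ = ∫⁻ ω, F (G ω, O ω) ∂μ := by
    refine lintegral_congr_ae ?_
    filter_upwards [hOW] with ω hω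
    rw [hω, hFW]
  have hsw : Measurable fun q : Matrix (Fin N) (Fin N) ℂ × Matrix (Fin e) (Fin N) ℂ =>
      F (q.2, q.1) := hF.comp (measurable_snd.prodMk measurable_fst)
  have h2 := lintegral_of_indepFun hO hGm hGO.symm hsw
  rw [h1, h2]
  calc ∫⁻ ω, ∫⁻ ω', F (G ω', O ω) ∂μ ∂μ ≤ ∫⁻ _ω, (negMomentBound * N) ^ e ∂μ := by
        refine lintegral_mono_ae ?_
        filter_upwards [hOW] with ω hω
        rw [hω]
        simp only [hFW]
        have hm : Measurable fun g : Matrix (Fin e) (Fin N) ℂ => ‖(g * W ω).det‖ₑ⁻¹ :=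
          (measurable_det.comp (measurable_id.matrixMul measurable_const)).enorm.inv
        have h3 := lintegral_map (μ := μ) hm hGm
        rw [← h3, hG]
        exact lintegral_det_mul_le hN e (W ω) (hW ω)
    _ = _ := by simp

lemma exists_semiUnitary (h : M ≤ N) : ∃ W : Matrix (Fin N) (Fin M) ℂ, IsSemiUnitary W := by
  obtain ⟨W, hW, -⟩ := exists_semiUnitary_orthogonal (N := N) (a := M)
    (0 : Matrix (Fin N) (Fin 0) ℂ) (by simpa using h)
  exact ⟨W, hW⟩

lemma IsRayleighFading.ae_det_ne_zero (hHt : IsRayleighFading μ Ht) (k : Fin K)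
    {A : Matrix (Fin M) (Fin M) ℂ} (hA : A.det ≠ 0) {W : Matrix (Fin N) (Fin M) ℂ}
    (hW : IsSemiUnitary W) : ∀ᵐ ω ∂μ, (A * Ht k ω * W).det ≠ 0 := by
  have h := ae_det_mul_ne_zero hW
  rw [← hHt.map_eq k] at h
  filter_upwards [ae_of_ae_map (hHt.measurable k).aemeasurable h] with ω hω
  rw [Matrix.mul_assoc, Matrix.det_mul]
  exact mul_ne_zero hA hω

lemma IsRayleighFading.integrable_frobSq (hHt : IsRayleighFading μ Ht) (k : Fin K) :
    Integrable (fun ω => frobSq (Ht k ω)) μ := by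
  have h := integrable_frobSq_gaussianMatrix M N
  rw [← hHt.map_eq k] at h
  exact h.comp_measurable (hHt.measurable k)

/-- The expected product of channel gain and quantization error. -/
lemma exists_interference_bound (hHt : IsRayleighFading μ Ht) (hd1 : 1 ≤ d) (hd : d ≤ M)
    (hM : M < N) {A : Matrix (Fin M) (Fin M) ℂ} (hA : A.det ≠ 0) (k : Fin K) :
    ∃ C : ℝ, 0 < C ∧ ∀ (n : ℕ), 0 < n → ∀ (U : Fin K → Fin n → Ω → Matrix (Fin N) (Fin d) ℂ),
      IsRVQ μ Ht U →
      ∫⁻ ω, ENNReal.ofReal (frobSq (Ht k ω) *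
        ⨅ i, (d - (rowProj (A * Ht k ω) * (U k i ω * (U k i ω)ᴴ)).trace.re)) ∂μ ≤
        ENNReal.ofReal (C * (n : ℝ) ^ (-1 / ((d * (N - M) : ℕ) : ℝ))) := by
  obtain ⟨C, hC, hdist⟩ := exists_distortion_bound (μ := μ) hd1 hd hM
  have hint := hHt.integrable_frobSq k
  set E := ∫ ω, frobSq (Ht k ω) ∂μ with hE
  have hE0 : 0 ≤ E := integral_nonneg fun ω => frobSq_nonneg _
  refine ⟨C * (E + 1), by positivity, fun n hn U hU => ?_⟩
  obtain ⟨W₀, hW₀⟩ := exists_semiUnitary hM.le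
  let F : Matrix (Fin M) (Fin N) ℂ × (Fin n → Matrix (Fin N) (Fin d) ℂ) → ℝ≥0∞ := fun q =>
    ENNReal.ofReal (frobSq q.1 * ⨅ i, (d - (rowProj (A * q.1) * (q.2 i * (q.2 i)ᴴ)).trace.re))
  have hF : Measurable F := by
    refine ENNReal.measurable_ofReal.comp ((measurable_frobSq.comp measurable_fst).mul
      (Measurable.iInf fun i => measurable_const.sub (measurable_trace_re.comp
        ((measurable_rowProj.comp (measurable_const.matrixMul measurable_fst)).matrixMul ?_))))
    exact measurable_mul_conjTranspose.comp ((measurable_pi_apply i).comp measurable_snd)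
  -- Given the channel, the row space is fixed and the distortion bound applies, uniformly in that
  -- row space.
  have h1 := lintegral_of_indepFun (hHt.measurable k) (hU.measurable_codebook k)
    (hU.indepFun_codebook k) hF
  calc _ = ∫⁻ ω, ∫⁻ ω', F (Ht k ω, fun i => U k i ω') ∂μ ∂μ := h1
    _ ≤ ∫⁻ ω, ENNReal.ofReal (frobSq (Ht k ω)) *
        ENNReal.ofReal (C * (n : ℝ) ^ (-1 / ((d * (N - M) : ℕ) : ℝ))) ∂μ := by
        refine lintegral_mono_ae ?_
        filter_upwards [hHt.ae_det_ne_zero k hA hW₀] with ω hω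
        obtain ⟨V, hV, -, -, -, hproj⟩ := exists_rowProj_factor hω
        simp only [F, hproj, trace_rowProj_mul, ENNReal.ofReal_mul (frobSq_nonneg (Ht k ω))]
        rw [lintegral_const_mul]
        · gcongr
          exact hdist n hn (U k) (hU.measurable k) (hU.semiUnitary k) (hU.isIsotropic k)
            (hU.iIndepFun_codebook k) V hV
        · exact ENNReal.measurable_ofReal.comp (Measurable.iInf fun i =>
            measurable_const.sub ((measurable_frobSq_mul V).comp (hU.measurable k i)))
    _ = ENNReal.ofReal E * ENNReal.ofReal (C * (n : ℝ) ^ (-1 / ((d * (N - M) : ℕ) : ℝ))) := by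
        rw [lintegral_mul_const (f := fun ω => ENNReal.ofReal (frobSq (Ht k ω))) _ (ENNReal.measurable_ofReal.comp
          (measurable_frobSq.comp (hHt.measurable k))), hE, ofReal_integral_eq_lintegral_ofReal hint
          (Eventually.of_forall fun ω => frobSq_nonneg _)]
    _ ≤ _ := by
        rw [← ENNReal.ofReal_mul hE0]
        apply ENNReal.ofReal_le_ofReal
        have : 0 ≤ (n : ℝ) ^ (-1 / ((d * (N - M) : ℕ) : ℝ)) := by positivity
        have h2 : 0 ≤ C * (n : ℝ) ^ (-1 / ((d * (N - M) : ℕ) : ℝ)) := by positivity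
        nlinarith

end Precoder

/-! ### Sums over all maximizers -/

section MaxSum

variable {n : ℕ}

/-- The sum of the ratios `√(a i / b i)` over the maximizers `i` of `a`. -/
def maxSum (a b : Fin n → ℝ) : ℝ≥0∞ :=
  ∑ i, if ∀ j, a j ≤ a i then ENNReal.ofReal √(a i) * (ENNReal.ofReal √(b i))⁻¹ else 0

/-- However ties are broken, the term of the selected index is dominated by `maxSum`, which involves
no choice and is measurable. -/
lemma le_maxSum {a b : Fin n → ℝ} {i : Fin n} (hi : ∀ j, a j ≤ a i) :
    ENNReal.ofReal √(a i) * (ENNReal.ofReal √(b i))⁻¹ ≤ maxSum a b := by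
  have h := Finset.single_le_sum (f := fun i => if ∀ j, a j ≤ a i then
    ENNReal.ofReal √(a i) * (ENNReal.ofReal √(b i))⁻¹ else 0) (fun _ _ => zero_le)
    (Finset.mem_univ i)
  rw [if_pos hi] at h
  exact h

lemma measurableSet_isMax (i : Fin n) : MeasurableSet {a : Fin n → ℝ | ∀ j, a j ≤ a i} := by
  have : {a : Fin n → ℝ | ∀ j, a j ≤ a i} = ⋂ j, {a : Fin n → ℝ | a j ≤ a i} := by
    ext a
    exact (Set.mem_iInter (s := fun j => {a : Fin n → ℝ | a j ≤ a i})).symm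
  rw [this]
  exact MeasurableSet.iInter fun j =>
    measurableSet_le (measurable_pi_apply j) (measurable_pi_apply i)

lemma measurable_maxSum : Measurable fun q : (Fin n → ℝ) × (Fin n → ℝ) => maxSum q.1 q.2 := by
  refine Finset.measurable_sum _ fun i _ => ?_
  refine Measurable.ite (measurable_fst (measurableSet_isMax i)) ?_ measurable_const
  exact (ENNReal.measurable_ofReal.comp ((measurable_pi_apply i).comp measurable_fst).sqrt).mul
    (ENNReal.measurable_ofReal.comp ((measurable_pi_apply i).comp measurable_snd).sqrt).inv

lemma maxSum_mul (a b : Fin n → ℝ) {s : ℝ} (hs : 0 < s) :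
    maxSum a (fun i => s ^ 2 * b i) = (ENNReal.ofReal s)⁻¹ * maxSum a b := by
  unfold maxSum
  rw [Finset.mul_sum]
  refine Finset.sum_congr rfl fun i _ => ?_
  split_ifs
  · rw [Real.sqrt_mul (by positivity), Real.sqrt_sq hs.le, ENNReal.ofReal_mul hs.le,
      ENNReal.mul_inv (Or.inr ENNReal.ofReal_ne_top) (Or.inl ENNReal.ofReal_ne_top)]
    ring
  · simp

lemma sum_isMax_le_one {a : Fin n → ℝ} (ha : Function.Injective a) :
    (∑ i, if ∀ j, a j ≤ a i then (1 : ℝ≥0∞) else 0) ≤ 1 := by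
  rw [← Finset.sum_filter, Finset.sum_const, nsmul_eq_mul, mul_one]
  have : (Finset.univ.filter fun i => ∀ j, a j ≤ a i).card ≤ 1 := by
    rw [Finset.card_le_one]
    intro i hi j hj
    simp only [Finset.mem_filter, Finset.mem_univ, true_and] at hi hj
    exact ha (le_antisymm (hj i) (hi j))
  exact_mod_cast this

end MaxSum

/-! ### Rotation invariance of a whole codebook -/

section Rotation

variable {Ω : Type*} [MeasurableSpace Ω] {μ : Measure Ω} [IsProbabilityMeasure μ] {N M d n : ℕ}
  {U : Fin n → Ω → Matrix (Fin N) (Fin d) ℂ}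

lemma map_conj_family_eq (hm : ∀ i, Measurable (U i))
    (hiso : ∀ i, IsIsotropic μ fun ω => U i ω * (U i ω)ᴴ) (hind : iIndepFun U μ)
    {Q : Matrix (Fin N) (Fin N) ℂ} (hQ : Q ∈ Matrix.unitaryGroup (Fin N) ℂ) :
    μ.map (fun ω i => Q * (U i ω * (U i ω)ᴴ) * Qᴴ) = μ.map (fun ω i => U i ω * (U i ω)ᴴ) := by
  have hX : ∀ i, Measurable fun ω => U i ω * (U i ω)ᴴ := fun i =>
    measurable_mul_conjTranspose.comp (hm i)
  have h1 : iIndepFun (fun i ω => U i ω * (U i ω)ᴴ) μ :=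
    hind.comp (fun _ A => A * Aᴴ) fun _ => measurable_mul_conjTranspose
  have h2 : iIndepFun (fun i ω => Q * (U i ω * (U i ω)ᴴ) * Qᴴ) μ :=
    h1.comp (fun _ A => Q * A * Qᴴ) fun _ => measurable_conj_mul _ _
  rw [h1.map_fun_eq_pi_map fun i => (hX i).aemeasurable,
    iIndepFun.map_fun_eq_pi_map (f := fun i ω => Q * (U i ω * (U i ω)ᴴ) * Qᴴ)
      (fun i => ((measurable_conj_mul _ _).comp (hX i)).aemeasurable) h2]
  congr 1
  funext i
  exact hiso i Q hQ

/-- Functions of the projections of independent isotropic subspaces to a fixed subspace have the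
same expectation for all subspaces. -/
lemma lintegral_projection_eq (hm : ∀ i, Measurable (U i))
    (hiso : ∀ i, IsIsotropic μ fun ω => U i ω * (U i ω)ᴴ) (hind : iIndepFun U μ)
    {V V' : Matrix (Fin N) (Fin M) ℂ} (hV : IsSemiUnitary V) (hV' : IsSemiUnitary V')
    {F : (Fin n → Matrix (Fin M) (Fin M) ℂ) → ℝ≥0∞} (hF : Measurable F) :
    ∫⁻ ω, F (fun i => V'ᴴ * (U i ω * (U i ω)ᴴ) * V') ∂μ =
      ∫⁻ ω, F (fun i => Vᴴ * (U i ω * (U i ω)ᴴ) * V) ∂μ := by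
  obtain ⟨Q, hQ, rfl⟩ := exists_unitary_mul_eq hV hV'
  have hX : Measurable fun ω i => U i ω * (U i ω)ᴴ := measurable_pi_lambda _ fun i =>
    measurable_mul_conjTranspose.comp (hm i)
  have hXQ : Measurable fun ω i => Qᴴ * (U i ω * (U i ω)ᴴ) * Qᴴᴴ := measurable_pi_lambda _ fun i =>
    (measurable_conj_mul _ _).comp (measurable_mul_conjTranspose.comp (hm i))
  have hG : Measurable fun X : Fin n → Matrix (Fin N) (Fin N) ℂ => F fun i => Vᴴ * X i * V :=
    hF.comp (measurable_pi_lambda _ fun i => (measurable_conj_mul _ _).comp (measurable_pi_apply i))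
  have h1 := lintegral_map (μ := μ) hG hX
  have h2 := lintegral_map (μ := μ) hG hXQ
  have h3 : Qᴴ ∈ Matrix.unitaryGroup (Fin N) ℂ := Unitary.star_mem hQ
  rw [map_conj_family_eq hm hiso hind h3, h1] at h2
  refine Eq.trans ?_ h2.symm
  refine lintegral_congr fun ω => ?_
  simp only [Matrix.conjTranspose_mul, Matrix.conjTranspose_conjTranspose, Matrix.mul_assoc]

end Rotation

/-! ### Mean alignment loss for a fixed channel and precoder -/

section Alignment

variable {Ω : Type*} [MeasurableSpace Ω] {μ : Measure Ω} [IsProbabilityMeasure μ] {N M n : ℕ}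
  {U : Fin n → Ω → Matrix (Fin N) (Fin 1) ℂ}

/-- The loss of alignment between the direction `η` and the codewords that are closest to the range
of `V`. -/
def alignSum (V : Matrix (Fin N) (Fin M) ℂ) (η : Matrix (Fin M) (Fin 1) ℂ)
    (C : Fin n → Matrix (Fin N) (Fin 1) ℂ) : ℝ≥0∞ :=
  maxSum (fun i => frobSq (Vᴴ * C i)) (fun i => frobSq (ηᴴ * (Vᴴ * C i)))

lemma measurable_alignSum (V : Matrix (Fin N) (Fin M) ℂ) :
    Measurable fun q : Matrix (Fin M) (Fin 1) ℂ × (Fin n → Matrix (Fin N) (Fin 1) ℂ) =>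
      alignSum V q.1 q.2 := by
  have h : ∀ i : Fin n, Measurable fun q : Matrix (Fin M) (Fin 1) ℂ ×
      (Fin n → Matrix (Fin N) (Fin 1) ℂ) => Vᴴ * q.2 i := fun i =>
    measurable_const.matrixMul ((measurable_pi_apply i).comp measurable_snd)
  exact measurable_maxSum.comp ((measurable_pi_lambda _ fun i => measurable_frobSq.comp (h i)).prodMk
    (measurable_pi_lambda _ fun i =>
      measurable_frobSq.comp (measurable_fst.matrixConjTranspose.matrixMul (h i))))

lemma measurable_alignSum_codebook (V : Matrix (Fin N) (Fin M) ℂ) (η : Matrix (Fin M) (Fin 1) ℂ)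
    (hm : ∀ i, Measurable (U i)) : Measurable fun ω => alignSum V η (fun i => U i ω) := by
  have h : Measurable fun ω => (η, fun i => U i ω) :=
    measurable_const.prodMk (measurable_pi_lambda _ hm)
  have h2 := (measurable_alignSum (n := n) V).comp h
  exact h2

lemma alignSum_smul (V : Matrix (Fin N) (Fin M) ℂ) (η : Matrix (Fin M) (Fin 1) ℂ)
    (C : Fin n → Matrix (Fin N) (Fin 1) ℂ) {s : ℝ} (hs : 0 < s) :
    alignSum V ((s : ℂ) • η) C = (ENNReal.ofReal s)⁻¹ * alignSum V η C := by
  rw [alignSum, alignSum, ← maxSum_mul _ _ hs]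
  congr 1
  funext i
  rw [Matrix.conjTranspose_smul, Matrix.smul_mul, frobSq_smul, norm_star, Complex.norm_real,
    Real.norm_eq_abs, sq_abs]

/-- Rotating `η` by `Q` amounts to replacing `V` by `V Q`, which is again semi-unitary, and the law
of the codebook does not distinguish the two. -/
lemma lintegral_alignSum_unitary (hm : ∀ i, Measurable (U i))
    (hiso : ∀ i, IsIsotropic μ fun ω => U i ω * (U i ω)ᴴ) (hind : iIndepFun U μ)
    {V : Matrix (Fin N) (Fin M) ℂ} (hV : IsSemiUnitary V) {Q : Matrix (Fin M) (Fin M) ℂ}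
    (hQ : Q ∈ Matrix.unitaryGroup (Fin M) ℂ) (η : Matrix (Fin M) (Fin 1) ℂ) :
    ∫⁻ ω, alignSum V (Q * η) (fun i => U i ω) ∂μ = ∫⁻ ω, alignSum V η (fun i => U i ω) ∂μ := by
  have hQ' : Qᴴ * Q = 1 := Matrix.mem_unitaryGroup_iff'.1 hQ
  have hQs : IsSemiUnitary (Qᴴ) := by
    show Qᴴᴴ * Qᴴ = 1
    rw [Matrix.conjTranspose_conjTranspose]; exact Matrix.mem_unitaryGroup_iff.1 hQ
  let F : (Fin n → Matrix (Fin M) (Fin M) ℂ) → ℝ≥0∞ := fun Y =>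
    maxSum (fun i => (Y i).trace.re) (fun i => (ηᴴ * Y i * η).trace.re)
  have hF : Measurable F := by
    have h1 : Measurable fun (Y : Fin n → Matrix (Fin M) (Fin M) ℂ) (i : Fin n) =>
        (Y i).trace.re :=
      measurable_pi_lambda _ fun i => measurable_trace_re.comp (measurable_pi_apply i)
    have h2 : Measurable fun (Y : Fin n → Matrix (Fin M) (Fin M) ℂ) (i : Fin n) =>
        (ηᴴ * Y i * η).trace.re :=
      measurable_pi_lambda _ fun i => measurable_trace_re.comp
        ((measurable_conj_mul _ _).comp (measurable_pi_apply i))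
    have h3 := measurable_maxSum.comp (h1.prodMk h2)
    exact h3
  have hFV : ∀ (V : Matrix (Fin N) (Fin M) ℂ) (C : Fin n → Matrix (Fin N) (Fin 1) ℂ),
      F (fun i => Vᴴ * (C i * (C i)ᴴ) * V) = alignSum V η C := by
    intro V C
    simp only [F, alignSum]
    congr 1
    · funext i; rw [← frobSq_conjTranspose_mul_eq]
    · funext i
      have : ηᴴ * (Vᴴ * (C i * (C i)ᴴ) * V) * η = (ηᴴ * (Vᴴ * C i)) * (ηᴴ * (Vᴴ * C i))ᴴ := by
        simp [Matrix.conjTranspose_mul, Matrix.mul_assoc]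
      rw [this, trace_mul_conjTranspose_self, Complex.ofReal_re]
  have h := lintegral_projection_eq hm hiso hind hV (hV.mul (n := Fin M) (U := V) (V := Q) hQ') hF
  simp only [hFV] at h
  rw [← h]
  refine lintegral_congr fun ω => ?_
  simp only [alignSum, Matrix.conjTranspose_mul]
  congr 1
  · funext i
    rw [Matrix.mul_assoc, frobSq_semiUnitary_mul hQs]
  · funext i
    simp only [Matrix.mul_assoc]

lemma exists_unitary_smul_eq {η₀ : Matrix (Fin M) (Fin 1) ℂ} (hη₀ : IsSemiUnitary η₀)
    {z : Matrix (Fin M) (Fin 1) ℂ} (hz : z ≠ 0) :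
    ∃ Q ∈ Matrix.unitaryGroup (Fin M) ℂ, z = ((√(frobSq z) : ℝ) : ℂ) • (Q * η₀) := by
  have h0 : frobSq z ≠ 0 := fun h => hz (frobSq_eq_zero h)
  have hpos : 0 < frobSq z := lt_of_le_of_ne (frobSq_nonneg _) (Ne.symm h0)
  obtain ⟨Q, hQ, h⟩ := exists_unitary_mul_eq hη₀ (isSemiUnitary_normalize h0)
  refine ⟨Q, hQ, ?_⟩
  rw [h, smul_smul, ← Complex.ofReal_mul, mul_inv_cancel₀ (Real.sqrt_pos.2 hpos).ne',
    Complex.ofReal_one, one_smul]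

/-- The expected alignment loss in a direction is inversely proportional to its length. -/
lemma lintegral_alignSum_eq (hm : ∀ i, Measurable (U i))
    (hiso : ∀ i, IsIsotropic μ fun ω => U i ω * (U i ω)ᴴ) (hind : iIndepFun U μ)
    {V : Matrix (Fin N) (Fin M) ℂ} (hV : IsSemiUnitary V) {η₀ : Matrix (Fin M) (Fin 1) ℂ}
    (hη₀ : IsSemiUnitary η₀) {z : Matrix (Fin M) (Fin 1) ℂ} (hz : z ≠ 0) :
    ∫⁻ ω, alignSum V z (fun i => U i ω) ∂μ =
      (ENNReal.ofReal √(frobSq z))⁻¹ * ∫⁻ ω, alignSum V η₀ (fun i => U i ω) ∂μ := by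
  obtain ⟨Q, hQ, h⟩ := exists_unitary_smul_eq hη₀ hz
  have h0 : frobSq z ≠ 0 := fun h => hz (frobSq_eq_zero h)
  have hpos : 0 < √(frobSq z) :=
    Real.sqrt_pos.2 (lt_of_le_of_ne (frobSq_nonneg _) (Ne.symm h0))
  have hU : Measurable fun ω i => U i ω := measurable_pi_lambda _ hm
  have hme : Measurable fun ω => alignSum V (Q * η₀) (fun i => U i ω) :=
    measurable_alignSum_codebook V (Q * η₀) hm
  calc ∫⁻ ω, alignSum V z (fun i => U i ω) ∂μ
      = ∫⁻ ω, (ENNReal.ofReal √(frobSq z))⁻¹ * alignSum V (Q * η₀) (fun i => U i ω) ∂μ := by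
        refine lintegral_congr fun ω => ?_
        rw [← alignSum_smul _ _ _ hpos, ← h]
    _ = _ := by
        rw [lintegral_const_mul _ hme, lintegral_alignSum_unitary hm hiso hind hV hQ]

/-- A Gaussian vector, as a column. -/
def columnOf (z : Fin M → ℂ) : Matrix (Fin M) (Fin 1) ℂ := Matrix.of fun i _ => z i

lemma measurable_columnOf : Measurable (columnOf : (Fin M → ℂ) → _) :=
  measurable_pi_lambda _ fun i => measurable_pi_lambda _ fun _ => measurable_pi_apply i

lemma ae_columnOf_ne_zero (hM : 0 < M) : ∀ᵐ z ∂(gaussianVector M), columnOf z ≠ 0 := by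
  have h := lintegral_dotProduct_le_coord (N := M) (Pi.single ⟨0, hM⟩ 1) ⟨0, hM⟩
  have hm : Measurable fun g : Fin M → ℂ => ‖(Pi.single ⟨0, hM⟩ 1 : Fin M → ℂ) ⬝ᵥ g‖ₑ⁻¹ := by
    simp only [single_one_dotProduct]
    exact (measurable_pi_apply _).enorm.inv
  have h2 := ae_lt_top hm (ne_top_of_le_ne_top (by simp [negMomentBound_ne_top]) h)
  filter_upwards [h2] with z hz h0
  have : z ⟨0, hM⟩ = 0 := congrFun (congrFun h0 ⟨0, hM⟩) 0
  simp [this] at hz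

/-- The average inverse length of a Gaussian vector. -/
def invNormMoment (M : ℕ) : ℝ≥0∞ :=
  ∫⁻ z : Fin M → ℂ, (ENNReal.ofReal √(frobSq (columnOf z)))⁻¹ ∂(gaussianVector M)

lemma invNormMoment_ne_zero (M : ℕ) : invNormMoment M ≠ 0 := by
  intro h
  have hm : Measurable fun z : Fin M → ℂ => (ENNReal.ofReal √(frobSq (columnOf z)))⁻¹ :=
    (ENNReal.measurable_ofReal.comp (measurable_frobSq.comp measurable_columnOf).sqrt).inv
  rw [invNormMoment, lintegral_eq_zero_iff hm] at h
  obtain ⟨z, hz⟩ := h.exists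
  simp at hz

lemma lintegral_inner_le (hM : 0 < M) (ξ : Matrix (Fin M) (Fin 1) ℂ) :
    ∫⁻ z : Fin M → ℂ, (ENNReal.ofReal √(frobSq ((columnOf z)ᴴ * ξ)))⁻¹ ∂(gaussianVector M) ≤
      negMomentBound * M * (ENNReal.ofReal √(frobSq ξ))⁻¹ := by
  have h := lintegral_dotProduct_le (fun i => star (ξ i 0)) (s := √(frobSq ξ))
    (by rw [Real.sq_sqrt (frobSq_nonneg _)]; simp [frobSq]) (Real.sqrt_nonneg _) hM
  refine le_trans (le_of_eq ?_) h
  refine lintegral_congr fun z => ?_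
  rw [frobSq_fin_one, Real.sqrt_sq (norm_nonneg _), ofReal_norm]
  have : ((columnOf z)ᴴ * ξ) 0 0 = star ((fun i => star (ξ i 0)) ⬝ᵥ z) := by
    simp [Matrix.mul_apply, dotProduct, columnOf, mul_comm]
  rw [this, ← ofReal_norm, ← ofReal_norm, norm_star]

/-- Two independent variables, one of them without atoms, coincide with probability zero. -/
lemma ae_injective_frobSq (hm : ∀ i, Measurable (U i)) (hU : ∀ i ω, IsSemiUnitary (U i ω))
    (hiso : ∀ i, IsIsotropic μ fun ω => U i ω * (U i ω)ᴴ) (hind : iIndepFun U μ) (hM : 0 < M)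
    (hMN : M < N) {V : Matrix (Fin N) (Fin M) ℂ} (hV : IsSemiUnitary V) :
    ∀ᵐ ω ∂μ, Function.Injective fun i => frobSq (Vᴴ * U i ω) := by
  obtain ⟨m, rfl⟩ : ∃ m, M = m + 1 := ⟨M - 1, by omega⟩
  have h : ∀ᵐ ω ∂μ, ∀ i j, i ≠ j → frobSq (Vᴴ * U i ω) ≠ frobSq (Vᴴ * U j ω) := by
    rw [ae_all_iff]; intro i
    rw [ae_all_iff]; intro j
    by_cases hij : i = j
    · exact Eventually.of_forall fun ω h => absurd hij h
    have h1 := measure_eq_zero_of_indep ((measurable_frobSq_mul V).comp (hm i))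
      ((measurable_frobSq_mul V).comp (hm j))
      ((hind.indepFun hij).comp (measurable_frobSq_mul V) (measurable_frobSq_mul V))
      (fun t => measure_frobSq_eq_zero (hm i) (hU i) (hiso i) hMN hV t)
    filter_upwards [measure_eq_zero_iff_ae_notMem.1 h1] with ω hω _ h
    exact hω h
  filter_upwards [h] with ω hω i j hij
  by_contra hne
  exact hω i j hne hij

/-- The expected alignment loss in the direction of a unit vector is bounded, uniformly in the
size of the codebook. -/
lemma lintegral_alignSum_le (hm : ∀ i, Measurable (U i)) (hU : ∀ i ω, IsSemiUnitary (U i ω))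
    (hiso : ∀ i, IsIsotropic μ fun ω => U i ω * (U i ω)ᴴ) (hind : iIndepFun U μ) (hM : 0 < M)
    (hMN : M < N) {V : Matrix (Fin N) (Fin M) ℂ} (hV : IsSemiUnitary V)
    {η₀ : Matrix (Fin M) (Fin 1) ℂ} (hη₀ : IsSemiUnitary η₀) :
    ∫⁻ ω, alignSum V η₀ (fun i => U i ω) ∂μ ≤ negMomentBound * M / invNormMoment M := by
  have hUm : Measurable fun ω i => U i ω := measurable_pi_lambda _ hm
  rw [ENNReal.le_div_iff_mul_le (Or.inl (invNormMoment_ne_zero M))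
    (Or.inr (ENNReal.mul_ne_top negMomentBound_ne_top (ENNReal.natCast_ne_top M)))]
  have hjoint : Measurable fun q : (Fin M → ℂ) × Ω =>
      alignSum V (columnOf q.1) (fun i => U i q.2) := by
    have h1 : Measurable fun q : (Fin M → ℂ) × Ω => (columnOf q.1, fun i => U i q.2) :=
      (measurable_columnOf.comp measurable_fst).prodMk (hUm.comp measurable_snd)
    have h2 := (measurable_alignSum (n := n) V).comp h1
    exact h2
  have hinner : ∀ ω, ∫⁻ z, alignSum V (columnOf z) (fun i => U i ω) ∂(gaussianVector M) ≤
      ∑ i, if ∀ j, frobSq (Vᴴ * U j ω) ≤ frobSq (Vᴴ * U i ω) then negMomentBound * M else 0 := by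
    intro ω
    unfold alignSum maxSum
    have hmi : ∀ i, Measurable fun z : Fin M → ℂ =>
        (ENNReal.ofReal √(frobSq ((columnOf z)ᴴ * (Vᴴ * U i ω))))⁻¹ := fun i =>
      (ENNReal.measurable_ofReal.comp (measurable_frobSq.comp
        (measurable_columnOf.matrixConjTranspose.matrixMul measurable_const)).sqrt).inv
    rw [lintegral_finsetSum]
    · refine Finset.sum_le_sum fun i _ => ?_
      split_ifs
      · rw [lintegral_const_mul _ (hmi i)]
        calc _ ≤ ENNReal.ofReal √(frobSq (Vᴴ * U i ω)) * (negMomentBound * M *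
              (ENNReal.ofReal √(frobSq (Vᴴ * U i ω)))⁻¹) := by
              gcongr; exact lintegral_inner_le hM _
          _ = negMomentBound * M * (ENNReal.ofReal √(frobSq (Vᴴ * U i ω)) *
              (ENNReal.ofReal √(frobSq (Vᴴ * U i ω)))⁻¹) := by ring
          _ ≤ negMomentBound * M * 1 := by gcongr; exact ENNReal.mul_inv_le_one _
          _ = _ := mul_one _
      · simp
    · intro i _
      split_ifs
      · exact (hmi i).const_mul _
      · exact measurable_const
  -- By the scaling law the product is the loss averaged over a Gaussian direction `z`. After
  -- exchanging the integrals the codebook is frozen, and only `|zᴴ ξ|⁻¹` is averaged, which costs a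
  -- constant times `‖ξ‖⁻¹`.
  calc (∫⁻ ω, alignSum V η₀ (fun i => U i ω) ∂μ) * invNormMoment M
      = ∫⁻ z, ∫⁻ ω, alignSum V (columnOf z) (fun i => U i ω) ∂μ ∂(gaussianVector M) := by
        rw [invNormMoment, ← lintegral_const_mul]
        · refine lintegral_congr_ae ?_
          filter_upwards [ae_columnOf_ne_zero hM] with z hz
          rw [lintegral_alignSum_eq hm hiso hind hV hη₀ hz, mul_comm]
        · exact (ENNReal.measurable_ofReal.comp
            (measurable_frobSq.comp measurable_columnOf).sqrt).inv
    _ = ∫⁻ ω, ∫⁻ z, alignSum V (columnOf z) (fun i => U i ω) ∂(gaussianVector M) ∂μ :=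
        lintegral_lintegral_swap hjoint.aemeasurable
    _ ≤ ∫⁻ _ω, negMomentBound * M ∂μ := by
        refine lintegral_mono_ae ?_
        -- Without ties at most one summand survives, so the bound does not grow with the codebook.
        filter_upwards [ae_injective_frobSq hm hU hiso hind hM hMN hV] with ω hω
        refine (hinner ω).trans ?_
        have h1 := sum_isMax_le_one hω
        calc _ = negMomentBound * M * ∑ i, (if ∀ j, frobSq (Vᴴ * U j ω) ≤ frobSq (Vᴴ * U i ω)
              then (1 : ℝ≥0∞) else 0) := by
              rw [Finset.mul_sum]
              exact Finset.sum_congr rfl fun i _ => by split_ifs <;> simp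
          _ ≤ negMomentBound * M * 1 := by gcongr
          _ = _ := mul_one _
    _ = _ := by simp

/-- The alignment loss, as a function of the projection `R` onto the row space of the channel, the
projection `Z` onto the precoder, and the codebook. -/
def alignWeight (R Z : Matrix (Fin N) (Fin N) ℂ) (C : Fin n → Matrix (Fin N) (Fin 1) ℂ) : ℝ≥0∞ :=
  ENNReal.ofReal √(R * Z).trace.re *
    maxSum (fun i => (R * (C i * (C i)ᴴ)).trace.re)
      (fun i => (Z * R * (C i * (C i)ᴴ) * R).trace.re)

lemma measurable_alignWeight : Measurable fun q : (Matrix (Fin N) (Fin N) ℂ ×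
    Matrix (Fin N) (Fin N) ℂ) × (Fin n → Matrix (Fin N) (Fin 1) ℂ) =>
      alignWeight q.1.1 q.1.2 q.2 := by
  have hR : Measurable fun q : (Matrix (Fin N) (Fin N) ℂ × Matrix (Fin N) (Fin N) ℂ) ×
      (Fin n → Matrix (Fin N) (Fin 1) ℂ) => q.1.1 := measurable_fst.comp measurable_fst
  have hZ : Measurable fun q : (Matrix (Fin N) (Fin N) ℂ × Matrix (Fin N) (Fin N) ℂ) ×
      (Fin n → Matrix (Fin N) (Fin 1) ℂ) => q.1.2 := measurable_snd.comp measurable_fst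
  have hX : ∀ i, Measurable fun q : (Matrix (Fin N) (Fin N) ℂ × Matrix (Fin N) (Fin N) ℂ) ×
      (Fin n → Matrix (Fin N) (Fin 1) ℂ) => q.2 i * (q.2 i)ᴴ := fun i =>
    measurable_mul_conjTranspose.comp ((measurable_pi_apply i).comp measurable_snd)
  refine (ENNReal.measurable_ofReal.comp (measurable_trace_re.comp (hR.matrixMul hZ)).sqrt).mul
    (measurable_maxSum.comp (Measurable.prodMk ?_ ?_))
  · exact measurable_pi_lambda _ fun i => measurable_trace_re.comp (hR.matrixMul (hX i))
  · exact measurable_pi_lambda _ fun i => measurable_trace_re.comp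
      (((hZ.matrixMul hR).matrixMul (hX i)).matrixMul hR)

lemma alignWeight_eq (V : Matrix (Fin N) (Fin M) ℂ) (w : Matrix (Fin N) (Fin 1) ℂ)
    (C : Fin n → Matrix (Fin N) (Fin 1) ℂ) :
    alignWeight (V * Vᴴ) (w * wᴴ) C =
      ENNReal.ofReal √(frobSq (Vᴴ * w)) * alignSum V (Vᴴ * w) C := by
  rw [alignWeight, alignSum, trace_rowProj_mul]
  congr 2
  · funext i; rw [trace_rowProj_mul]
  · funext i
    have h1 : w * wᴴ * (V * Vᴴ) * (C i * (C i)ᴴ) * (V * Vᴴ) =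
        w * ((Vᴴ * w)ᴴ * (Vᴴ * C i) * ((C i)ᴴ * V * Vᴴ)) := by
      simp [Matrix.conjTranspose_mul, Matrix.mul_assoc]
    have h2 : (Vᴴ * w)ᴴ * (Vᴴ * C i) * ((C i)ᴴ * V * Vᴴ) * w =
        ((Vᴴ * w)ᴴ * (Vᴴ * C i)) * ((Vᴴ * w)ᴴ * (Vᴴ * C i))ᴴ := by
      simp [Matrix.conjTranspose_mul, Matrix.mul_assoc]
    rw [h1, Matrix.trace_mul_comm, h2, trace_mul_conjTranspose_self, Complex.ofReal_re]

/-- The factor `‖Vᴴ w‖` in the weight cancels the inverse length in `lintegral_alignSum_eq`, which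
makes the bound uniform in `w`. -/
lemma lintegral_alignWeight_le (hm : ∀ i, Measurable (U i)) (hU : ∀ i ω, IsSemiUnitary (U i ω))
    (hiso : ∀ i, IsIsotropic μ fun ω => U i ω * (U i ω)ᴴ) (hind : iIndepFun U μ) (hM : 0 < M)
    (hMN : M < N) {V : Matrix (Fin N) (Fin M) ℂ} (hV : IsSemiUnitary V)
    (w : Matrix (Fin N) (Fin 1) ℂ) :
    ∫⁻ ω, alignWeight (V * Vᴴ) (w * wᴴ) (fun i => U i ω) ∂μ ≤
      negMomentBound * M / invNormMoment M := by
  simp only [alignWeight_eq]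
  have hme : Measurable fun ω => alignSum V (Vᴴ * w) (fun i => U i ω) :=
    measurable_alignSum_codebook V (Vᴴ * w) hm
  rw [lintegral_const_mul _ hme]
  -- The prefactor is then zero, and `0 * ⊤ = 0`.
  by_cases hz : Vᴴ * w = 0
  · simp [hz, frobSq]
  obtain ⟨η₀, hη₀⟩ := exists_semiUnitary (M := 1) (N := M) hM
  rw [lintegral_alignSum_eq hm hiso hind hV hη₀ hz, ← mul_assoc]
  calc _ ≤ 1 * ∫⁻ ω, alignSum V η₀ (fun i => U i ω) ∂μ := by
        gcongr; exact ENNReal.mul_inv_le_one _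
    _ ≤ _ := by rw [one_mul]; exact lintegral_alignSum_le hm hU hiso hind hM hMN hV hη₀

end Alignment

/-! ### Mean alignment loss for random channel and precoder -/

section RandomAlignment

variable {Ω : Type*} [MeasurableSpace Ω] {μ : Measure Ω} [IsProbabilityMeasure μ] {K M N n : ℕ}
  {Ht : Fin K → Ω → Matrix (Fin M) (Fin N) ℂ} {U : Fin K → Fin n → Ω → Matrix (Fin N) (Fin 1) ℂ}

lemma measurable_alignWeight_joint (A : Matrix (Fin M) (Fin M) ℂ) :
    Measurable fun q : Matrix (Fin N) (Fin N) ℂ ×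
      (Matrix (Fin M) (Fin N) ℂ × (Fin n → Matrix (Fin N) (Fin 1) ℂ)) =>
      alignWeight (rowProj (A * q.2.1)) q.1 q.2.2 := by
  have h1 : Measurable fun q : Matrix (Fin N) (Fin N) ℂ ×
      (Matrix (Fin M) (Fin N) ℂ × (Fin n → Matrix (Fin N) (Fin 1) ℂ)) =>
      ((rowProj (A * q.2.1), q.1), q.2.2) :=
    ((measurable_rowProj.comp (measurable_const.matrixMul
      (measurable_fst.comp measurable_snd))).prodMk measurable_fst).prodMk
      (measurable_snd.comp measurable_snd)
  have h2 := (measurable_alignWeight (N := N) (n := n)).comp h1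
  exact h2

/-- The expected alignment loss between the effective channel and the zero-forcing precoder. -/
lemma lintegral_alignWeight_random_le (hHt : IsRayleighFading μ Ht) (hU : IsRVQ μ Ht U)
    (hM : 0 < M) (hMN : M < N) {A : Matrix (Fin M) (Fin M) ℂ} (hA : A.det ≠ 0) (k : Fin K)
    {O : Ω → Matrix (Fin N) (Fin N) ℂ} (hO : Measurable O)
    (hind : IndepFun (fun ω => (Ht k ω, fun i => U k i ω)) O μ)
    {w : Ω → Matrix (Fin N) (Fin 1) ℂ} (hOw : ∀ᵐ ω ∂μ, O ω = w ω * (w ω)ᴴ) :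
    ∫⁻ ω, alignWeight (rowProj (A * Ht k ω)) (O ω) (fun i => U k i ω) ∂μ ≤
      negMomentBound * M / invNormMoment M := by
  obtain ⟨W₀, hW₀⟩ := exists_semiUnitary hMN.le
  have hX : Measurable fun ω => (Ht k ω, fun i => U k i ω) :=
    (hHt.measurable k).prodMk (hU.measurable_codebook k)
  have hF := measurable_alignWeight_joint (N := N) (n := n) A
  have h1 := lintegral_of_indepFun hO hX hind.symm hF
  calc ∫⁻ ω, alignWeight (rowProj (A * Ht k ω)) (O ω) (fun i => U k i ω) ∂μ
      = ∫⁻ ω, ∫⁻ ω', alignWeight (rowProj (A * Ht k ω')) (O ω) (fun i => U k i ω') ∂μ ∂μ := h1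
    _ ≤ ∫⁻ _ω, negMomentBound * M / invNormMoment M ∂μ := by
        refine lintegral_mono_ae ?_
        filter_upwards [hOw] with ω hω
        have hF' : Measurable fun q : Matrix (Fin M) (Fin N) ℂ ×
            (Fin n → Matrix (Fin N) (Fin 1) ℂ) => alignWeight (rowProj (A * q.1)) (O ω) q.2 := by
          have h := hF.comp (measurable_prodMk_left (x := O ω))
          exact h
        have h2 := lintegral_of_indepFun (hHt.measurable k) (hU.measurable_codebook k)
          (hU.indepFun_codebook k) hF'
        calc ∫⁻ ω', alignWeight (rowProj (A * Ht k ω')) (O ω) (fun i => U k i ω') ∂μ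
            = ∫⁻ ω', ∫⁻ ω'', alignWeight (rowProj (A * Ht k ω')) (O ω)
                (fun i => U k i ω'') ∂μ ∂μ := h2
          _ ≤ ∫⁻ _ω', negMomentBound * M / invNormMoment M ∂μ := by
              refine lintegral_mono_ae ?_
              filter_upwards [hHt.ae_det_ne_zero k hA hW₀] with ω' hω'
              obtain ⟨V, hV, -, -, -, hproj⟩ := exists_rowProj_factor hω'
              rw [hproj, hω]
              exact lintegral_alignWeight_le (hU.measurable k) (hU.semiUnitary k)
                (hU.isIsotropic k) (hU.iIndepFun_codebook k) hM hMN hV (w ω)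
          _ = _ := by simp
    _ = _ := by simp

/-- No atom at zero: a codeword is almost surely not orthogonal to the row space, so the selected
one has a projection with a direction. -/
lemma ae_trace_rowProj_ne_zero (hHt : IsRayleighFading μ Ht) (hU : IsRVQ μ Ht U)
    (hM : 0 < M) (hMN : M < N) {A : Matrix (Fin M) (Fin M) ℂ} (hA : A.det ≠ 0) (k : Fin K)
    (i : Fin n) :
    ∀ᵐ ω ∂μ, (rowProj (A * Ht k ω) * (U k i ω * (U k i ω)ᴴ)).trace.re ≠ 0 := by
  obtain ⟨W₀, hW₀⟩ := exists_semiUnitary hMN.le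
  have hm : Measurable fun q : Matrix (Fin M) (Fin N) ℂ × Matrix (Fin N) (Fin 1) ℂ =>
      (rowProj (A * q.1) * (q.2 * q.2ᴴ)).trace.re :=
    measurable_trace_re.comp ((measurable_rowProj.comp (measurable_const.matrixMul
      measurable_fst)).matrixMul (measurable_mul_conjTranspose.comp measurable_snd))
  have hs : MeasurableSet {q : Matrix (Fin M) (Fin N) ℂ × Matrix (Fin N) (Fin 1) ℂ |
      (rowProj (A * q.1) * (q.2 * q.2ᴴ)).trace.re ≠ 0} := hm (measurableSet_singleton 0).compl
  have hind : IndepFun (Ht k) (U k i) μ :=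
    (hU.indepFun_codebook k).comp measurable_id (measurable_pi_apply i)
  refine ae_of_indepFun (hHt.measurable k) (hU.measurable k i) hind hs ?_
  filter_upwards [hHt.ae_det_ne_zero k hA hW₀] with ω hω
  obtain ⟨V, hV, -, -, -, hproj⟩ := exists_rowProj_factor hω
  obtain ⟨m, rfl⟩ : ∃ m, M = m + 1 := ⟨M - 1, by omega⟩
  have h1 := measure_frobSq_eq_zero (hU.measurable k i) (hU.semiUnitary k i) (hU.isIsotropic k i)
    hMN hV 0
  filter_upwards [measure_eq_zero_iff_ae_notMem.1 h1] with ω' hω'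
  show (rowProj (A * Ht k ω) * (U k i ω' * (U k i ω')ᴴ)).trace.re ≠ 0
  rw [hproj, trace_rowProj_mul]
  exact hω'

end RandomAlignment

/-! ### Deterministic lower bounds for logarithmic lengths -/

section LowerBounds

variable {M N : ℕ}

lemma norm_le_one_add_frobSq {m n : Type*} [Fintype m] [Fintype n] (A : Matrix m n ℂ) (i : m)
    (j : n) : ‖A i j‖ ≤ 1 + frobSq A := by
  have h1 : ‖A i j‖ ^ 2 ≤ ∑ j, ‖A i j‖ ^ 2 :=
    Finset.single_le_sum (f := fun j => ‖A i j‖ ^ 2) (fun _ _ => by positivity) (Finset.mem_univ j)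
  have h2 : ∑ j, ‖A i j‖ ^ 2 ≤ frobSq A :=
    Finset.single_le_sum (f := fun i => ∑ j, ‖A i j‖ ^ 2)
      (fun _ _ => by positivity) (Finset.mem_univ i)
  nlinarith [sq_nonneg (‖A i j‖ - 1), norm_nonneg (A i j)]

lemma norm_adjugate_le (T : Matrix (Fin M) (Fin M) ℂ) (i j : Fin M) :
    ‖T.adjugate i j‖ ≤ M.factorial * (1 + frobSq T) ^ M := by
  rw [Matrix.adjugate_apply]
  have h := Matrix.det_le (abv := NormedField.toAbsoluteValue ℂ) (x := 1 + frobSq T)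
    (A := T.updateRow j (Pi.single i 1)) (fun a b => by
      show ‖T.updateRow j (Pi.single i 1) a b‖ ≤ _
      rw [Matrix.updateRow_apply]
      split_ifs
      · rw [Pi.single_apply]
        split_ifs <;> simp [frobSq_nonneg]
        linarith [frobSq_nonneg T]
      · exact norm_le_one_add_frobSq T a b)
  have h' : ‖(T.updateRow j (Pi.single i 1)).det‖ ≤ _ := h
  simpa using h'

lemma frobSq_adjugate_le (T : Matrix (Fin M) (Fin M) ℂ) :
    frobSq T.adjugate ≤ (M * M.factorial * (1 + frobSq T) ^ M) ^ 2 := by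
  calc frobSq T.adjugate ≤ ∑ _i : Fin M, ∑ _j : Fin M, (M.factorial * (1 + frobSq T) ^ M) ^ 2 := by
        unfold frobSq
        refine Finset.sum_le_sum fun i _ => Finset.sum_le_sum fun j _ => ?_
        exact pow_le_pow_left₀ (norm_nonneg _) (norm_adjugate_le T i j) 2
    _ = _ := by simp; ring

/-- Apply the adjugate to `T c` and bound its entries crudely. The result holds for all unit vectors
at once, as it must, because the combiner depends on the channel and the codebook. -/
lemma norm_det_sq_le (T : Matrix (Fin M) (Fin M) ℂ) {c : Matrix (Fin M) (Fin 1) ℂ}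
    (hc : IsSemiUnitary c) :
    ‖T.det‖ ^ 2 ≤ (M * M.factorial * (1 + frobSq T) ^ M) ^ 2 * frobSq (T * c) := by
  have h1 : T.adjugate * (T * c) = T.det • c := by
    rw [← Matrix.mul_assoc, Matrix.adjugate_mul, Matrix.smul_mul, Matrix.one_mul]
  have h2 := frobSq_mul_le T.adjugate (T * c)
  rw [h1, frobSq_smul, frobSq_of_semiUnitary hc] at h2
  simp only [Fintype.card_fin, Nat.cast_one, mul_one] at h2
  exact h2.trans (mul_le_mul_of_nonneg_right (frobSq_adjugate_le T) (frobSq_nonneg _))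

/-- Turns bounded negative first moments into lower bounds for expected logarithms. -/
lemma neg_inv_le_log {x : ℝ} (hx : 0 < x) : -x⁻¹ ≤ Real.log x := by
  have := Real.log_le_sub_one_of_pos (inv_pos.2 hx)
  rw [Real.log_inv] at this
  linarith

/-- The effective channel after combining is bounded below by a determinant of the channel. -/
lemma log_frobSq_effective_ge {H : Matrix (Fin M) (Fin N) ℂ} {V W₀ : Matrix (Fin N) (Fin M) ℂ}
    (hM : 0 < M) (hV : IsSemiUnitary V) (hH : H * (V * Vᴴ) = H) (hW₀ : IsSemiUnitary W₀)
    (hdet : (H * W₀).det ≠ 0) {c : Matrix (Fin M) (Fin 1) ℂ} (hc : IsSemiUnitary c) :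
    -(2 * ‖(H * W₀).det‖⁻¹ + 2 * Real.log (M * M.factorial) + 2 * M * frobSq H) ≤
      Real.log (frobSq ((H * V)ᴴ * c)) := by
  set T := (H * W₀)ᴴ with hT
  have hTdet : ‖T.det‖ = ‖(H * W₀).det‖ := by
    rw [hT, Matrix.det_conjTranspose, norm_star]
  have hpos : 0 < ‖T.det‖ := by rw [hTdet]; exact norm_pos_iff.2 hdet
  -- Projecting to the range of `W₀` only shortens vectors; the channel-dependent basis `V` is thus
  -- traded for a fixed one.
  have hTc : frobSq (T * c) ≤ frobSq ((H * V)ᴴ * c) := by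
    have e : T * c = W₀ᴴ * (V * ((H * V)ᴴ * c)) := by
      have e1 : Hᴴ = V * (H * V)ᴴ := by
        have := congrArg Matrix.conjTranspose hH
        simp only [Matrix.conjTranspose_mul, Matrix.conjTranspose_conjTranspose] at this ⊢
        rw [← Matrix.mul_assoc]; exact this.symm
      rw [hT, Matrix.conjTranspose_mul, ← Matrix.mul_assoc V, ← e1, Matrix.mul_assoc]
    rw [e]
    exact (frobSq_conjTranspose_mul_le hW₀ _).trans_eq (frobSq_semiUnitary_mul hV _)
  have hTH : frobSq T ≤ frobSq H := by
    rw [hT, Matrix.conjTranspose_mul, ← frobSq_conjTranspose H]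
    exact frobSq_conjTranspose_mul_le hW₀ _
  have hfac : (0 : ℝ) < M * M.factorial := by
    have h1 : (0 : ℝ) < M := by exact_mod_cast hM
    have h2 : (0 : ℝ) < M.factorial := by exact_mod_cast M.factorial_pos
    positivity
  have hf := frobSq_nonneg T
  have hfH := frobSq_nonneg H
  set B := (M * M.factorial : ℝ) * (1 + frobSq T) ^ M with hB
  have hBpos : 0 < B := by positivity
  have h1 : ‖T.det‖ ^ 2 ≤ B ^ 2 * frobSq ((H * V)ᴴ * c) :=
    (norm_det_sq_le T hc).trans (mul_le_mul_of_nonneg_left hTc (by positivity))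
  have hτ : 0 < frobSq ((H * V)ᴴ * c) := by
    by_contra hcon
    have : frobSq ((H * V)ᴴ * c) = 0 := le_antisymm (not_lt.1 hcon) (frobSq_nonneg _)
    rw [this, mul_zero] at h1
    exact absurd h1 (not_le.2 (by positivity))
  have h2 := Real.log_le_log (by positivity) h1
  rw [Real.log_mul (by positivity) hτ.ne', Real.log_pow, Real.log_pow, hB,
    Real.log_mul hfac.ne' (by positivity), Real.log_pow] at h2
  have h3 := neg_inv_le_log hpos
  have h4 : Real.log (1 + frobSq T) ≤ frobSq H := by
    have := Real.log_le_sub_one_of_pos (show 0 < 1 + frobSq T by linarith)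
    linarith
  have h5 : (M : ℝ) * Real.log (1 + frobSq T) ≤ M * frobSq H :=
    mul_le_mul_of_nonneg_left h4 (Nat.cast_nonneg M)
  rw [hTdet] at h2 h3
  push_cast at h2
  linarith

/-- The part of the precoder in the row space of the channel is bounded below by its gain. -/
lemma log_frobSq_precoder_ge {G : Matrix (Fin M) (Fin N) ℂ} {V : Matrix (Fin N) (Fin M) ℂ}
    (hV : IsSemiUnitary V) (hG : G * (V * Vᴴ) = G) {w : Matrix (Fin N) (Fin 1) ℂ} {i : Fin M}
    (hne : (G * w) i 0 ≠ 0) :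
    0 < frobSq (Vᴴ * w) ∧
      -(2 * ‖(G * w) i 0‖⁻¹ + frobSq G) ≤ Real.log (frobSq (Vᴴ * w)) := by
  have h1 : ‖(G * w) i 0‖ ^ 2 ≤ frobSq G * frobSq (Vᴴ * w) := by
    have h2 : ‖(G * w) i 0‖ ^ 2 ≤ frobSq (G * w) := by
      have := Finset.single_le_sum (f := fun i => ‖(G * w) i 0‖ ^ 2)
        (fun _ _ => by positivity) (Finset.mem_univ i)
      simpa [frobSq] using this
    have h3 : G * w = (G * V) * (Vᴴ * w) := by
      rw [Matrix.mul_assoc, ← Matrix.mul_assoc V, ← Matrix.mul_assoc, hG]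
    have h4 : frobSq (G * V) ≤ frobSq G := by
      rw [← frobSq_conjTranspose, Matrix.conjTranspose_mul, ← frobSq_conjTranspose G]
      exact frobSq_conjTranspose_mul_le hV _
    refine h2.trans ?_
    conv_lhs => rw [h3]
    exact (frobSq_mul_le _ _).trans (mul_le_mul_of_nonneg_right h4 (frobSq_nonneg _))
  have hpos : 0 < ‖(G * w) i 0‖ := norm_pos_iff.2 hne
  have hp : 0 < frobSq G * frobSq (Vᴴ * w) := lt_of_lt_of_le (by positivity) h1
  have hβ : 0 < frobSq (Vᴴ * w) := by
    rcases (frobSq_nonneg (Vᴴ * w)).lt_or_eq with h | h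
    · exact h
    · rw [← h, mul_zero] at hp; exact absurd hp (lt_irrefl 0)
  have hG0 : 0 < frobSq G := pos_of_mul_pos_left hp hβ.le
  refine ⟨hβ, ?_⟩
  have h2 := Real.log_le_log (by positivity) h1
  rw [Real.log_mul hG0.ne' hβ.ne', Real.log_pow] at h2
  have h3 := neg_inv_le_log hpos
  have h4 := Real.log_le_sub_one_of_pos hG0
  push_cast at h2
  linarith

end LowerBounds

/-! ### Logarithmic gain with combining -/

section Gain

variable {M N n : ℕ}

/-- The gain of zero-forcing with quantization-based combining. -/
lemma IsQBC.log_gain_ge {q : (Fin n → Matrix (Fin N) (Fin 1) ℂ) → Matrix (Fin M) (Fin N) ℂ →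
      Matrix (Fin M) (Fin 1) ℂ × Fin n} (hq : IsQBC q) {C : Fin n → Matrix (Fin N) (Fin 1) ℂ}
    (hC : ∀ i, IsSemiUnitary (C i)) (hM : 0 < M) {A : Matrix (Fin M) (Fin M) ℂ} (hA : A.det ≠ 0)
    {G : Matrix (Fin M) (Fin N) ℂ} {W₀ : Matrix (Fin N) (Fin M) ℂ} (hW₀ : IsSemiUnitary W₀)
    (hdet : (A * G * W₀).det ≠ 0) {w : Matrix (Fin N) (Fin 1) ℂ} {i : Fin M}
    (hne : (G * w) i 0 ≠ 0) {j : Fin n}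
    (hj : (rowProj (A * G) * (C j * (C j)ᴴ)).trace.re ≠ 0)
    (hfin : alignWeight (rowProj (A * G)) (w * wᴴ) C ≠ ⊤) :
    ((q C (A * G)).1ᴴ * (A * G) * w) 0 0 ≠ 0 ∧
    -(2 * ‖(A * G * W₀).det‖⁻¹ + 2 * Real.log (M * M.factorial) + 2 * M * frobSq (A * G) +
      2 * ‖(G * w) i 0‖⁻¹ + frobSq G + 2 * (alignWeight (rowProj (A * G)) (w * wᴴ) C).toReal) ≤
      Real.log (‖((q C (A * G)).1ᴴ * (A * G) * w) 0 0‖ ^ 2) := by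
  obtain ⟨V, hV, -, hH, hHV, hproj⟩ := exists_rowProj_factor hdet
  obtain ⟨hmax, halign⟩ := hq.aligned hC hV hH hHV
  have hτ := frobSq_effective_ne_zero hHV (hq.unit C (A * G))
  have h1 := log_frobSq_effective_ge hM hV hH hW₀ hdet (hq.unit C (A * G))
  have hG : G * (V * Vᴴ) = G := by
    have := congrArg (fun B => A⁻¹ * B) hH
    simpa only [← Matrix.mul_assoc, Matrix.nonsing_inv_mul _ hA.isUnit, Matrix.one_mul] using this
  obtain ⟨hβ, h2⟩ := log_frobSq_precoder_ge hV hG hne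
  rw [hproj, trace_rowProj_mul] at hj
  rw [hproj, alignWeight_eq] at hfin ⊢
  set c := (q C (A * G)).1 with hc
  set ξ := Vᴴ * C (q C (A * G)).2 with hξ
  set τ := (A * G * V)ᴴ * c with hτdef
  set β := Vᴴ * w with hβdef
  have hτpos : 0 < frobSq τ := lt_of_le_of_ne (frobSq_nonneg _) (Ne.symm hτ)
  have hξpos : 0 < frobSq ξ :=
    lt_of_lt_of_le (lt_of_le_of_ne (frobSq_nonneg _) (Ne.symm hj)) (hmax j)
  have hle : ENNReal.ofReal √(frobSq β) * (ENNReal.ofReal √(frobSq ξ) *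
      (ENNReal.ofReal √(frobSq (βᴴ * ξ)))⁻¹) ≤ ENNReal.ofReal √(frobSq β) * alignSum V β C := by
    have h := le_maxSum (a := fun i => frobSq (Vᴴ * C i)) (b := fun i => frobSq (βᴴ * (Vᴴ * C i)))
      hmax
    exact mul_le_mul_right h _
  have hsβ : 0 < √(frobSq β) := Real.sqrt_pos.2 hβ
  have hsξ : 0 < √(frobSq ξ) := Real.sqrt_pos.2 hξpos
  -- Otherwise the alignment weight would be infinite.
  have hb : 0 < frobSq (βᴴ * ξ) := by
    refine lt_of_le_of_ne (frobSq_nonneg _) fun h0 => hfin ?_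
    rw [← h0] at hle
    simp only [Real.sqrt_zero, ENNReal.ofReal_zero, ENNReal.inv_zero] at hle
    rw [ENNReal.mul_top (ENNReal.ofReal_pos.2 hsξ).ne', ENNReal.mul_top
      (ENNReal.ofReal_pos.2 hsβ).ne'] at hle
    exact top_le_iff.1 hle
  have hsb : 0 < √(frobSq (βᴴ * ξ)) := Real.sqrt_pos.2 hb
  have hy : √(frobSq β) * (√(frobSq ξ) * (√(frobSq (βᴴ * ξ)))⁻¹) ≤
      (ENNReal.ofReal √(frobSq β) * alignSum V β C).toReal := by
    have := ENNReal.toReal_mono hfin hle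
    rwa [← ENNReal.ofReal_inv_of_pos hsb, ← ENNReal.ofReal_mul hsξ.le, ← ENNReal.ofReal_mul hsβ.le,
      ENNReal.toReal_ofReal (by positivity)] at this
  have hs : ‖(cᴴ * (A * G) * w) 0 0‖ ^ 2 = frobSq (βᴴ * τ) := by
    have e : cᴴ * (A * G) * w = (βᴴ * τ)ᴴ := by
      rw [hτdef, hβdef]
      conv_lhs => rw [← hH]
      simp [Matrix.conjTranspose_mul, Matrix.mul_assoc]
    rw [e, ← frobSq_fin_one, frobSq_conjTranspose]
  -- This writes the gain as `‖τ‖² |βᴴ ξ|² / ‖ξ‖²`. The logarithm of the last quotient is at least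
  -- `log ‖β‖²` minus twice the alignment weight.
  have hal := halign β
  have hspos : 0 < frobSq (βᴴ * τ) := by
    have : 0 < frobSq ξ * frobSq (βᴴ * τ) := by rw [hal]; positivity
    exact pos_of_mul_pos_right this hξpos.le
  have hlog := congrArg Real.log hal
  rw [Real.log_mul hξpos.ne' hspos.ne', Real.log_mul hτpos.ne' hb.ne'] at hlog
  have hylog : 1 / 2 * Real.log (frobSq β) + (1 / 2 * Real.log (frobSq ξ) -
      1 / 2 * Real.log (frobSq (βᴴ * ξ))) ≤
      √(frobSq β) * (√(frobSq ξ) * (√(frobSq (βᴴ * ξ)))⁻¹) := by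
    have h := Real.log_le_sub_one_of_pos (x := √(frobSq β) * (√(frobSq ξ) *
      (√(frobSq (βᴴ * ξ)))⁻¹)) (by positivity)
    rw [Real.log_mul hsβ.ne' (by positivity), Real.log_mul hsξ.ne' (by positivity), Real.log_inv,
      Real.log_sqrt hβ.le, Real.log_sqrt hξpos.le, Real.log_sqrt hb.le] at h
    linarith
  refine ⟨?_, ?_⟩
  · intro h0
    rw [h0] at hs
    simp at hs
    exact hspos.ne hs
  · rw [hs]
    linarith

end Gain

/-! ### Rate bounds for block-diagonalization -/

section RateBD

variable {K M N : ℕ}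

lemma signal_eq {e : ℕ} (H : Matrix (Fin M) (Fin N) ℂ) (W : Matrix (Fin N) (Fin e) ℂ) :
    H * W * Wᴴ * Hᴴ = (H * W) * (H * W)ᴴ := by
  simp [Matrix.conjTranspose_mul, Matrix.mul_assoc]

lemma posSemidef_sum_signal {e : ℕ} (T : Finset (Fin K)) (H : Matrix (Fin M) (Fin N) ℂ)
    (W : Fin K → Matrix (Fin N) (Fin e) ℂ) {p : ℝ} (hp : 0 ≤ p) :
    (∑ l ∈ T, (p : ℂ) • (H * W l * (W l)ᴴ * Hᴴ)).PosSemidef := by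
  refine Matrix.posSemidef_sum _ fun l _ => ?_
  rw [signal_eq]
  exact (Matrix.posSemidef_self_mul_conjTranspose _).smul (by exact_mod_cast hp)

lemma trace_sum_signal {e : ℕ} (T : Finset (Fin K)) (H : Matrix (Fin M) (Fin N) ℂ)
    (W : Fin K → Matrix (Fin N) (Fin e) ℂ) (p : ℝ) :
    (∑ l ∈ T, (p : ℂ) • (H * W l * (W l)ᴴ * Hᴴ)).trace.re = p * ∑ l ∈ T, frobSq (H * W l) := by
  rw [Matrix.trace_sum, Complex.re_sum, Finset.mul_sum]
  refine Finset.sum_congr rfl fun l _ => ?_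
  rw [signal_eq, Matrix.trace_smul, trace_mul_conjTranspose_self, smul_eq_mul, ← Complex.ofReal_mul,
    Complex.ofReal_re]

lemma smul_signal_eq {e : ℕ} (H : Matrix (Fin M) (Fin N) ℂ) (W : Matrix (Fin N) (Fin e) ℂ) {p : ℝ}
    (hp : 0 ≤ p) : (p : ℂ) • (H * W * Wᴴ * Hᴴ) =
      (((√p : ℝ) : ℂ) • (H * W)) * (((√p : ℝ) : ℂ) • (H * W))ᴴ := by
  rw [signal_eq, Matrix.conjTranspose_smul, Matrix.smul_mul, Matrix.mul_smul, smul_smul,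
    show ∀ r : ℝ, star (r : ℂ) = (r : ℂ) from Complex.conj_ofReal, ← Complex.ofReal_mul,
    Real.mul_self_sqrt hp]

variable {S : Finset (Fin K)} {P : ℝ} {H : Matrix (Fin M) (Fin N) ℂ}
  {W : Fin K → Matrix (Fin N) (Fin M) ℂ} {k : Fin K}

lemma det_interference_le (hk : k ∈ S) {p : ℝ} (hp : 0 ≤ p) :
    (1 + ∑ l ∈ S.erase k, (p : ℂ) • (H * W l * (W l)ᴴ * Hᴴ)).det.re ≤
      (1 + ∑ l ∈ S, (p : ℂ) • (H * W l * (W l)ᴴ * Hᴴ)).det.re := by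
  have h := det_add_le_of_posSemidef (posSemidef_sum_signal (S.erase k) H W hp)
    (((√p : ℝ) : ℂ) • (H * W k))
  rwa [← smul_signal_eq H (W k) hp, add_assoc, Finset.sum_erase_add _ _ hk] at h

lemma rateBD_nonneg (hk : k ∈ S) (hP : 0 ≤ P) : 0 ≤ rateBD S P H W k := by
  have hp : 0 ≤ P / (M * S.card) := by positivity
  have h1 := one_le_det_one_add (posSemidef_sum_signal (S.erase k) H W hp)
  apply Real.logb_nonneg one_lt_two
  rw [le_div_iff₀ (by linarith), one_mul]
  exact det_interference_le hk hp

lemma rateBD_le_logb (hP : 0 ≤ P) : rateBD S P H W k ≤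
    Real.log (1 + ∑ l ∈ S, ((P / (M * S.card) : ℝ) : ℂ) • (H * W l * (W l)ᴴ * Hᴴ)).det.re /
      Real.log 2 := by
  have hp : 0 ≤ P / (M * S.card) := by positivity
  have h1 := one_le_det_one_add (posSemidef_sum_signal (S.erase k) H W hp)
  have h2 := one_le_det_one_add (posSemidef_sum_signal S H W hp)
  have hl2 : 0 < Real.log 2 := Real.log_pos one_lt_two
  rw [rateBD, Real.logb]
  refine div_le_div_of_nonneg_right (Real.log_le_log ?_ ?_) hl2.le
  · exact div_pos (by linarith) (by linarith)
  · exact div_le_self (by linarith) h1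

lemma rateBD_le (hP : 0 ≤ P) :
    rateBD S P H W k ≤ P / (M * S.card) * ∑ l ∈ S, frobSq (H * W l) / Real.log 2 := by
  have hp : 0 ≤ P / (M * S.card) := by positivity
  have hl2 : 0 < Real.log 2 := Real.log_pos one_lt_two
  have h1 := det_one_add_le_exp (posSemidef_sum_signal S H W hp)
  have h2 := one_le_det_one_add (posSemidef_sum_signal S H W hp)
  refine (rateBD_le_logb hP).trans ?_
  rw [← Finset.sum_div, ← mul_div_assoc]
  gcongr
  have h3 := Real.log_le_log (by linarith) h1
  rwa [Real.log_exp, trace_sum_signal] at h3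

lemma rateBD_le_of_one_le (hP : 1 ≤ P) :
    rateBD S P H W k ≤ M * Real.logb 2 P +
      1 / (M * S.card) * ∑ l ∈ S, frobSq (H * W l) / Real.log 2 := by
  have hP0 : 0 ≤ P := by linarith
  have hp : (0 : ℝ) ≤ 1 / (M * S.card) := by positivity
  have hl2 : 0 < Real.log 2 := Real.log_pos one_lt_two
  have h1 := det_one_add_le_exp (posSemidef_sum_signal S H W hp)
  have h2 := one_le_det_one_add (posSemidef_sum_signal S H W hp)
  have h3 := det_one_add_smul_le (posSemidef_sum_signal S H W hp) hP
  have h4 : (P : ℂ) • ∑ l ∈ S, ((1 / (M * S.card) : ℝ) : ℂ) • (H * W l * (W l)ᴴ * Hᴴ) =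
      ∑ l ∈ S, ((P / (M * S.card) : ℝ) : ℂ) • (H * W l * (W l)ᴴ * Hᴴ) := by
    rw [Finset.smul_sum]
    refine Finset.sum_congr rfl fun l _ => ?_
    rw [smul_smul, ← Complex.ofReal_mul, mul_one_div]
  rw [h4, Fintype.card_fin] at h3
  have h5 := one_le_det_one_add (posSemidef_sum_signal S H W
    (show (0 : ℝ) ≤ P / (M * S.card) by positivity))
  refine (rateBD_le_logb hP0).trans ?_
  rw [← Finset.sum_div, ← mul_div_assoc, Real.logb, ← mul_div_assoc, ← add_div]
  gcongr
  have h6 := Real.log_le_log (by linarith) h3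
  rw [Real.log_mul (by positivity) (by linarith), Real.log_pow] at h6
  have h7 := Real.log_le_log (by linarith) h1
  rw [Real.log_exp, trace_sum_signal] at h7
  linarith

/-- The numerator is reduced to the own signal without noise; in the denominator `det (1 + Y) ≤ exp
(tr Y)` makes the loss linear in the leakage. -/
lemma rateBD_ge (hk : k ∈ S) (hM : 0 < M) (hP : 0 < P) (hdet : (H * W k).det ≠ 0) :
    (M * Real.log (P / (M * S.card)) + 2 * Real.log ‖(H * W k).det‖ -
      P / (M * S.card) * ∑ l ∈ S.erase k, frobSq (H * W l)) / Real.log 2 ≤ rateBD S P H W k := by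
  have hS : 0 < S.card := Finset.card_pos.2 ⟨k, hk⟩
  have hp : 0 < P / (M * S.card) := by positivity
  set p := P / (M * S.card) with hpdef
  have hl2 : 0 < Real.log 2 := Real.log_pos one_lt_two
  have h1 := one_le_det_one_add (posSemidef_sum_signal (S.erase k) H W hp.le)
  have h2 := det_one_add_le_exp (posSemidef_sum_signal (S.erase k) H W hp.le)
  have h3 : p ^ M * ‖(H * W k).det‖ ^ 2 ≤
      (1 + ∑ l ∈ S, (p : ℂ) • (H * W l * (W l)ᴴ * Hᴴ)).det.re := by
    have hps := posSemidef_sum_signal {k} H W hp.le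
    rw [Finset.sum_singleton] at hps
    have h4 := det_le_det_one_add hps
    rw [smul_signal_eq H (W k) hp.le, re_det_mul_conjTranspose, Matrix.det_smul, norm_mul, norm_pow,
      Complex.norm_real, Real.norm_of_nonneg (Real.sqrt_nonneg p), Fintype.card_fin, mul_pow,
      ← pow_mul, mul_comm M 2, pow_mul, Real.sq_sqrt hp.le, ← smul_signal_eq H (W k) hp.le] at h4
    refine h4.trans ?_
    -- Adding the co-users one at a time only increases the determinant.
    have hind : ∀ T : Finset (Fin K), k ∉ T →
        (1 + (p : ℂ) • (H * W k * (W k)ᴴ * Hᴴ)).det.re ≤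
        (1 + ((p : ℂ) • (H * W k * (W k)ᴴ * Hᴴ) +
          ∑ l ∈ T, (p : ℂ) • (H * W l * (W l)ᴴ * Hᴴ))).det.re := by
      intro T
      induction T using Finset.induction_on with
      | empty => intro _; simp
      | insert a T ha ih =>
        intro hkT
        have hkT' : k ∉ T := fun h => hkT (Finset.mem_insert_of_mem h)
        refine (ih hkT').trans ?_
        have h := det_add_le_of_posSemidef (hps.add (posSemidef_sum_signal T H W hp.le))
          (((√p : ℝ) : ℂ) • (H * W a))
        rw [← smul_signal_eq H (W a) hp.le] at h
        refine h.trans_eq ?_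
        rw [Finset.sum_insert ha]
        congr 2
        abel
    have := hind (S.erase k) (Finset.notMem_erase k S)
    rwa [Finset.add_sum_erase S (fun l => (p : ℂ) • (H * W l * (W l)ᴴ * Hᴴ)) hk] at this
  have hdpos : 0 < ‖(H * W k).det‖ := norm_pos_iff.2 hdet
  rw [rateBD, Real.logb]
  gcongr
  rw [Real.log_div (lt_of_lt_of_le (by positivity) h3).ne' (by linarith)]
  have h4 := Real.log_le_log (by positivity) h3
  rw [Real.log_mul (by positivity) (by positivity), Real.log_pow, Real.log_pow] at h4
  have h5 := Real.log_le_log (by linarith) h2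
  rw [Real.log_exp, trace_sum_signal] at h5
  push_cast at h4
  linarith

end RateBD

/-! ### Rate bounds for zero-forcing with combining -/

section RateZFC

variable {K M N : ℕ} {S : Finset (Fin K)} {P : ℝ} {H : Matrix (Fin M) (Fin N) ℂ}
  {c : Matrix (Fin M) (Fin 1) ℂ} {w : Fin K → Matrix (Fin N) (Fin 1) ℂ} {k : Fin K}

lemma rateZFC_nonneg (hP : 0 ≤ P) : 0 ≤ rateZFC S P H c w k := by
  apply Real.logb_nonneg one_lt_two
  have : 0 ≤ (P / S.card) * ‖(cᴴ * H * w k) 0 0‖ ^ 2 /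
    (1 + ∑ l ∈ S.erase k, (P / S.card) * ‖(cᴴ * H * w l) 0 0‖ ^ 2) := by positivity
  linarith

lemma rateZFC_le_log (hP : 0 ≤ P) : rateZFC S P H c w k ≤
    Real.log (1 + P / S.card * ‖(cᴴ * H * w k) 0 0‖ ^ 2) / Real.log 2 := by
  have hl2 : 0 < Real.log 2 := Real.log_pos one_lt_two
  have h : 0 ≤ ∑ l ∈ S.erase k, (P / S.card) * ‖(cᴴ * H * w l) 0 0‖ ^ 2 := by positivity
  rw [rateZFC, Real.logb]
  gcongr
  exact div_le_self (by positivity) (by linarith)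

lemma rateZFC_le (hP : 0 ≤ P) :
    rateZFC S P H c w k ≤ P / S.card * ‖(cᴴ * H * w k) 0 0‖ ^ 2 / Real.log 2 := by
  have hl2 : 0 < Real.log 2 := Real.log_pos one_lt_two
  refine (rateZFC_le_log hP).trans ?_
  gcongr
  have h : 0 ≤ P / S.card * ‖(cᴴ * H * w k) 0 0‖ ^ 2 := by positivity
  have := Real.log_le_sub_one_of_pos (show 0 < 1 + P / S.card * ‖(cᴴ * H * w k) 0 0‖ ^ 2 by linarith)
  linarith

lemma rateZFC_le_of_one_le (hP : 1 ≤ P) :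
    rateZFC S P H c w k ≤
      Real.logb 2 P + 1 / S.card * ‖(cᴴ * H * w k) 0 0‖ ^ 2 / Real.log 2 := by
  have hl2 : 0 < Real.log 2 := Real.log_pos one_lt_two
  refine (rateZFC_le_log (by linarith)).trans ?_
  rw [Real.logb, ← add_div]
  gcongr
  have h : (0 : ℝ) ≤ 1 / S.card * ‖(cᴴ * H * w k) 0 0‖ ^ 2 := by positivity
  have h1 : 1 + P / S.card * ‖(cᴴ * H * w k) 0 0‖ ^ 2 ≤
      P * (1 + 1 / S.card * ‖(cᴴ * H * w k) 0 0‖ ^ 2) := by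
    have : P / S.card * ‖(cᴴ * H * w k) 0 0‖ ^ 2 =
        P * (1 / S.card * ‖(cᴴ * H * w k) 0 0‖ ^ 2) := by ring
    rw [this]; linarith
  have h0 : 0 ≤ P / S.card * ‖(cᴴ * H * w k) 0 0‖ ^ 2 := by positivity
  have h2 := Real.log_le_log (by linarith) h1
  rw [Real.log_mul (by linarith) (by linarith)] at h2
  have := Real.log_le_sub_one_of_pos
    (show 0 < 1 + 1 / S.card * ‖(cᴴ * H * w k) 0 0‖ ^ 2 by linarith)
  linarith

lemma rateZFC_ge (hk : k ∈ S) (hP : 0 < P) (hs : (cᴴ * H * w k) 0 0 ≠ 0) :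
    (Real.log (P / S.card) + Real.log (‖(cᴴ * H * w k) 0 0‖ ^ 2) -
      P / S.card * ∑ l ∈ S.erase k, ‖(cᴴ * H * w l) 0 0‖ ^ 2) / Real.log 2 ≤
      rateZFC S P H c w k := by
  have hl2 : 0 < Real.log 2 := Real.log_pos one_lt_two
  have hS : 0 < S.card := Finset.card_pos.2 ⟨k, hk⟩
  have hp : 0 < P / S.card := by positivity
  have hs' : 0 < ‖(cᴴ * H * w k) 0 0‖ := norm_pos_iff.2 hs
  have hI : 0 ≤ ∑ l ∈ S.erase k, (P / S.card) * ‖(cᴴ * H * w l) 0 0‖ ^ 2 := by positivity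
  rw [rateZFC, Real.logb, Finset.mul_sum]
  gcongr
  set I := ∑ l ∈ S.erase k, (P / S.card) * ‖(cᴴ * H * w l) 0 0‖ ^ 2 with hIdef
  have h1 : P / S.card * ‖(cᴴ * H * w k) 0 0‖ ^ 2 / (1 + I) ≤
      1 + P / S.card * ‖(cᴴ * H * w k) 0 0‖ ^ 2 / (1 + I) := by linarith
  have h2 := Real.log_le_log (by positivity) h1
  rw [Real.log_div (by positivity) (by linarith), Real.log_mul hp.ne' (by positivity)] at h2
  have h3 := Real.log_le_sub_one_of_pos (show 0 < 1 + I by linarith)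
  linarith

lemma norm_combined_sq_le (hc : IsSemiUnitary c) {v : Matrix (Fin N) (Fin 1) ℂ}
    (hv : IsSemiUnitary v) : ‖(cᴴ * H * v) 0 0‖ ^ 2 ≤ frobSq H := by
  rw [← frobSq_fin_one, Matrix.mul_assoc]
  have h1 := frobSq_mul_le cᴴ (H * v)
  have h2 := frobSq_mul_le H v
  rw [frobSq_conjTranspose, frobSq_of_semiUnitary hc] at h1
  rw [frobSq_of_semiUnitary hv] at h2
  simp only [Fintype.card_fin, Nat.cast_one, mul_one, one_mul] at h1 h2
  exact h1.trans h2

end RateZFC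

/-! ### Feedback bits against power -/

section Scaling

/-- Since `d s = N`, each user gets `d (N - M) log₂ P + O(1)` bits, so the distortion `2 ^ (-B / (d
(N - M)))` is of order `1/P`. Only the lower half of the `O(1)` is needed. -/
lemma ScalesAs.exists_bound {N M d s : ℕ} (hM : M < N) (hd : d * s = N) {B : ℝ → ℕ}
    (hB : ScalesAs (fun P => ((s * B P : ℕ) : ℝ)) ((N : ℝ) * ((N : ℝ) - M))) :
    ∃ C : ℝ, 0 < C ∧ ∀ᶠ P in atTop,
      P * ((2 ^ B P : ℕ) : ℝ) ^ (-1 / ((d * (N - M) : ℕ) : ℝ)) ≤ C := by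
  obtain ⟨c, hc⟩ := hB.bound
  have hN : 0 < N := by omega
  have hs : 0 < s := Nat.pos_of_ne_zero (by rintro rfl; simp at hd; omega)
  have hd0 : 0 < d := Nat.pos_of_ne_zero (by rintro rfl; simp at hd; omega)
  set T : ℕ := d * (N - M) with hT
  have hT0 : 0 < T := Nat.mul_pos hd0 (by omega)
  have hTr : (0 : ℝ) < T := by exact_mod_cast hT0
  have hsr : (0 : ℝ) < s := by exact_mod_cast hs
  have hTN : (s : ℝ) * T = (N : ℝ) * ((N : ℝ) - M) := by
    rw [hT, ← hd]
    push_cast [Nat.cast_sub (show M ≤ d * s by omega)]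
    ring
  refine ⟨(2 : ℝ) ^ (c / (s * T)), by positivity, ?_⟩
  filter_upwards [hc, eventually_gt_atTop 0] with P hP hP0
  simp only [norm_one, mul_one, Real.norm_eq_abs] at hP
  rw [← hTN] at hP
  have h1 := (abs_le.1 hP).1
  push_cast at h1
  have h2 : Real.logb 2 P - c / (s * T) ≤ B P / T := by
    rw [sub_le_iff_le_add, ← sub_le_iff_le_add', le_div_iff₀ (by positivity), sub_mul]
    have : (B P : ℝ) / T * (s * T) = s * B P := by field_simp
    rw [this]
    linarith
  have h3 : ((2 ^ B P : ℕ) : ℝ) ^ (-1 / (T : ℝ)) = (2 : ℝ) ^ (-((B P : ℝ) / T)) := by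
    push_cast
    rw [← Real.rpow_natCast, ← Real.rpow_mul (by norm_num)]
    congr 1
    ring
  calc P * ((2 ^ B P : ℕ) : ℝ) ^ (-1 / (T : ℝ))
      ≤ (2 : ℝ) ^ (Real.logb 2 P) * (2 : ℝ) ^ (-(Real.logb 2 P - c / (s * T))) := by
        rw [h3, Real.rpow_logb (by norm_num) (by norm_num) hP0]
        gcongr
        norm_num
    _ = (2 : ℝ) ^ (c / (s * T)) := by
        rw [← Real.rpow_add (by norm_num)]
        congr 1
        ring

end Scaling

/-! ### From rate bounds to multiplexing gain -/

section Gain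

variable {Ω : Type*} [MeasurableSpace Ω] {μ : Measure Ω} [IsProbabilityMeasure μ] {K : ℕ}

lemma integrable_of_lintegral_le {L : Ω → ℝ} (hm : Measurable L) (h0 : ∀ᵐ ω ∂μ, 0 ≤ L ω) {C : ℝ≥0∞}
    (hC : C ≠ ⊤) (h : ∫⁻ ω, ENNReal.ofReal (L ω) ∂μ ≤ C) :
    Integrable L μ ∧ ∫ ω, L ω ∂μ ≤ C.toReal := by
  have hfin : ∫⁻ ω, ENNReal.ofReal (L ω) ∂μ ≠ ⊤ := ne_top_of_le_ne_top hC h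
  refine ⟨?_, ?_⟩
  · exact (lintegral_ofReal_ne_top_iff_integrable hm.aestronglyMeasurable
      h0).1 hfin
  · rw [integral_eq_lintegral_of_nonneg_ae h0 hm.aestronglyMeasurable]
    exact ENNReal.toReal_mono hC h

/-- Two-sided bounds of the rates of the individual users give the multiplexing gain. -/
lemma achievesMultiplexingGain_of_bounds {S : Finset (Fin K)} {d N : ℕ} (hS : d * S.card = N)
    {g : Fin K → ℝ → Ω → ℝ} {Z : Fin K → Ω → ℝ}
    (hm : ∀ k ∈ S, ∀ P, 0 < P → Measurable (g k P))
    (h0 : ∀ k ∈ S, ∀ P, 0 < P → ∀ ω, 0 ≤ g k P ω) (hZ : ∀ k ∈ S, Integrable (Z k) μ)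
    (hub : ∀ k ∈ S, ∀ P, 0 < P → ∀ ω, g k P ω ≤ P * Z k ω)
    (hub' : ∀ k ∈ S, ∀ P, 1 ≤ P → ∀ ω, g k P ω ≤ d * Real.logb 2 P + Z k ω)
    (hlb : ∀ k ∈ S, ∃ C, ∀ᶠ P in atTop, d * Real.logb 2 P - C ≤ ∫ ω, g k P ω ∂μ) :
    AchievesMultiplexingGain μ (fun P ω => ∑ k ∈ S, g k P ω) N := by
  -- The crude bound, linear in `P`, gives integrability at every power; the logarithmic one, for `P
  -- ≥ 1`, is reserved for the asymptotics.
  have hint : ∀ k ∈ S, ∀ P, 0 < P → Integrable (g k P) μ := by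
    intro k hk P hP
    refine Integrable.mono' ((hZ k hk).const_mul P) (hm k hk P hP).aestronglyMeasurable
      (Eventually.of_forall fun ω => ?_)
    rw [Real.norm_of_nonneg (h0 k hk P hP ω)]
    exact hub k hk P hP ω
  choose! C hC using hlb
  have hbound : (fun P => (∫ ω, ∑ k ∈ S, g k P ω ∂μ) - N * Real.logb 2 P) =O[atTop]
      (fun _ => (1 : ℝ)) := by
    have hone : ∀ k ∈ S, (fun P => (∫ ω, g k P ω ∂μ) - d * Real.logb 2 P) =O[atTop]
        (fun _ => (1 : ℝ)) := by
      intro k hk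
      refine Asymptotics.IsBigO.of_bound (max |C k| |∫ ω, Z k ω ∂μ|) ?_
      filter_upwards [hC k hk, eventually_ge_atTop 1] with P hP hP1
      have h2 : ∫ ω, g k P ω ∂μ ≤ d * Real.logb 2 P + ∫ ω, Z k ω ∂μ := by
        have h3 := integral_mono (hint k hk P (by linarith))
          ((integrable_const (d * Real.logb 2 P)).add (hZ k hk)) (hub' k hk P hP1)
        simp only [Pi.add_apply] at h3
        rw [integral_add (integrable_const _) (hZ k hk)] at h3
        simpa using h3
      rw [norm_one, mul_one, Real.norm_eq_abs, abs_le]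
      constructor
      · have := le_max_left |C k| |∫ ω, Z k ω ∂μ|
        have := le_abs_self (C k)
        linarith
      · have := le_max_right |C k| |∫ ω, Z k ω ∂μ|
        have := le_abs_self (∫ ω, Z k ω ∂μ)
        linarith
    have hsum := Asymptotics.IsBigO.sum hone
    refine hsum.congr' ?_ EventuallyEq.rfl
    filter_upwards [eventually_gt_atTop 0] with P hP
    rw [integral_finsetSum _ fun k hk => hint k hk P hP, Finset.sum_apply, Finset.sum_sub_distrib, Finset.sum_const,
      nsmul_eq_mul, ← hS]
    push_cast
    ring
  have hlog : Tendsto (fun P : ℝ => Real.logb 2 P) atTop atTop :=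
    Real.tendsto_logb_atTop (by norm_num)
  refine ⟨fun P hP => integrable_finsetSum _ fun k hk => hint k hk P hP, hbound, ?_⟩
  have ho : Tendsto (fun P => ((∫ ω, ∑ k ∈ S, g k P ω ∂μ) - N * Real.logb 2 P) / Real.logb 2 P)
      atTop (𝓝 0) := by
    have h1 : (fun P => (∫ ω, ∑ k ∈ S, g k P ω ∂μ) - N * Real.logb 2 P) =o[atTop]
        (fun P : ℝ => Real.logb 2 P) :=
      hbound.trans_isLittleO ((Asymptotics.isLittleO_const_left).2
        (Or.inr (tendsto_norm_atTop_atTop.comp hlog)))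
    exact h1.tendsto_div_nhds_zero
  have h2 := ho.add_const (N : ℝ)
  rw [zero_add] at h2
  refine h2.congr' ?_
  filter_upwards [hlog.eventually_gt_atTop 0] with P hP
  field_simp
  ring

end Gain

/-! ### Integrability and measurability of the rate terms -/

section Users

variable {Ω : Type*} [MeasurableSpace Ω] {μ : Measure Ω} [IsProbabilityMeasure μ] {K M N : ℕ}

lemma det_sqrt_ne_zero {R : Matrix (Fin M) (Fin M) ℂ} (hR : R.PosDef) : (CFC.sqrt R).det ≠ 0 := by
  have h1 : CFC.sqrt R * CFC.sqrt R = R := CFC.sqrt_mul_sqrt_self R hR.posSemidef.nonneg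
  intro h0
  have h2 := congrArg Matrix.det h1
  rw [Matrix.det_mul, h0, zero_mul] at h2
  exact hR.det_pos.ne h2

lemma integrable_inv_norm {x : Ω → ℂ} (hx : Measurable x) {C : ℝ≥0∞} (hC : C ≠ ⊤)
    (h : ∫⁻ ω, ‖x ω‖ₑ⁻¹ ∂μ ≤ C) :
    (∀ᵐ ω ∂μ, x ω ≠ 0) ∧ Integrable (fun ω => ‖x ω‖⁻¹) μ ∧ ∫ ω, ‖x ω‖⁻¹ ∂μ ≤ C.toReal := by
  have hm : Measurable fun ω => ‖x ω‖⁻¹ := hx.norm.inv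
  refine ⟨?_, integrable_of_lintegral_le hm
    (Eventually.of_forall fun ω => by positivity) hC (le_trans (lintegral_mono fun ω => ?_) h)⟩
  · filter_upwards [ae_lt_top hx.enorm.inv (ne_top_of_le_ne_top hC h)] with ω hω h0
    simp [h0] at hω
  · by_cases h0 : x ω = 0
    · simp [h0]
    · rw [ENNReal.ofReal_inv_of_pos (norm_pos_iff.2 h0), ofReal_norm]

/-- Five error terms serve combining: two inverse moments, the channel energy, the alignment loss
and the interference. Block-diagonalization has only two and fills up with zeros. -/
lemma le_integral_of_ae_le {g L₁ L₂ L₃ L₄ L₅ : Ω → ℝ} {a l α₁ α₂ α₃ α₄ α₅ c₁ c₂ c₃ c₄ c₅ : ℝ}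
    (hl : 0 < l) (hg : Integrable g μ) (h₁ : Integrable L₁ μ ∧ ∫ ω, L₁ ω ∂μ ≤ c₁)
    (h₂ : Integrable L₂ μ ∧ ∫ ω, L₂ ω ∂μ ≤ c₂) (h₃ : Integrable L₃ μ ∧ ∫ ω, L₃ ω ∂μ ≤ c₃)
    (h₄ : Integrable L₄ μ ∧ ∫ ω, L₄ ω ∂μ ≤ c₄) (h₅ : Integrable L₅ μ ∧ ∫ ω, L₅ ω ∂μ ≤ c₅)
    (hα₁ : 0 ≤ α₁) (hα₂ : 0 ≤ α₂) (hα₃ : 0 ≤ α₃) (hα₄ : 0 ≤ α₄) (hα₅ : 0 ≤ α₅)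
    (h : ∀ᵐ ω ∂μ, (a - (α₁ * L₁ ω + α₂ * L₂ ω + α₃ * L₃ ω + α₄ * L₄ ω + α₅ * L₅ ω)) / l ≤ g ω) :
    (a - (α₁ * c₁ + α₂ * c₂ + α₃ * c₃ + α₄ * c₄ + α₅ * c₅)) / l ≤ ∫ ω, g ω ∂μ := by
  have i₁ := h₁.1.const_mul α₁
  have i₂ := i₁.add (h₂.1.const_mul α₂)
  have i₃ := i₂.add (h₃.1.const_mul α₃)
  have i₄ := i₃.add (h₄.1.const_mul α₄)
  have i₅ := i₄.add (h₅.1.const_mul α₅)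
  have e : ∫ ω, (a - (α₁ * L₁ ω + α₂ * L₂ ω + α₃ * L₃ ω + α₄ * L₄ ω + α₅ * L₅ ω)) / l ∂μ =
      (a - (α₁ * ∫ ω, L₁ ω ∂μ + α₂ * ∫ ω, L₂ ω ∂μ + α₃ * ∫ ω, L₃ ω ∂μ + α₄ * ∫ ω, L₄ ω ∂μ +
        α₅ * ∫ ω, L₅ ω ∂μ)) / l := by
    rw [integral_div]
    have e1 := integral_sub (integrable_const (μ := μ) a) i₅
    simp only [Pi.add_apply] at e1
    have e2 := integral_add i₄ (h₅.1.const_mul α₅)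
    have e3 := integral_add i₃ (h₄.1.const_mul α₄)
    have e4 := integral_add i₂ (h₃.1.const_mul α₃)
    have e5 := integral_add i₁ (h₂.1.const_mul α₂)
    simp only [Pi.add_apply] at e2 e3 e4 e5
    rw [e1, e2, e3, e4, e5]
    simp [integral_const_mul]
  have hle := integral_mono_ae (((integrable_const (μ := μ) a).sub i₅).div_const l) hg h
  refine le_trans ?_ hle
  refine le_trans ?_ (le_of_eq e.symm)
  have b₁ := mul_le_mul_of_nonneg_left h₁.2 hα₁
  have b₂ := mul_le_mul_of_nonneg_left h₂.2 hα₂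
  have b₃ := mul_le_mul_of_nonneg_left h₃.2 hα₃
  have b₄ := mul_le_mul_of_nonneg_left h₄.2 hα₄
  have b₅ := mul_le_mul_of_nonneg_left h₅.2 hα₅
  refine div_le_div_of_nonneg_right ?_ hl.le
  linarith

lemma measurable_det_re_signal {T : Finset (Fin K)} {e : ℕ} {H : Ω → Matrix (Fin M) (Fin N) ℂ}
    (hH : Measurable H) {W : Fin K → Ω → Matrix (Fin N) (Fin e) ℂ}
    (hW : ∀ l ∈ T, Measurable (W l)) (p : ℂ) :
    Measurable fun ω => (1 + ∑ l ∈ T, p • (H ω * W l ω * (W l ω)ᴴ * (H ω)ᴴ)).det.re := by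
  have hs : Measurable fun ω => ∑ l ∈ T, p • (H ω * W l ω * (W l ω)ᴴ * (H ω)ᴴ) := by
    refine Finset.measurable_sum _ fun l hl => ?_
    have h1 : Measurable fun ω => H ω * W l ω * (W l ω)ᴴ * (H ω)ᴴ :=
      ((hH.matrixMul (hW l hl)).matrixMul (hW l hl).matrixConjTranspose).matrixMul
        hH.matrixConjTranspose
    exact measurable_pi_lambda _ fun i => measurable_pi_lambda _ fun j =>
      (h1.matrixElem i j).const_mul p
  have hc : Measurable fun Y : Matrix (Fin M) (Fin M) ℂ => (1 + Y).det.re :=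
    (Complex.continuous_re.comp (continuous_const.add continuous_id).matrix_det).measurable
  exact hc.comp hs

lemma measurable_rateBD {S : Finset (Fin K)} (P : ℝ) {H : Ω → Matrix (Fin M) (Fin N) ℂ}
    (hH : Measurable H) {W : Fin K → Ω → Matrix (Fin N) (Fin M) ℂ}
    (hW : ∀ l ∈ S, Measurable (W l)) (k : Fin K) :
    Measurable fun ω => rateBD S P (H ω) (fun l => W l ω) k := by
  have h1 := measurable_det_re_signal hH hW ((P / (M * S.card) : ℝ) : ℂ)
  have h2 := measurable_det_re_signal hH (fun l hl => hW l (Finset.mem_of_mem_erase hl))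
    ((P / (M * S.card) : ℝ) : ℂ) (T := S.erase k)
  exact (Real.measurable_log.comp (h1.div h2)).div_const _

lemma measurable_rateZFC {S : Finset (Fin K)} (P : ℝ) {H : Ω → Matrix (Fin M) (Fin N) ℂ}
    (hH : Measurable H) {c : Ω → Matrix (Fin M) (Fin 1) ℂ} (hc : Measurable c)
    {w : Fin K → Ω → Matrix (Fin N) (Fin 1) ℂ}
    (hw : ∀ l ∈ S, Measurable (w l)) {k : Fin K} (hk : k ∈ S) :
    Measurable fun ω => rateZFC S P (H ω) (c ω) (fun l => w l ω) k := by
  have h1 : ∀ l ∈ S, Measurable fun ω => (P / S.card) * ‖((c ω)ᴴ * H ω * w l ω) 0 0‖ ^ 2 :=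
    fun l hl => ((((hc.matrixConjTranspose.matrixMul hH).matrixMul (hw l hl)).matrixElem
      0 0).norm.pow_const 2).const_mul _
  have h2 : Measurable fun ω => ∑ l ∈ S.erase k,
      (P / S.card) * ‖((c ω)ᴴ * H ω * w l ω) 0 0‖ ^ 2 :=
    Finset.measurable_sum _ fun l hl => h1 l (Finset.mem_of_mem_erase hl)
  exact (Real.measurable_log.comp (((h1 k hk).div (h2.const_add 1)).const_add 1)).div_const _

variable {Ht : Fin K → Ω → Matrix (Fin M) (Fin N) ℂ}

/-- Lets the determinant moment bound, for `1 × 1` matrices, be applied to one entry of `G w`. -/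
lemma IsRayleighFading.row (hHt : IsRayleighFading μ Ht) (i : Fin M) :
    IsRayleighFading μ fun k ω => (Ht k ω).submatrix (fun _ : Fin 1 => i) id where
  measurable k := measurable_pi_lambda _ fun _ => measurable_pi_lambda _ fun j =>
    (hHt.measurable k).matrixElem i j
  law k _ j := hHt.law k i j
  indep := hHt.indep.precomp (g := fun p : Fin K × Fin 1 × Fin N => (p.1, i, p.2.2)) (by
    rintro ⟨k, a, j⟩ ⟨k', a', j'⟩ h
    simp only [Prod.mk.injEq] at h
    simp [h.1, h.2.2, Subsingleton.elim a a'])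

/-- The interference terms are integrable, with an integral that decays with the codebook size. -/
lemma integrable_interference {n d : ℕ} [NeZero n] (hHt : IsRayleighFading μ Ht) (hM : M < N)
    {A : Matrix (Fin M) (Fin M) ℂ} (hA : A.det ≠ 0) (k : Fin K)
    {U : Fin K → Fin n → Ω → Matrix (Fin N) (Fin d) ℂ} (hU : IsRVQ μ Ht U) {C : ℝ}
    (hC : 0 ≤ C)
    (h : ∫⁻ ω, ENNReal.ofReal (frobSq (Ht k ω) *
        ⨅ i, (d - (rowProj (A * Ht k ω) * (U k i ω * (U k i ω)ᴴ)).trace.re)) ∂μ ≤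
        ENNReal.ofReal C) :
    Integrable (fun ω => frobSq (Ht k ω) *
        ⨅ i, (d - (rowProj (A * Ht k ω) * (U k i ω * (U k i ω)ᴴ)).trace.re)) μ ∧
      ∫ ω, frobSq (Ht k ω) *
        ⨅ i, (d - (rowProj (A * Ht k ω) * (U k i ω * (U k i ω)ᴴ)).trace.re) ∂μ ≤ C := by
  obtain ⟨W₀, hW₀⟩ := exists_semiUnitary hM.le
  have hm : Measurable fun ω => frobSq (Ht k ω) *
        ⨅ i, (d - (rowProj (A * Ht k ω) * (U k i ω * (U k i ω)ᴴ)).trace.re) := by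
    refine (measurable_frobSq.comp (hHt.measurable k)).mul (Measurable.iInf fun i =>
      measurable_const.sub (measurable_trace_re.comp ((measurable_rowProj.comp
        (measurable_const.matrixMul (hHt.measurable k))).matrixMul ?_)))
    exact measurable_mul_conjTranspose.comp (hU.measurable k i)
  have h1 := integrable_of_lintegral_le hm (by
    filter_upwards [hHt.ae_det_ne_zero k hA hW₀] with ω hω
    obtain ⟨V, hV, -, -, -, hproj⟩ := exists_rowProj_factor hω
    refine mul_nonneg (frobSq_nonneg _) (le_ciInf fun i => ?_)
    rw [hproj, trace_rowProj_mul]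
    exact sub_frobSq_nonneg (hU.semiUnitary k i ω) hV) ENNReal.ofReal_ne_top h
  rwa [ENNReal.toReal_ofReal hC] at h1

end Users

/-! ### Lower bound of the block-diagonalization rate -/

section BlockDiagonalization

variable {Ω : Type*} [MeasurableSpace Ω] {μ : Measure Ω} [IsProbabilityMeasure μ] {K M N : ℕ}
  {Ht : Fin K → Ω → Matrix (Fin M) (Fin N) ℂ}

lemma measurable_channel (R : Matrix (Fin M) (Fin M) ℂ) :
    Measurable (channel R : Matrix (Fin M) (Fin N) ℂ → _) :=
  measurable_const.matrixMul measurable_id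

/-- The interference leaked to a user under block-diagonalization. -/
lemma IsChordalQuantizer.frobSq_mul_le {n : ℕ} [NeZero n]
    {q : (Fin n → Matrix (Fin N) (Fin M) ℂ) → Matrix (Fin M) (Fin N) ℂ → Fin n}
    (hq : IsChordalQuantizer q) {C : Fin n → Matrix (Fin N) (Fin M) ℂ}
    (hC : ∀ i, IsSemiUnitary (C i)) {A : Matrix (Fin M) (Fin M) ℂ} {G : Matrix (Fin M) (Fin N) ℂ}
    {W₀ : Matrix (Fin N) (Fin M) ℂ} (hdet : (A * G * W₀).det ≠ 0) {e : ℕ}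
    {W : Matrix (Fin N) (Fin e) ℂ} (hW : IsSemiUnitary W) (hort : (C (q C (A * G)))ᴴ * W = 0) :
    frobSq (A * G * W) ≤ frobSq A * (frobSq G *
      ⨅ i, (M - (rowProj (A * G) * (C i * (C i)ᴴ)).trace.re)) := by
  obtain ⟨V, hV, hcol, hH, -, hproj⟩ := exists_rowProj_factor hdet
  have h1 := frobSq_mul_le_chordalDist (A * G) (hC _) hW hort
  have h2 : chordalDist (A * G) (C (q C (A * G))) ^ 2 ≤
      ⨅ i, ((M : ℝ) - (rowProj (A * G) * (C i * (C i)ᴴ)).trace.re) := by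
    refine le_ciInf fun i => ?_
    rw [hproj, trace_rowProj_mul, ← chordalDist_sq (A * G) (hC i) hV hcol hH]
    exact pow_le_pow_left₀ (Real.sqrt_nonneg _) (hq.isMin C (A * G) i) 2
  rw [← mul_assoc]
  exact h1.trans (mul_le_mul (LimitedFeedback.frobSq_mul_le A G) h2 (by positivity)
    (mul_nonneg (frobSq_nonneg _) (frobSq_nonneg _)))

variable {R : Fin K → Matrix (Fin M) (Fin M) ℂ} {S : Finset (Fin K)}
  {U : (b : ℕ) → Fin K → Fin (2 ^ b) → Ω → Matrix (Fin N) (Fin M) ℂ}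
  {q : (b : ℕ) → Fin K → (Fin (2 ^ b) → Matrix (Fin N) (Fin M) ℂ) →
        Matrix (Fin M) (Fin N) ℂ → Fin (2 ^ b)}
  {B : ℝ → ℕ} {W : ℝ → Fin K → Ω → Matrix (Fin N) (Fin M) ℂ}

lemma div_mul_le_mul {P n s x y : ℝ} (hP : 0 ≤ P) (hs : 0 < s) (hsn : s ≤ n) (hx : 0 ≤ x)
    (h : x ≤ s * y) : P / n * x ≤ P * y := by
  calc P / n * x ≤ P / s * x := by gcongr
    _ ≤ P / s * (s * y) := by gcongr
    _ = P * y := by field_simp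

set_option maxHeartbeats 1000000 in
/-- The expected rate of a user under block-diagonalization. -/
lemma exists_le_integral_rateBD (hM : 1 ≤ M) (hMN : M < N) (hR : ∀ k, (R k).PosDef)
    (hHt : IsRayleighFading μ Ht) (hS : M * S.card = N) (hU : ∀ b, IsRVQ μ Ht (U b))
    (hq : ∀ b k, IsChordalQuantizer (q b k))
    (hB : ScalesAs (fun P => ((S.card * B P : ℕ) : ℝ)) ((N : ℝ) * ((N : ℝ) - M)))
    (hW : ∀ P, 0 < P → IsZeroForcingPrecoder S
        (fun k ω => U (B P) k (q (B P) k (fun i => U (B P) k i ω) (channel (R k) (Ht k ω))) ω)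
        (W P)) {k : Fin K} (hk : k ∈ S)
    (hint : ∀ P, 0 < P → Integrable
      (fun ω => rateBD S P (channel (R k) (Ht k ω)) (fun l => W P l ω) k) μ) :
    ∃ C, ∀ᶠ P in atTop, M * Real.logb 2 P - C ≤
      ∫ ω, rateBD S P (channel (R k) (Ht k ω)) (fun l => W P l ω) k ∂μ := by
  have hl2 : 0 < Real.log 2 := Real.log_pos one_lt_two
  have hN : 0 < N := by omega
  have hScard : 0 < S.card := Finset.card_pos.2 ⟨k, hk⟩
  set A := CFC.sqrt (R k) with hAdef
  have hA : A.det ≠ 0 := det_sqrt_ne_zero (hR k)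
  have hf : 0 ≤ frobSq A := frobSq_nonneg A
  obtain ⟨W₀, hW₀⟩ := exists_semiUnitary hMN.le
  obtain ⟨C₁, hC₁, hint₁⟩ := exists_interference_bound (μ := μ) (d := M) hHt hM le_rfl hMN hA k
  obtain ⟨C₂, hC₂, hscale⟩ := hB.exists_bound hMN hS
  set E : ℝ≥0∞ := (negMomentBound * N) ^ M with hE
  have hEtop : E ≠ ⊤ :=
    ENNReal.pow_ne_top (ENNReal.mul_ne_top negMomentBound_ne_top (ENNReal.natCast_ne_top N))
  -- The constant does not involve `P`: `E` and `C₁` are uniform in the precoder and the codebook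
  -- size, and `C₂` bounds `P` times the distortion factor.
  refine ⟨-((-(M * Real.log N) + 2 * Real.log ‖A.det‖ -
    (2 * E.toReal + frobSq A * (C₁ * C₂))) / Real.log 2), ?_⟩
  filter_upwards [hscale, eventually_ge_atTop 1] with P hP hP1
  have hP0 : 0 < P := by linarith
  have hn : NeZero (2 ^ B P) := ⟨by positivity⟩
  have hUP := hU (B P)
  -- The quantizer is regarded as a function of the uncorrelated channel, to which the independence
  -- statements refer.
  let s : Fin K → (Fin (2 ^ B P) → Matrix (Fin N) (Fin M) ℂ) → Matrix (Fin M) (Fin N) ℂ →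
    Fin (2 ^ B P) := fun l C G => q (B P) l C (channel (R l) G)
  have hs : ∀ l, Measurable fun p : (Fin (2 ^ B P) → Matrix (Fin N) (Fin M) ℂ) ×
      Matrix (Fin M) (Fin N) ℂ => s l p.1 p.2 := by
    intro l
    have h1 := (hq (B P) l).measurable.comp
      (measurable_fst.prodMk ((measurable_channel (R l)).comp measurable_snd))
    exact h1
  obtain ⟨O, hO, hOW, hind⟩ := (hW P hP0).exists_indep_projection hHt hUP hs hS hk
  have hxm : Measurable fun ω => (Ht k ω * W P k ω).det :=
    measurable_det.comp ((hHt.measurable k).matrixMul ((hW P hP0).measurable k hk))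
  obtain ⟨hx0, hL₁⟩ := integrable_inv_norm hxm hEtop
    (lintegral_det_mul_le_of_indepFun hN (hHt.measurable k) (hHt.map_eq k) hO
      (hind.comp measurable_fst measurable_id) ((hW P hP0).semiUnitary k hk) hOW)
  have hJ := integrable_interference hHt hMN hA k hUP (by positivity)
    (hint₁ (2 ^ B P) (by positivity) (U (B P)) hUP)
  have h0 : Integrable (fun _ : Ω => (0 : ℝ)) μ ∧ ∫ _ω, (0 : ℝ) ∂μ ≤ 0 :=
    ⟨integrable_zero _ _ _, by simp⟩
  have hmain := le_integral_of_ae_le (a := M * (Real.log P - Real.log N) +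
    2 * Real.log ‖A.det‖) hl2 (hint P hP0) hL₁ hJ h0 h0 h0 (α₁ := 2) (α₂ := P * frobSq A)
    (α₃ := 0) (α₄ := 0) (α₅ := 0) (by norm_num) (by positivity) le_rfl le_rfl le_rfl (by
      filter_upwards [hHt.ae_det_ne_zero k hA hW₀, hx0] with ω hω hxω
      have hdet : (channel (R k) (Ht k ω) * W P k ω).det = A.det * (Ht k ω * W P k ω).det := by
        rw [channel, Matrix.mul_assoc, Matrix.det_mul]
      have hdet0 : (channel (R k) (Ht k ω) * W P k ω).det ≠ 0 := by
        rw [hdet]; exact mul_ne_zero hA hxω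
      refine le_trans ?_ (rateBD_ge hk hM hP0 hdet0)
      have hMS : ((M : ℝ) * S.card) = N := by exact_mod_cast hS
      have hNr : (0 : ℝ) < N := by exact_mod_cast hN
      rw [hdet, norm_mul, Real.log_mul (norm_ne_zero_iff.2 hA) (norm_ne_zero_iff.2 hxω), hMS,
        Real.log_div hP0.ne' hNr.ne']
      have h1 := neg_inv_le_log (norm_pos_iff.2 hxω)
      set J := frobSq (Ht k ω) * ⨅ i, ((M : ℝ) - (rowProj (A * Ht k ω) *
        (U (B P) k i ω * (U (B P) k i ω)ᴴ)).trace.re) with hJdef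
      have h2 : ∀ l ∈ S.erase k, frobSq (channel (R k) (Ht k ω) * W P l ω) ≤ frobSq A * J := by
        intro l hl
        have hlS := Finset.mem_of_mem_erase hl
        exact (hq (B P) k).frobSq_mul_le (C := fun i => U (B P) k i ω)
          (fun i => hUP.semiUnitary k i ω) hω ((hW P hP0).semiUnitary l hlS ω)
          ((hW P hP0).orthogonal l hlS k hk (Finset.ne_of_mem_erase hl).symm ω)
      have h3 : ∑ l ∈ S.erase k, frobSq (channel (R k) (Ht k ω) * W P l ω) ≤
          S.card * (frobSq A * J) := by
        have hJ0 : 0 ≤ frobSq A * J := by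
          obtain ⟨V, hV, -, -, -, hproj⟩ := exists_rowProj_factor hω
          refine mul_nonneg hf (mul_nonneg (frobSq_nonneg _) (le_ciInf fun i => ?_))
          rw [hproj, trace_rowProj_mul]
          exact sub_frobSq_nonneg (hUP.semiUnitary k i ω) hV
        refine (Finset.sum_le_card_nsmul _ _ _ h2).trans ?_
        rw [nsmul_eq_mul]
        refine mul_le_mul_of_nonneg_right ?_ hJ0
        exact_mod_cast Finset.card_le_card (Finset.erase_subset k S)
      have hSN : (S.card : ℝ) ≤ N := by
        have : S.card ≤ N := by rw [← hS]; exact Nat.le_mul_of_pos_left _ hM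
        exact_mod_cast this
      have h4 : P / N * ∑ l ∈ S.erase k, frobSq (channel (R k) (Ht k ω) * W P l ω) ≤
          P * frobSq A * J := by
        have hsum0 : 0 ≤ ∑ l ∈ S.erase k, frobSq (channel (R k) (Ht k ω) * W P l ω) :=
          Finset.sum_nonneg fun l _ => frobSq_nonneg _
        rw [mul_assoc]
        exact div_mul_le_mul hP0.le (by exact_mod_cast hScard) hSN hsum0 h3
      refine div_le_div_of_nonneg_right ?_ hl2.le
      linarith)
  refine le_trans ?_ hmain
  rw [sub_neg_eq_add, Real.logb, ← mul_div_assoc, ← add_div]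
  refine div_le_div_of_nonneg_right ?_ hl2.le
  have h5 : P * frobSq A * (C₁ * ((2 ^ B P : ℕ) : ℝ) ^ (-1 / ((M * (N - M) : ℕ) : ℝ))) ≤
      frobSq A * (C₁ * C₂) := by
    have : P * frobSq A * (C₁ * ((2 ^ B P : ℕ) : ℝ) ^ (-1 / ((M * (N - M) : ℕ) : ℝ))) =
        frobSq A * (C₁ * (P * ((2 ^ B P : ℕ) : ℝ) ^ (-1 / ((M * (N - M) : ℕ) : ℝ)))) := by ring
    rw [this]
    gcongr
  linarith

end BlockDiagonalization

/-! ### Lower bound of the rate with combining -/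

section Combining

variable {Ω : Type*} [MeasurableSpace Ω] {μ : Measure Ω} [IsProbabilityMeasure μ] {K M N : ℕ}
  {Ht : Fin K → Ω → Matrix (Fin M) (Fin N) ℂ}

/-- The interference leaked to a user under zero-forcing with combining. -/
lemma IsQBC.norm_sq_le {n : ℕ} [NeZero n]
    {q : (Fin n → Matrix (Fin N) (Fin 1) ℂ) → Matrix (Fin M) (Fin N) ℂ →
      Matrix (Fin M) (Fin 1) ℂ × Fin n}
    (hq : IsQBC q) {C : Fin n → Matrix (Fin N) (Fin 1) ℂ}
    (hC : ∀ i, IsSemiUnitary (C i)) {A : Matrix (Fin M) (Fin M) ℂ} {G : Matrix (Fin M) (Fin N) ℂ}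
    {W₀ : Matrix (Fin N) (Fin M) ℂ} (hdet : (A * G * W₀).det ≠ 0)
    {w : Matrix (Fin N) (Fin 1) ℂ} (hw : IsSemiUnitary w)
    (hort : (C (q C (A * G)).2)ᴴ * w = 0) :
    ‖((q C (A * G)).1ᴴ * (A * G) * w) 0 0‖ ^ 2 ≤ frobSq A * (frobSq G *
      ⨅ i, (((1 : ℕ) : ℝ) - (rowProj (A * G) * (C i * (C i)ᴴ)).trace.re)) := by
  obtain ⟨V, hV, -, hH, hHV, hproj⟩ := exists_rowProj_factor hdet
  have h1 := frobSq_mul_le_chordalDist ((q C (A * G)).1ᴴ * (A * G)) (hC _) hw hort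
  have h2 : chordalDist ((q C (A * G)).1ᴴ * (A * G)) (C (q C (A * G)).2) ^ 2 ≤
      ⨅ i, (((1 : ℕ) : ℝ) - (rowProj (A * G) * (C i * (C i)ᴴ)).trace.re) := by
    refine le_ciInf fun i => ?_
    rw [hproj, trace_rowProj_mul, Nat.cast_one]
    exact hq.chordalDist_sq_le hC hV hH hHV i
  have h3 : frobSq ((q C (A * G)).1ᴴ * (A * G)) ≤ frobSq A * frobSq G := by
    have h4 := frobSq_mul_le (q C (A * G)).1ᴴ (A * G)
    rw [frobSq_conjTranspose, frobSq_of_semiUnitary (hq.unit C (A * G))] at h4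
    simp only [Fintype.card_fin, Nat.cast_one, one_mul] at h4
    exact h4.trans (frobSq_mul_le A G)
  rw [← mul_assoc, ← frobSq_fin_one]
  exact h1.trans (mul_le_mul h3 h2 (by positivity)
    (mul_nonneg (frobSq_nonneg _) (frobSq_nonneg _)))

/-- The negative moments of the determinants of correlated channels. -/
lemma IsRayleighFading.lintegral_det_le (hHt : IsRayleighFading μ Ht) (hN : 0 < N) (k : Fin K)
    (A : Matrix (Fin M) (Fin M) ℂ) {W : Matrix (Fin N) (Fin M) ℂ}
    (hW : IsSemiUnitary W) :
    ∫⁻ ω, ‖(A * Ht k ω * W).det‖ₑ⁻¹ ∂μ ≤ ‖A.det‖ₑ⁻¹ * (negMomentBound * N) ^ M := by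
  have hm : Measurable fun g : Matrix (Fin M) (Fin N) ℂ => ‖(g * W).det‖ₑ⁻¹ :=
    (measurable_det.comp (measurable_id.matrixMul measurable_const)).enorm.inv
  have h3 := lintegral_map (μ := μ) hm (hHt.measurable k)
  rw [hHt.map_eq] at h3
  have h4 := lintegral_det_mul_le hN M W hW
  rw [h3] at h4
  calc ∫⁻ ω, ‖(A * Ht k ω * W).det‖ₑ⁻¹ ∂μ = ∫⁻ ω, ‖A.det‖ₑ⁻¹ * ‖(Ht k ω * W).det‖ₑ⁻¹ ∂μ := by
        refine lintegral_congr fun ω => ?_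
        rw [Matrix.mul_assoc, Matrix.det_mul, enorm_mul,
          ENNReal.mul_inv (Or.inr enorm_ne_top) (Or.inl enorm_ne_top)]
    _ = ‖A.det‖ₑ⁻¹ * ∫⁻ ω, ‖(Ht k ω * W).det‖ₑ⁻¹ ∂μ :=
        lintegral_const_mul _ (hm.comp (hHt.measurable k))
    _ ≤ _ := by gcongr

variable {R : Fin K → Matrix (Fin M) (Fin M) ℂ} {S : Finset (Fin K)}
  {U : (b : ℕ) → Fin K → Fin (2 ^ b) → Ω → Matrix (Fin N) (Fin 1) ℂ}
  {q : (b : ℕ) → Fin K → (Fin (2 ^ b) → Matrix (Fin N) (Fin 1) ℂ) →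
        Matrix (Fin M) (Fin N) ℂ → Matrix (Fin M) (Fin 1) ℂ × Fin (2 ^ b)}
  {B : ℝ → ℕ} {w : ℝ → Fin K → Ω → Matrix (Fin N) (Fin 1) ℂ}

set_option maxHeartbeats 2000000 in
/-- The expected rate of a user under zero-forcing with combining. -/
lemma exists_le_integral_rateZFC (hM : 1 ≤ M) (hMN : M < N) (hR : ∀ k, (R k).PosDef)
    (hHt : IsRayleighFading μ Ht) (hS : S.card = N) (hU : ∀ b, IsRVQ μ Ht (U b))
    (hq : ∀ b k, IsQBC (q b k))
    (hB : ScalesAs (fun P => ((S.card * B P : ℕ) : ℝ)) ((N : ℝ) * ((N : ℝ) - M)))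
    (hw : ∀ P, 0 < P → IsZeroForcingPrecoder S
        (fun k ω => U (B P) k (q (B P) k (fun i => U (B P) k i ω) (channel (R k) (Ht k ω))).2 ω)
        (w P)) {k : Fin K} (hk : k ∈ S)
    (hint : ∀ P, 0 < P → Integrable
      (fun ω => rateZFC S P (channel (R k) (Ht k ω))
        (q (B P) k (fun i => U (B P) k i ω) (channel (R k) (Ht k ω))).1 (fun l => w P l ω) k) μ) :
    ∃ C, ∀ᶠ P in atTop, Real.logb 2 P - C ≤
      ∫ ω, rateZFC S P (channel (R k) (Ht k ω))
        (q (B P) k (fun i => U (B P) k i ω) (channel (R k) (Ht k ω))).1 (fun l => w P l ω) k ∂μ := by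
  have hl2 : 0 < Real.log 2 := Real.log_pos one_lt_two
  have hN : 0 < N := by omega
  have hScard : 0 < S.card := Finset.card_pos.2 ⟨k, hk⟩
  set A := CFC.sqrt (R k) with hAdef
  have hA : A.det ≠ 0 := det_sqrt_ne_zero (hR k)
  have hf : 0 ≤ frobSq A := frobSq_nonneg A
  obtain ⟨W₀, hW₀⟩ := exists_semiUnitary hMN.le
  obtain ⟨C₁, hC₁, hint₁⟩ := exists_interference_bound (μ := μ) (d := 1) hHt le_rfl hM hMN hA k
  obtain ⟨C₂, hC₂, hscale⟩ := hB.exists_bound hMN ((one_mul _).trans hS)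
  have htop : negMomentBound * (N : ℝ≥0∞) ≠ ⊤ :=
    ENNReal.mul_ne_top negMomentBound_ne_top (ENNReal.natCast_ne_top N)
  set E₁ : ℝ≥0∞ := ‖A.det‖ₑ⁻¹ * (negMomentBound * N) ^ M with hE₁
  have hE₁top : E₁ ≠ ⊤ := ENNReal.mul_ne_top
    (ENNReal.inv_ne_top.2 (enorm_ne_zero.2 hA)) (ENNReal.pow_ne_top htop)
  set E₂ : ℝ≥0∞ := (negMomentBound * N) ^ 1 with hE₂
  have hE₂top : E₂ ≠ ⊤ := ENNReal.pow_ne_top htop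
  set E₄ : ℝ≥0∞ := negMomentBound * M / invNormMoment M with hE₄
  have hE₄top : E₄ ≠ ⊤ := ENNReal.div_ne_top
    (ENNReal.mul_ne_top negMomentBound_ne_top (ENNReal.natCast_ne_top M)) (invNormMoment_ne_zero M)
  set E₃ := ∫ ω, frobSq (Ht k ω) ∂μ with hE₃
  have hdm : Measurable fun ω => (A * Ht k ω * W₀).det :=
    measurable_det.comp ((measurable_const.matrixMul (hHt.measurable k)).matrixMul
      measurable_const)
  obtain ⟨hd0, hL₁⟩ := integrable_inv_norm hdm hE₁top (hHt.lintegral_det_le hN k A hW₀)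
  refine ⟨-((-Real.log N - 2 * Real.log (M * M.factorial) -
    (2 * E₁.toReal + 2 * E₂.toReal + (2 * M * frobSq A + 1) * E₃ + 2 * E₄.toReal +
      frobSq A * (C₁ * C₂))) / Real.log 2), ?_⟩
  filter_upwards [hscale, eventually_ge_atTop 1] with P hP hP1
  have hP0 : 0 < P := by linarith
  have hn : NeZero (2 ^ B P) := ⟨by positivity⟩
  have hUP := hU (B P)
  let s : Fin K → (Fin (2 ^ B P) → Matrix (Fin N) (Fin 1) ℂ) → Matrix (Fin M) (Fin N) ℂ →
    Fin (2 ^ B P) := fun l C G => (q (B P) l C (channel (R l) G)).2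
  have hs : ∀ l, Measurable fun p : (Fin (2 ^ B P) → Matrix (Fin N) (Fin 1) ℂ) ×
      Matrix (Fin M) (Fin N) ℂ => s l p.1 p.2 := by
    intro l
    have h1 := measurable_snd.comp ((hq (B P) l).measurable.comp
      (measurable_fst.prodMk ((measurable_channel (R l)).comp measurable_snd)))
    exact h1
  obtain ⟨O, hO, hOW, hind⟩ := (hw P hP0).exists_indep_projection hHt hUP hs
    ((one_mul _).trans hS) hk
  -- One row of the channel suffices: its product with the precoder bounds from below the part of
  -- the precoder in the row space.
  set i₀ : Fin M := ⟨0, hM⟩ with hi₀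
  have hrow := hHt.row i₀
  have hrm := hrow.measurable k
  have hxm : Measurable fun ω =>
      ((Ht k ω).submatrix (fun _ : Fin 1 => i₀) id * w P k ω).det :=
    measurable_det.comp (hrm.matrixMul ((hw P hP0).measurable k hk))
  have hsub : Measurable fun p : Matrix (Fin M) (Fin N) ℂ ×
      (Fin (2 ^ B P) → Matrix (Fin N) (Fin 1) ℂ) => p.1.submatrix (fun _ : Fin 1 => i₀) id :=
    measurable_pi_lambda _ fun _ => measurable_pi_lambda _ fun j =>
      measurable_fst.matrixElem i₀ j
  obtain ⟨hx0, hL₂⟩ := integrable_inv_norm hxm hE₂top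
    (lintegral_det_mul_le_of_indepFun hN hrm (hrow.map_eq k) hO
      (hind.comp hsub measurable_id) ((hw P hP0).semiUnitary k hk) hOW)
  have hL₃ : Integrable (fun ω => frobSq (Ht k ω)) μ ∧ ∫ ω, frobSq (Ht k ω) ∂μ ≤ E₃ :=
    ⟨hHt.integrable_frobSq k, le_rfl⟩
  have hawm : Measurable fun ω => alignWeight (rowProj (A * Ht k ω)) (O ω)
      (fun i => U (B P) k i ω) := by
    have h1 := (measurable_alignWeight_joint (N := N) (n := 2 ^ B P) A).comp
      (hO.prodMk ((hHt.measurable k).prodMk (hUP.measurable_codebook k)))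
    exact h1
  have hawl := lintegral_alignWeight_random_le hHt hUP hM hMN hA k hO hind hOW
  have hawfin := ae_lt_top hawm (ne_top_of_le_ne_top hE₄top hawl)
  have hL₄ := integrable_of_lintegral_le hawm.ennreal_toReal
    (Eventually.of_forall fun ω => ENNReal.toReal_nonneg) hE₄top
    ((lintegral_mono fun ω => ENNReal.ofReal_toReal_le).trans hawl)
  have hJ := integrable_interference hHt hMN hA k hUP (by positivity)
    (hint₁ (2 ^ B P) (by positivity) (U (B P)) hUP)
  have hmain := le_integral_of_ae_le (a := Real.log P - Real.log N -
    2 * Real.log (M * M.factorial)) hl2 (hint P hP0) hL₁ hL₂ hL₃ hL₄ hJ (α₁ := 2) (α₂ := 2)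
    (α₃ := 2 * M * frobSq A + 1) (α₄ := 2) (α₅ := P * frobSq A) (by norm_num) (by norm_num)
    (by positivity) (by norm_num) (by positivity) (by
      filter_upwards [hd0, hx0, hawfin, hOW, ae_trace_rowProj_ne_zero hHt hUP hM hMN hA k 0] with
        ω hω hxω hfinω hOω hjω
      have hxeq : ((Ht k ω).submatrix (fun _ : Fin 1 => i₀) id * w P k ω).det =
          (Ht k ω * w P k ω) i₀ 0 := by
        rw [Matrix.det_fin_one]; rfl
      rw [hxeq] at hxω ⊢
      rw [hOω] at hfinω ⊢
      obtain ⟨hs0, hgain⟩ := (hq (B P) k).log_gain_ge (C := fun i => U (B P) k i ω)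
        (fun i => hUP.semiUnitary k i ω) hM hA hW₀ hω hxω hjω hfinω.ne
      refine le_trans ?_ (rateZFC_ge hk hP0 hs0)
      have hNr : (0 : ℝ) < N := by exact_mod_cast hN
      rw [hS, Real.log_div hP0.ne' hNr.ne']
      set J := frobSq (Ht k ω) * ⨅ i, (((1 : ℕ) : ℝ) - (rowProj (A * Ht k ω) *
        (U (B P) k i ω * (U (B P) k i ω)ᴴ)).trace.re) with hJdef
      set c := (q (B P) k (fun i => U (B P) k i ω) (A * Ht k ω)).1 with hc
      have h2 : ∀ l ∈ S.erase k, ‖(cᴴ * (A * Ht k ω) * w P l ω) 0 0‖ ^ 2 ≤ frobSq A * J := by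
        intro l hl
        have hlS := Finset.mem_of_mem_erase hl
        exact (hq (B P) k).norm_sq_le (C := fun i => U (B P) k i ω)
          (fun i => hUP.semiUnitary k i ω) hω ((hw P hP0).semiUnitary l hlS ω)
          ((hw P hP0).orthogonal l hlS k hk (Finset.ne_of_mem_erase hl).symm ω)
      have h3 : ∑ l ∈ S.erase k, ‖(cᴴ * (A * Ht k ω) * w P l ω) 0 0‖ ^ 2 ≤
          N * (frobSq A * J) := by
        have hJ0 : 0 ≤ frobSq A * J := by
          obtain ⟨V, hV, -, -, -, hproj⟩ := exists_rowProj_factor hω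
          refine mul_nonneg hf (mul_nonneg (frobSq_nonneg _) (le_ciInf fun i => ?_))
          rw [hproj, trace_rowProj_mul]
          exact sub_frobSq_nonneg (hUP.semiUnitary k i ω) hV
        refine (Finset.sum_le_card_nsmul _ _ _ h2).trans ?_
        rw [nsmul_eq_mul]
        refine mul_le_mul_of_nonneg_right ?_ hJ0
        rw [← hS]
        exact_mod_cast Finset.card_le_card (Finset.erase_subset k S)
      have h4 : P / N * ∑ l ∈ S.erase k, ‖(cᴴ * (A * Ht k ω) * w P l ω) 0 0‖ ^ 2 ≤
          P * frobSq A * J := by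
        rw [mul_assoc]
        exact div_mul_le_mul hP0.le hNr le_rfl (by positivity) h3
      have h5 : 2 * M * frobSq (A * Ht k ω) ≤ 2 * M * frobSq A * frobSq (Ht k ω) := by
        rw [mul_assoc (2 * (M : ℝ))]
        exact mul_le_mul_of_nonneg_left (frobSq_mul_le A (Ht k ω)) (by positivity)
      refine div_le_div_of_nonneg_right ?_ hl2.le
      show _ ≤ Real.log P - Real.log N + Real.log (‖(cᴴ * (A * Ht k ω) * w P k ω) 0 0‖ ^ 2) -
        P / N * ∑ l ∈ S.erase k, ‖(cᴴ * (A * Ht k ω) * w P l ω) 0 0‖ ^ 2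
      linarith)
  refine le_trans ?_ hmain
  rw [sub_neg_eq_add, Real.logb, ← add_div]
  refine div_le_div_of_nonneg_right ?_ hl2.le
  have h5 : P * frobSq A * (C₁ * ((2 ^ B P : ℕ) : ℝ) ^ (-1 / ((1 * (N - M) : ℕ) : ℝ))) ≤
      frobSq A * (C₁ * C₂) := by
    have : P * frobSq A * (C₁ * ((2 ^ B P : ℕ) : ℝ) ^ (-1 / ((1 * (N - M) : ℕ) : ℝ))) =
        frobSq A * (C₁ * (P * ((2 ^ B P : ℕ) : ℝ) ^ (-1 / ((1 * (N - M) : ℕ) : ℝ)))) := by ring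
    rw [this]
    gcongr
  linarith

end Combining

/-! ### Sum rates of both strategies -/

section SumRates

variable {Ω : Type*} [MeasurableSpace Ω] {μ : Measure Ω} [IsProbabilityMeasure μ] {K M N : ℕ}
  {Ht : Fin K → Ω → Matrix (Fin M) (Fin N) ℂ} {R : Fin K → Matrix (Fin M) (Fin M) ℂ}
  {S : Finset (Fin K)} {B : ℝ → ℕ}

lemma frobSq_channel_le (R : Matrix (Fin M) (Fin M) ℂ) (G : Matrix (Fin M) (Fin N) ℂ) :
    frobSq (channel R G) ≤ frobSq (CFC.sqrt R) * frobSq G :=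
  frobSq_mul_le _ _

lemma average_signal_le (hM : 1 ≤ M) (hS : S.Nonempty) (H : Matrix (Fin M) (Fin N) ℂ)
    {W : Fin K → Matrix (Fin N) (Fin M) ℂ} (hW : ∀ l ∈ S, IsSemiUnitary (W l)) :
    1 / (M * S.card : ℝ) * ∑ l ∈ S, frobSq (H * W l) / Real.log 2 ≤ frobSq H / Real.log 2 := by
  have hl2 : 0 < Real.log 2 := Real.log_pos one_lt_two
  have hc : (0 : ℝ) < S.card := by exact_mod_cast Finset.card_pos.2 hS
  have hM0 : (0 : ℝ) < M := by exact_mod_cast hM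
  have h1 : ∀ l ∈ S, frobSq (H * W l) / Real.log 2 ≤ frobSq H * M / Real.log 2 := by
    intro l hl
    have h2 := frobSq_mul_le H (W l)
    rw [frobSq_of_semiUnitary (hW l hl), Fintype.card_fin] at h2
    exact div_le_div_of_nonneg_right h2 hl2.le
  have h3 := Finset.sum_le_card_nsmul S _ _ h1
  rw [nsmul_eq_mul] at h3
  calc _ ≤ 1 / (M * S.card : ℝ) * (S.card * (frobSq H * M / Real.log 2)) := by gcongr
    _ = _ := by field_simp

lemma integrable_of_nonneg_of_le_mul {f Z : Ω → ℝ} {P : ℝ} (hf : Measurable f) (h0 : ∀ ω, 0 ≤ f ω)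
    (hZ : Integrable Z μ) (h : ∀ ω, f ω ≤ P * Z ω) : Integrable f μ :=
  (hZ.const_mul P).mono' hf.aestronglyMeasurable
    (Eventually.of_forall fun ω => by rw [Real.norm_of_nonneg (h0 ω)]; exact h ω)

/-- Block-diagonalization achieves the full multiplexing gain. -/
lemma achievesMultiplexingGain_rateBD {U : (b : ℕ) → Fin K → Fin (2 ^ b) → Ω →
      Matrix (Fin N) (Fin M) ℂ}
    {q : (b : ℕ) → Fin K → (Fin (2 ^ b) → Matrix (Fin N) (Fin M) ℂ) →
        Matrix (Fin M) (Fin N) ℂ → Fin (2 ^ b)}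
    {W : ℝ → Fin K → Ω → Matrix (Fin N) (Fin M) ℂ}
    (hM : 1 ≤ M) (hMN : M < N) (hR : ∀ k, (R k).PosDef)
    (hHt : IsRayleighFading μ Ht) (hS : M * S.card = N) (hU : ∀ b, IsRVQ μ Ht (U b))
    (hq : ∀ b k, IsChordalQuantizer (q b k))
    (hB : ScalesAs (fun P => ((S.card * B P : ℕ) : ℝ)) ((N : ℝ) * ((N : ℝ) - M)))
    (hW : ∀ P, 0 < P → IsZeroForcingPrecoder S
        (fun k ω => U (B P) k (q (B P) k (fun i => U (B P) k i ω) (channel (R k) (Ht k ω))) ω)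
        (W P)) :
    AchievesMultiplexingGain μ
      (fun P ω => ∑ k ∈ S, rateBD S P (channel (R k) (Ht k ω)) (fun l => W P l ω) k) N := by
  have hl2 : 0 < Real.log 2 := Real.log_pos one_lt_two
  have hH : ∀ k, Measurable fun ω => channel (R k) (Ht k ω) := fun k =>
    (measurable_channel (R k)).comp (hHt.measurable k)
  have hm : ∀ k ∈ S, ∀ P, 0 < P → Measurable fun ω =>
      rateBD S P (channel (R k) (Ht k ω)) (fun l => W P l ω) k := fun k _ P hP =>
    measurable_rateBD P (hH k) (hW P hP).measurable k
  have h0 : ∀ k ∈ S, ∀ P, 0 < P → ∀ ω,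
      0 ≤ rateBD S P (channel (R k) (Ht k ω)) (fun l => W P l ω) k := fun k hk P hP ω =>
    rateBD_nonneg hk hP.le
  have hZ : ∀ k ∈ S, Integrable
      (fun ω => frobSq (CFC.sqrt (R k)) * frobSq (Ht k ω) / Real.log 2) μ := fun k _ =>
    ((hHt.integrable_frobSq k).const_mul _).div_const _
  have hsig : ∀ k ∈ S, ∀ P, 0 < P → ∀ ω,
      1 / (M * S.card : ℝ) * ∑ l ∈ S, frobSq (channel (R k) (Ht k ω) * W P l ω) / Real.log 2 ≤
        frobSq (CFC.sqrt (R k)) * frobSq (Ht k ω) / Real.log 2 := fun k hk P hP ω =>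
    (average_signal_le hM ⟨k, hk⟩ _ fun l hl => (hW P hP).semiUnitary l hl ω).trans
      (div_le_div_of_nonneg_right (frobSq_channel_le _ _) hl2.le)
  have hub : ∀ k ∈ S, ∀ P, 0 < P → ∀ ω,
      rateBD S P (channel (R k) (Ht k ω)) (fun l => W P l ω) k ≤
        P * (frobSq (CFC.sqrt (R k)) * frobSq (Ht k ω) / Real.log 2) := by
    intro k hk P hP ω
    refine (rateBD_le hP.le).trans ?_
    rw [← mul_one_div P, mul_assoc]
    exact mul_le_mul_of_nonneg_left (hsig k hk P hP ω) hP.le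
  refine achievesMultiplexingGain_of_bounds hS hm h0 hZ hub (fun k hk P hP ω => ?_) fun k hk =>
    exists_le_integral_rateBD hM hMN hR hHt hS hU hq hB hW hk fun P hP =>
      integrable_of_nonneg_of_le_mul (hm k hk P hP) (h0 k hk P hP) (hZ k hk) (hub k hk P hP)
  exact (rateBD_le_of_one_le hP).trans
    (add_le_add_right (hsig k hk P (zero_lt_one.trans_le hP) ω) _)

/-- Zero-forcing with combining achieves the full multiplexing gain. -/
lemma achievesMultiplexingGain_rateZFC {U : (b : ℕ) → Fin K → Fin (2 ^ b) → Ω →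
      Matrix (Fin N) (Fin 1) ℂ}
    {q : (b : ℕ) → Fin K → (Fin (2 ^ b) → Matrix (Fin N) (Fin 1) ℂ) →
        Matrix (Fin M) (Fin N) ℂ → Matrix (Fin M) (Fin 1) ℂ × Fin (2 ^ b)}
    {w : ℝ → Fin K → Ω → Matrix (Fin N) (Fin 1) ℂ}
    (hM : 1 ≤ M) (hMN : M < N) (hR : ∀ k, (R k).PosDef)
    (hHt : IsRayleighFading μ Ht) (hS : S.card = N) (hU : ∀ b, IsRVQ μ Ht (U b))
    (hq : ∀ b k, IsQBC (q b k))
    (hB : ScalesAs (fun P => ((S.card * B P : ℕ) : ℝ)) ((N : ℝ) * ((N : ℝ) - M)))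
    (hw : ∀ P, 0 < P → IsZeroForcingPrecoder S
        (fun k ω => U (B P) k (q (B P) k (fun i => U (B P) k i ω) (channel (R k) (Ht k ω))).2 ω)
        (w P)) :
    AchievesMultiplexingGain μ
      (fun P ω => ∑ k ∈ S, rateZFC S P (channel (R k) (Ht k ω))
        (q (B P) k (fun i => U (B P) k i ω) (channel (R k) (Ht k ω))).1 (fun l => w P l ω) k) N := by
  have hl2 : 0 < Real.log 2 := Real.log_pos one_lt_two
  have hH : ∀ k, Measurable fun ω => channel (R k) (Ht k ω) := fun k =>
    (measurable_channel (R k)).comp (hHt.measurable k)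
  have hm : ∀ k ∈ S, ∀ P, 0 < P → Measurable fun ω => rateZFC S P (channel (R k) (Ht k ω))
      (q (B P) k (fun i => U (B P) k i ω) (channel (R k) (Ht k ω))).1 (fun l => w P l ω) k := by
    intro k hk P hP
    have h1 := (hq (B P) k).measurable.comp (((hU (B P)).measurable_codebook k).prodMk (hH k))
    exact measurable_rateZFC P (hH k) h1.fst (hw P hP).measurable hk
  have h0 : ∀ k ∈ S, ∀ P, 0 < P → ∀ ω, 0 ≤ rateZFC S P (channel (R k) (Ht k ω))
      (q (B P) k (fun i => U (B P) k i ω) (channel (R k) (Ht k ω))).1 (fun l => w P l ω) k :=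
    fun k hk P hP ω => rateZFC_nonneg hP.le
  have hZ : ∀ k ∈ S, Integrable
      (fun ω => frobSq (CFC.sqrt (R k)) * frobSq (Ht k ω) / Real.log 2) μ := fun k _ =>
    ((hHt.integrable_frobSq k).const_mul _).div_const _
  have hsig : ∀ k ∈ S, ∀ P, 0 < P → ∀ ω,
      1 / (S.card : ℝ) * ‖((q (B P) k (fun i => U (B P) k i ω) (channel (R k) (Ht k ω))).1ᴴ *
        channel (R k) (Ht k ω) * w P k ω) 0 0‖ ^ 2 / Real.log 2 ≤
        frobSq (CFC.sqrt (R k)) * frobSq (Ht k ω) / Real.log 2 := by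
    intro k hk P hP ω
    have hc : (1 : ℝ) ≤ S.card := by exact_mod_cast Finset.card_pos.2 ⟨k, hk⟩
    refine div_le_div_of_nonneg_right ?_ hl2.le
    refine (mul_le_of_le_one_left (by positivity) (div_le_one_of_le₀ hc (by positivity))).trans ?_
    exact (norm_combined_sq_le ((hq _ k).unit _ _) ((hw P hP).semiUnitary k hk ω)).trans
      (frobSq_channel_le _ _)
  have hub : ∀ k ∈ S, ∀ P, 0 < P → ∀ ω, rateZFC S P (channel (R k) (Ht k ω))
      (q (B P) k (fun i => U (B P) k i ω) (channel (R k) (Ht k ω))).1 (fun l => w P l ω) k ≤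
        P * (frobSq (CFC.sqrt (R k)) * frobSq (Ht k ω) / Real.log 2) := by
    intro k hk P hP ω
    refine (rateZFC_le hP.le).trans ?_
    rw [← mul_one_div P, mul_assoc, mul_div_assoc]
    exact mul_le_mul_of_nonneg_left (hsig k hk P hP ω) hP.le
  refine achievesMultiplexingGain_of_bounds (d := 1) ((one_mul _).trans hS) hm h0 hZ hub
    (fun k hk P hP ω => ?_) fun k hk => ?_
  · rw [Nat.cast_one, one_mul]
    exact (rateZFC_le_of_one_le hP).trans
      (add_le_add_right (hsig k hk P (zero_lt_one.trans_le hP) ω) _)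
  · simp only [Nat.cast_one, one_mul]
    exact exists_le_integral_rateZFC hM hMN hR hHt hS hU hq hB hw hk fun P hP =>
      integrable_of_nonneg_of_le_mul (hm k hk P hP) (h0 k hk P hP) (hZ k hk) (hub k hk P hP)

end SumRates

end LimitedFeedback

end

theorem corollary1 {Ω : Type*} [MeasurableSpace Ω] (μ : Measure Ω) [IsProbabilityMeasure μ]
    (N M K : ℕ) (hM : 1 ≤ M) (hMN : M < N)
    -- receive correlation matrices and channels
    (R : Fin K → Matrix (Fin M) (Fin M) ℂ) (hR : ∀ k, (R k).PosDef)
    (Ht : Fin K → Ω → Matrix (Fin M) (Fin N) ℂ) (hHt : LimitedFeedback.IsRayleighFading μ Ht) :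
    -- block-diagonalization, `N / M` scheduled users, `B P` feedback bits per user
    (∀ (S : Finset (Fin K)), M * S.card = N →
      ∀ (U : (b : ℕ) → Fin K → Fin (2 ^ b) → Ω → Matrix (Fin N) (Fin M) ℂ),
      (∀ b, LimitedFeedback.IsRVQ μ Ht (U b)) →
      ∀ (q : (b : ℕ) → Fin K → (Fin (2 ^ b) → Matrix (Fin N) (Fin M) ℂ) →
        Matrix (Fin M) (Fin N) ℂ → Fin (2 ^ b)),
      (∀ b k, LimitedFeedback.IsChordalQuantizer (q b k)) →
      ∀ (B : ℝ → ℕ),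
      LimitedFeedback.ScalesAs (fun P => ((∑ _k ∈ S, B P : ℕ) : ℝ)) ((N : ℝ) * ((N : ℝ) - M)) →
      ∀ (W : ℝ → Fin K → Ω → Matrix (Fin N) (Fin M) ℂ),
      (∀ P, 0 < P → LimitedFeedback.IsZeroForcingPrecoder S
        (fun k ω => U (B P) k
          (q (B P) k (fun i => U (B P) k i ω) (LimitedFeedback.channel (R k) (Ht k ω))) ω)
        (W P)) →
      LimitedFeedback.AchievesMultiplexingGain μ
        (fun P ω => ∑ k ∈ S, LimitedFeedback.rateBD S P
          (LimitedFeedback.channel (R k) (Ht k ω)) (fun l => W P l ω) k) N) ∧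
    -- zero-forcing with (quantization-based) combining, `N` scheduled users, `B P` bits per user
    (∀ (S : Finset (Fin K)), S.card = N →
      ∀ (U : (b : ℕ) → Fin K → Fin (2 ^ b) → Ω → Matrix (Fin N) (Fin 1) ℂ),
      (∀ b, LimitedFeedback.IsRVQ μ Ht (U b)) →
      ∀ (q : (b : ℕ) → Fin K → (Fin (2 ^ b) → Matrix (Fin N) (Fin 1) ℂ) →
        Matrix (Fin M) (Fin N) ℂ → Matrix (Fin M) (Fin 1) ℂ × Fin (2 ^ b)),
      (∀ b k, LimitedFeedback.IsQBC (q b k)) →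
      ∀ (B : ℝ → ℕ),
      LimitedFeedback.ScalesAs (fun P => ((∑ _k ∈ S, B P : ℕ) : ℝ)) ((N : ℝ) * ((N : ℝ) - M)) →
      ∀ (w : ℝ → Fin K → Ω → Matrix (Fin N) (Fin 1) ℂ),
      (∀ P, 0 < P → LimitedFeedback.IsZeroForcingPrecoder S
        (fun k ω => U (B P) k
          (q (B P) k (fun i => U (B P) k i ω) (LimitedFeedback.channel (R k) (Ht k ω))).2 ω)
        (w P)) →
      LimitedFeedback.AchievesMultiplexingGain μ
        (fun P ω => ∑ k ∈ S, LimitedFeedback.rateZFC S P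
          (LimitedFeedback.channel (R k) (Ht k ω))
          (q (B P) k (fun i => U (B P) k i ω) (LimitedFeedback.channel (R k) (Ht k ω))).1
          (fun l => w P l ω) k) N) := by
  simp only [Finset.sum_const, smul_eq_mul]
  exact ⟨fun S hS U hU q hq B hB W hW =>
      LimitedFeedback.achievesMultiplexingGain_rateBD hM hMN hR hHt hS hU hq hB hW,
    fun S hS U hU q hq B hB w hw =>
      LimitedFeedback.achievesMultiplexingGain_rateZFC hM hMN hR hHt hS hU hq hB hw⟩
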